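/- Let $(\Omega,\omega)$ be a symplectic manifold of dimension $2n$, $n\ge 2$ (Hausdorff, second countable, without boundary), and let $H\colon\Omega\to\mathbb R$ be smooth, with Hamiltonian vector field $X_H$ defined by $\omega(X_H,\cdot)=dH$. A section is a $(2n-1)$-dimensional smooth embedded submanifold of $\Omega$ to which $X_H$ is nowhere tangent. Let $\Sigma_0,\Sigma_1$ be two sections such that for every $x\in\Sigma_0$ the trajectory of $X_H$ starting at $x$ meets $\Sigma_1$ at some positive time; let $\tau(x)>0$ be the first such time and $R_H(x)\in\Sigma_1$ the corresponding point, and suppose that the Poincaré map $R_H\colon\Sigma_0\to\Sigma_1$ is a diffeomorphism. Let $y_0\in\Sigma_0$, assume that $\tau\colon\Sigma_0\to(0,\infty)$ is continuous at $y_0$, and let $x_0$ be a point of the trajectory of $y_0$ lying strictly between $y_0$ and $R_H(y_0)$ (that is, reached at a time in $(0,\tau(y_0))$). Put $h=H(x_0)$, $\Sigma_i^h=\Sigma_i\cap H^{-1}(h)$ (symplectic submanifolds of dimension $2n-2$) and $R_H^h=R_H|_{\Sigma_0^h}\colon\Sigma_0^h\to\Sigma_1^h$. Then for every neighborhood $U$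 of $x_0$ in $\Omega$ there exists a neighborhood $V^h$ of $y_0$ in $\Sigma_0^h$ such that for every neighborhood $\mathcal H$ of $H$ in $C^\infty(\Omega,\mathbb R)$ there exists a neighborhood $\mathcal R^h$ of $R_H^h$ in $C^\infty(\Sigma_0^h,\Sigma_1^h)$ such that the following holds. For every smooth map $\widetilde R^h\in\mathcal R^h$ from $\Sigma_0^h$ to $\Sigma_1^h$ that preserves the restrictions of $\omega$ to the slices and satisfies $\widetilde R^h=R_H^h$ outside $V^h$, there exists $\widetilde H\in\mathcal H$ such that $\widetilde H=H$ on $H^{-1}(h)\setminus U$ and $\widetilde R^h=R^h_{\widetilde H}$; that is, $\Sigma_0$ and $\Sigma_1$ are sections also for $\widetilde H$, $\Sigma_i\cap\widetilde H^{-1}(h)=\Sigma_i^h$ for $i=0,1$, and for every $x\in\Sigma_0^h$ the trajectory of $X_{\widetilde H}$ starting at $x$ meets $\Sigma_1$ at a positive time, for the first time at the point $\widetilde R^h(x)$. Here neighborhoods of $H$ are taken in the strong (Whitney) $C^\infty$ topology and neighborhoods of $R_H^h$ in the weak (compact-open) $C^\infty$ topology; a fortiori the statement holds if both spaces carry the strong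 topology, and also if both carry the weak one. -/

import Mathlib

open scoped Manifold ContDiff Topology
open Set

namespace PoincareSection

/-- The model space `ℝᵈ` with its Euclidean norm. -/
abbrev Euc (d : ℕ) : Type := EuclideanSpace ℝ (Fin d)

variable {d : ℕ} {Ω : Type*} [TopologicalSpace Ω] [ChartedSpace (Euc d) Ω]

/-! ### Symplectic forms and Hamiltonian vector fields -/

/-- A (not necessarily smooth) differential 2-form on `Ω`. -/
abbrev TwoForm (d : ℕ) (Ω : Type*) [TopologicalSpace Ω] [ChartedSpace (Euc d) Ω] : Type _ :=
  ∀ x : Ω, (TangentSpace (𝓡 d) x) [⋀^Fin 2]→L[ℝ] ℝ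

/-- The expression of a 2-form in a chart `e`: the pullback of the form under `e.symm`. -/
noncomputable def TwoForm.inChart (σ : TwoForm d Ω) (e : OpenPartialHomeomorph Ω (Euc d))
    (z : Euc d) : (Euc d) [⋀^Fin 2]→L[ℝ] ℝ :=
  (σ (e.symm z)).compContinuousLinearMap (mfderiv (𝓡 d) (𝓡 d) e.symm z)

/-- A symplectic form: a smooth, closed, nondegenerate 2-form. -/
structure IsSymplecticForm (σ : TwoForm d Ω) : Prop where
  smooth : ∀ e ∈ IsManifold.maximalAtlas (𝓡 d) ∞ Ω, ContDiffOn ℝ ∞ (σ.inChart e) e.target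
  closed : ∀ e ∈ IsManifold.maximalAtlas (𝓡 d) ∞ Ω, ∀ z ∈ e.target, extDeriv (σ.inChart e) z = 0
  nondegenerate : ∀ (x : Ω) (v : TangentSpace (𝓡 d) x),
    (∀ w : TangentSpace (𝓡 d) x, σ x ![v, w] = 0) → v = 0

/-- The differential of a real function at `x`, as a real-valued functional. -/
noncomputable def dAt (H : Ω → ℝ) (x : Ω) (v : TangentSpace (𝓡 d) x) : ℝ :=
  mfderiv (𝓡 d) 𝓘(ℝ, ℝ) H x v

/-- The Hamiltonian vector field `X_H`: the solution of `σ(X_H, v) = dH(v)` for all `v`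
(unique when `σ` is nondegenerate, see `hamiltonianVectorField_eq_iff`). -/
noncomputable def hamiltonianVectorField (σ : TwoForm d Ω) (H : Ω → ℝ) (x : Ω) :
    TangentSpace (𝓡 d) x :=
  Classical.epsilon fun X : TangentSpace (𝓡 d) x =>
    ∀ v : TangentSpace (𝓡 d) x, σ x ![X, v] = dAt H x v

theorem update_pair_zero {E : Type*} (a v c : E) : Function.update ![a, v] 0 c = ![c, v] := by
  ext i
  fin_cases i <;> rfl

theorem update_pair_one {E : Type*} (a v c : E) : Function.update ![a, v] 1 c = ![a, c] := by
  ext i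
  fin_cases i <;> rfl

theorem hamiltonianVectorField_spec {σ : TwoForm d Ω} (hσ : IsSymplecticForm σ) (H : Ω → ℝ)
    (x : Ω) (v : TangentSpace (𝓡 d) x) :
    σ x ![hamiltonianVectorField σ H x, v] = dAt H x v := by
  have key : ∃ X : TangentSpace (𝓡 d) x, ∀ v : TangentSpace (𝓡 d) x,
      σ x ![X, v] = dAt H x v := by
    have hadd : ∀ a b v : TangentSpace (𝓡 d) x, σ x ![a + b, v] = σ x ![a, v] + σ x ![b, v] := by
      intro a b v
      have := (σ x).map_update_add ![a, v] 0 a b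
      rwa [update_pair_zero, update_pair_zero, update_pair_zero] at this
    have hsmul : ∀ (c : ℝ) (a v : TangentSpace (𝓡 d) x), σ x ![c • a, v] = c * σ x ![a, v] := by
      intro c a v
      have := (σ x).map_update_smul ![a, v] 0 c a
      rwa [update_pair_zero, update_pair_zero] at this
    have hadd2 : ∀ a b v : TangentSpace (𝓡 d) x, σ x ![v, a + b] = σ x ![v, a] + σ x ![v, b] := by
      intro a b v
      have := (σ x).map_update_add ![v, a] 1 a b
      rwa [update_pair_one, update_pair_one, update_pair_one] at this
    have hsmul2 : ∀ (c : ℝ) (a v : TangentSpace (𝓡 d) x), σ x ![v, c • a] = c * σ x ![v, a] := by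
      intro c a v
      have := (σ x).map_update_smul ![v, a] 1 c a
      rwa [update_pair_one, update_pair_one] at this
    let B : TangentSpace (𝓡 d) x →ₗ[ℝ] Module.Dual ℝ (TangentSpace (𝓡 d) x) :=
      LinearMap.mk₂ ℝ (fun a b => σ x ![a, b]) hadd hsmul
        (fun v a b => hadd2 a b v) (fun c v a => hsmul2 c a v)
    have : FiniteDimensional ℝ (TangentSpace (𝓡 d) x) :=
      inferInstanceAs (FiniteDimensional ℝ (Euc d))
    have hinj : Function.Injective B := by
      rw [injective_iff_map_eq_zero]
      intro a ha
      exact hσ.nondegenerate x a fun w => by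
        have := congrArg (fun f => f w) ha
        simpa [B] using this
    have hsurj : Function.Surjective B :=
      (LinearMap.injective_iff_surjective_of_finrank_eq_finrank
        (Subspace.dual_finrank_eq).symm).1 hinj
    obtain ⟨X, hX⟩ := hsurj (mfderiv (𝓡 d) 𝓘(ℝ, ℝ) H x).toLinearMap
    exact ⟨X, fun v => congrArg (fun f => f v) hX⟩
  exact Classical.epsilon_spec key v

theorem hamiltonianVectorField_eq_iff {σ : TwoForm d Ω} (hσ : IsSymplecticForm σ) (H : Ω → ℝ)
    (x : Ω) (X : TangentSpace (𝓡 d) x) :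
    X = hamiltonianVectorField σ H x ↔
      ∀ v : TangentSpace (𝓡 d) x, σ x ![X, v] = dAt H x v := by
  constructor
  · rintro rfl v
    exact hamiltonianVectorField_spec hσ H x v
  · intro h
    rw [← sub_eq_zero]
    refine hσ.nondegenerate x _ fun w => ?_
    have h2 := (σ x).map_update_sub ![X, w] 0 X (hamiltonianVectorField σ H x)
    rw [update_pair_zero, update_pair_zero, update_pair_zero] at h2
    rw [h2, h w, hamiltonianVectorField_spec hσ H x w, sub_self]

/-! ### Embedded submanifolds -/

/-- The inclusion of `ℝᵐ` into `ℝᵈ` as the first `m` coordinates (used for `m ≤ d`). -/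
noncomputable def pad (m d : ℕ) (w : Euc m) : Euc d :=
  WithLp.toLp 2 fun i => if h : (i : ℕ) < m then w ⟨i, h⟩ else 0

/-- `e` is a smooth chart of `Ω` in which `S` is the `m`-plane `{z | zᵢ = 0 for i ≥ m}`. -/
def IsSliceChart (m : ℕ) (S : Set Ω) (e : OpenPartialHomeomorph Ω (Euc d)) : Prop :=
  e ∈ IsManifold.maximalAtlas (𝓡 d) ∞ Ω ∧
    ∀ x ∈ e.source, x ∈ S ↔ ∀ i : Fin d, m ≤ (i : ℕ) → e x i = 0

/-- `S` is a smooth embedded submanifold of `Ω` of dimension `m`. -/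
def IsSubmanifold (m : ℕ) (S : Set Ω) : Prop :=
  ∀ x ∈ S, ∃ e : OpenPartialHomeomorph Ω (Euc d), IsSliceChart m S e ∧ x ∈ e.source

/-- `v` is tangent at `x` to the `m`-dimensional submanifold `S`. -/
def IsTangent (m : ℕ) (S : Set Ω) (x : Ω) (v : TangentSpace (𝓡 d) x) : Prop :=
  ∃ e : OpenPartialHomeomorph Ω (Euc d), IsSliceChart m S e ∧ x ∈ S ∧ x ∈ e.source ∧
    ∀ i : Fin d, m ≤ (i : ℕ) → (show Euc d from mfderiv (𝓡 d) (𝓡 d) e x v) i = 0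

/-- `f` restricts to a smooth map between the submanifolds `S` and `T`. Maps `S → T` are
represented by functions `Ω → Ω` of which only the values on `S` matter. -/
def IsSmoothMap (S T : Set Ω) (f : Ω → Ω) : Prop :=
  ContMDiffOn (𝓡 d) (𝓡 d) ∞ f S ∧ MapsTo f S T

/-- `f` restricts to a diffeomorphism between the submanifolds `S` and `T`. -/
def IsDiffeoBetween (S T : Set Ω) (f : Ω → Ω) : Prop :=
  IsSmoothMap (d := d) S T f ∧ ∃ g : Ω → Ω, IsSmoothMap (d := d) T S g ∧ InvOn g f S T

/-- The smooth map `f` preserves the restriction of `σ` to the `m`-dimensional submanifold `S`.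
On vectors tangent to `S`, `mfderivWithin … f S x` is the differential of `f` restricted
to `S`. -/
def IsSymplecticOn (σ : TwoForm d Ω) (m : ℕ) (S : Set Ω) (f : Ω → Ω) : Prop :=
  ∀ x ∈ S, ∀ v w : TangentSpace (𝓡 d) x, IsTangent m S x v → IsTangent m S x w →
    σ (f x) ![mfderivWithin (𝓡 d) (𝓡 d) f S x v, mfderivWithin (𝓡 d) (𝓡 d) f S x w]
      = σ x ![v, w]

/-! ### Sections and Poincaré maps -/

/-- A section of the Hamiltonian flow of `H`: a submanifold of codimension one to which `X_H` is
nowhere tangent. -/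
def IsSection (σ : TwoForm d Ω) (H : Ω → ℝ) (S : Set Ω) : Prop :=
  IsSubmanifold (d := d) (d - 1) S ∧
    ∀ x ∈ S, ¬ IsTangent (d - 1) S x (hamiltonianVectorField σ H x)

/-- The slice of `S` by the level set `{H = h}`. -/
def slice (H : Ω → ℝ) (S : Set Ω) (h : ℝ) : Set Ω := {x ∈ S | H x = h}

/-- `γ` restricted to `[0, t]` is the piece of the `H`-trajectory of `x` up to time `t > 0`, it
ends at the point `y ∈ S`, and it does not meet `S` at times in `(0, t)`. -/
def IsFirstHitAlong (σ : TwoForm d Ω) (H : Ω → ℝ) (S : Set Ω) (γ : ℝ → Ω) (x : Ω) (t : ℝ)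
    (y : Ω) : Prop :=
  0 < t ∧ IsMIntegralCurveOn (I := 𝓡 d) γ (hamiltonianVectorField σ H) (Icc 0 t) ∧
    γ 0 = x ∧ γ t = y ∧ y ∈ S ∧ ∀ s ∈ Ioo 0 t, γ s ∉ S

/-- `y` is the first point, at time `t`, at which the positive `H`-trajectory of `x` meets `S`. -/
def IsFirstHit (σ : TwoForm d Ω) (H : Ω → ℝ) (S : Set Ω) (x : Ω) (t : ℝ) (y : Ω) : Prop :=
  ∃ γ : ℝ → Ω, IsFirstHitAlong σ H S γ x t y

/-- `x₀` lies on the `H`-trajectory of `y₀`, strictly between `y₀` and the first intersection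
point of this trajectory with `S`. -/
def IsBetween (σ : TwoForm d Ω) (H : Ω → ℝ) (S : Set Ω) (y₀ x₀ : Ω) : Prop :=
  ∃ (γ : ℝ → Ω) (t : ℝ) (y : Ω), IsFirstHitAlong σ H S γ y₀ t y ∧ ∃ s ∈ Ioo 0 t, γ s = x₀

/-- On the set `D`, the map `R` is the Poincaré map of the Hamiltonian flow of `H` to `S`. -/
def IsPoincareMapOn (σ : TwoForm d Ω) (H : Ω → ℝ) (D S : Set Ω) (R : Ω → Ω) : Prop :=
  ∀ x ∈ D, ∃ t : ℝ, IsFirstHit σ H S x t (R x)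

/-! ### The `C^∞` topologies -/

/-- `𝓗` is a neighborhood of `H` in `C^∞(Ω, ℝ)` for the strong (Whitney) `C^∞` topology: it
contains all `G` whose derivatives up to some order `r` are `εᵢ`-close to those of `H` on `Kᵢ`, for
some locally finite sequence of compact sets `Kᵢ`, each in the domain of a chart, and some
`εᵢ > 0`. -/
def IsWhitneyNhd (H : C^∞⟮𝓡 d, Ω; 𝓘(ℝ, ℝ), ℝ⟯) (𝓗 : Set (C^∞⟮𝓡 d, Ω; 𝓘(ℝ, ℝ), ℝ⟯)) : Prop :=
  ∃ (r : ℕ) (e : ℕ → OpenPartialHomeomorph Ω (Euc d)) (K : ℕ → Set Ω) (ε : ℕ → ℝ),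
    LocallyFinite K ∧
    (∀ i, e i ∈ IsManifold.maximalAtlas (𝓡 d) ∞ Ω ∧ IsCompact (K i) ∧ K i ⊆ (e i).source ∧
      0 < ε i) ∧
    ∀ G : C^∞⟮𝓡 d, Ω; 𝓘(ℝ, ℝ), ℝ⟯,
      (∀ i, ∀ k ≤ r, ∀ x ∈ K i,
        ‖iteratedFDeriv ℝ k (fun z => G ((e i).symm z) - H ((e i).symm z)) (e i x)‖ < ε i) →
      G ∈ 𝓗

/-- `𝓢` is a neighborhood of the smooth map `f` in `C^∞(S, T)`, where `S` and `T` are submanifolds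
of dimension `m`, for the weak (compact-open) `C^∞` topology: it contains all smooth `g : S → T`
which, on finitely many compact subsets `Kᵢ` of `S` and read in charts `eᵢ` of `S` and `cᵢ` of `T`
(the restrictions of slice charts), are `ε`-close to `f` together with their derivatives up to some
order `r`. -/
def IsWeakNhd (m : ℕ) (S T : Set Ω) (f : Ω → Ω) (𝓢 : Set (Ω → Ω)) : Prop :=
  ∃ (r N : ℕ) (e c : Fin N → OpenPartialHomeomorph Ω (Euc d)) (K : Fin N → Set Ω) (ε : ℝ),
    0 < ε ∧
    (∀ i, IsSliceChart m S (e i) ∧ IsSliceChart m T (c i) ∧ IsCompact (K i) ∧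
      K i ⊆ S ∩ (e i).source ∧ MapsTo f (K i) (c i).source) ∧
    ∀ g : Ω → Ω, IsSmoothMap (d := d) S T g →
      (∀ i, MapsTo g (K i) (c i).source ∧
        ∀ k ≤ r, ∀ w : Euc m, pad m d w ∈ (e i).target → (e i).symm (pad m d w) ∈ K i →
          ‖iteratedFDeriv ℝ k (fun u : Euc m =>
            c i (g ((e i).symm (pad m d u))) - c i (f ((e i).symm (pad m d u)))) w‖ < ε) →
      g ∈ 𝓢

end PoincareSection

/-!
The perturbation of `H` is written down explicitly, in coordinates in which the flow is a
translation, from a generating function of the perturbed Poincaré map.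

*Coordinates.* Near each point of the trajectory of `y₀` there are *flow charts*: coordinates
`(z, t, e)` on `Ω`, with `z ∈ ℝᵐ`, `m = 2n - 2`, in which `ω = ωZ + dt ∧ de` with a constant form `ωZ`,
`H = h + e` and hence `X_H = ∂/∂t` (`exists_isFlowChart`, from Darboux's theorem relative to `H`,
`exists_darboux`, which rests on the flow box theorem and on Moser's argument). Flow charts can be
transported by the flow, so that the same `(z, e)` labels a trajectory at `y₀`, at `x₀` and at the end
point `R y₀` (`exists_flowTube_of_trajectory`). Sliding the charts at the two ends along the flow onto
the sections gives charts of the sections, which restrict on the slices to coordinates `z` in which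
`ω` is `ωZ`. In these labels `R` is the identity, and, by the continuity of `τ` at `y₀` and the
injectivity of `R`, the trajectories with labels near zero cross the chart at `x₀` exactly once, in a
straight line (`exists_passage_charts`, `IsFirstHitAlong.eq_of_meet_of_injOn`).

*Model.* In the labels, a map `R'` that is close to `R` and equal to it outside `V` is a symplectic map
`z ↦ z + a(z)` of `ℝᵐ` with `a` small and supported in a ball. The 1-form
`u ↦ ωZ(a(x), u + a'(x) u / 2)` is closed, precisely because this map is symplectic; let `S` be its
primitive, normalized to vanish outside the ball (`hasFDerivAt_genFun`, `genFun_eq_of_norm_lt`; the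
complement of the ball is connected because `m ≥ 2`). Let `β` go from `0` to `1` on a short time interval
and put `K(t, y) = β'(t) S(x)` where `y = x + (1 + β(t)) / 2 • a(x)`. The Hamiltonian `e + K(t, z)` has
the solutions

  `z = x + (1 + β) / 2 • a(x)`, `e = -K(t, z)`, where `x(t)` is given by `x + (1 - β) / 2 • a(x) = q`,

which go from `z = q` to `z = q + a(q)` on the energy level zero (`form_identity`,
`hasDerivAt_modelCurve`). As `K` is small, these solutions stay in the region where a cut-off function
`χ(e)` equals `1`, so that `χ(e) K(t, z)` has the same effect and is supported in a small box around
`x₀`. Then `H' = H + χ K` moves the trajectory labelled `q` to the one labelled `q + a(q)`, and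
leaves alone the trajectories on the level `h` that avoid the box (`IsPassage.isPoincareMapOn`).

*Size.* It remains to see that `H'` is close to `H` when `R'` is close to `R`. The map `a ↦ χ K`
involves an inverse function, but it takes smooth families to smooth families. A sequence of `a`'s that
tends to zero fast enough lies on a smooth curve through zero, so this already implies continuity
at zero in the `C^∞` topologies (`exists_special_curve`, `exists_forall_iteratedFDeriv_lt`). The
support of `H' - H` lies in a fixed compact set, which is why the weak topology for `R'` controls the
Whitney topology for `H'` (`exists_forall_perturbedEnergy_lt`).
-/

set_option maxSynthPendingDepth 3

namespace PoincareSection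

/-! ### Smooth dependence of solutions of differential equations on initial values -/

section Nemytskii

universe u

variable {K : Type*} [TopologicalSpace K] [CompactSpace K]

/-- The pointwise application `(A, h) ↦ (t ↦ A t (h t))`, as a continuous bilinear map. -/
noncomputable def pointwiseApply (K : Type*) [TopologicalSpace K] [CompactSpace K]
    (E F : Type*) [NormedAddCommGroup E] [NormedSpace ℝ E] [NormedAddCommGroup F]
    [NormedSpace ℝ F] : C(K, E →L[ℝ] F) →L[ℝ] C(K, E) →L[ℝ] C(K, F) :=
  LinearMap.mkContinuous₂
    (LinearMap.mk₂ ℝ (fun (A : C(K, E →L[ℝ] F)) (h : C(K, E)) =>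
        (⟨fun t => A t (h t), A.continuous.clm_apply h.continuous⟩ : C(K, F)))
      (fun A B h => by ext t; simp) (fun c A h => by ext t; simp)
      (fun A h k => by ext t; simp) (fun c A h => by ext t; simp)) 1
    (fun A h => by
      rw [one_mul]
      refine (ContinuousMap.norm_le _ (by positivity)).2 fun t => ?_
      exact ((A t).le_opNorm (h t)).trans
        (by gcongr; exacts [A.norm_coe_le_norm t, h.norm_coe_le_norm t]))

@[simp]
theorem pointwiseApply_apply {E F : Type*} [NormedAddCommGroup E] [NormedSpace ℝ E]
    [NormedAddCommGroup F] [NormedSpace ℝ F] (A : C(K, E →L[ℝ] F)) (h : C(K, E)) (t : K) :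
    pointwiseApply K E F A h t = A t (h t) := rfl

/-- Composition with a continuously differentiable map is differentiable on the Banach space of
continuous maps; its differential is pointwise application of the derivative. -/
theorem hasFDerivAt_continuousMap_comp {E F : Type*} [NormedAddCommGroup E] [NormedSpace ℝ E]
    [NormedAddCommGroup F] [NormedSpace ℝ F] {f : E → F} (hf : ContDiff ℝ 1 f) (α : C(K, E)) :
    HasFDerivAt (fun α : C(K, E) => (⟨f, hf.continuous⟩ : C(E, F)).comp α)
      (pointwiseApply K E F ((⟨fderiv ℝ f, hf.continuous_fderiv one_ne_zero⟩ :
        C(E, E →L[ℝ] F)).comp α)) α := by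
  rw [hasFDerivAt_iff_isLittleO_nhds_zero, Asymptotics.isLittleO_iff]
  intro ε hε
  let D : C(E, E →L[ℝ] F) := ⟨fderiv ℝ f, hf.continuous_fderiv one_ne_zero⟩
  have hc := (ContinuousMap.continuous_postcomp (X := K) D).tendsto α
  have hD : ∀ᶠ A : C(K, E →L[ℝ] F) in 𝓝 (D.comp α), dist A (D.comp α) < ε :=
    Filter.mem_of_superset (Metric.ball_mem_nhds (D.comp α) hε) fun _ hA => hA
  obtain ⟨δ, hδ, hball⟩ := Metric.eventually_nhds_iff.1 (hc.eventually hD)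
  filter_upwards [Metric.ball_mem_nhds (0 : C(K, E)) hδ] with h hh
  refine (ContinuousMap.norm_le _ (by positivity)).2 fun t => ?_
  have hseg : ∀ z ∈ segment ℝ (α t) (α t + h t), ‖fderiv ℝ f z - fderiv ℝ f (α t)‖ ≤ ε := by
    intro z hz
    rw [segment_eq_image'] at hz
    obtain ⟨s, hs, rfl⟩ := hz
    have hd : dist (α + s • h) α < δ := by
      rw [dist_eq_norm, add_sub_cancel_left, norm_smul, Real.norm_of_nonneg hs.1]
      have : ‖h‖ < δ := by simpa using hh
      nlinarith [norm_nonneg h, hs.2]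
    have h1 := (ContinuousMap.dist_lt_iff hε).1 (hball hd) t
    rw [dist_eq_norm] at h1
    simpa [D] using h1.le
  have := (convex_segment (𝕜 := ℝ) (α t) (α t + h t)).norm_image_sub_le_of_norm_hasFDerivWithin_le'
    (f := f) (f' := fderiv ℝ f) (φ := fderiv ℝ f (α t))
    (fun z _ => ((hf.differentiable one_ne_zero) z).hasFDerivAt.hasFDerivWithinAt) hseg
    (left_mem_segment ℝ _ _) (right_mem_segment ℝ _ _)
  simp only [add_sub_cancel_left] at this
  calc _ ≤ ε * ‖h t‖ := by simpa using this
    _ ≤ ε * ‖h‖ := by gcongr; exact h.norm_coe_le_norm t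

theorem contDiff_continuousMap_comp_nat (n : ℕ) : ∀ {E F : Type u} [NormedAddCommGroup E]
    [NormedSpace ℝ E] [NormedAddCommGroup F] [NormedSpace ℝ F] {f : E → F} (hf : ContDiff ℝ ∞ f),
    ContDiff ℝ n (fun α : C(K, E) => (⟨f, hf.continuous⟩ : C(E, F)).comp α) := by
  induction n with
  | zero =>
    intro E F _ _ _ _ f hf
    exact contDiff_zero.2 (ContinuousMap.continuous_postcomp _)
  | succ n ih =>
    intro E F _ _ _ _ f hf
    have hf1 : ContDiff ℝ 1 f := hf.of_le (by exact_mod_cast le_top)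
    have hD := hasFDerivAt_continuousMap_comp (K := K) hf1
    push_cast
    refine contDiff_succ_iff_fderiv.2 ⟨fun α => (hD α).differentiableAt, by simp, ?_⟩
    have : fderiv ℝ (fun α : C(K, E) => (⟨f, hf.continuous⟩ : C(E, F)).comp α) = fun α =>
        pointwiseApply K E F ((⟨fderiv ℝ f, hf1.continuous_fderiv one_ne_zero⟩ :
          C(E, E →L[ℝ] F)).comp α) := funext fun α => (hD α).fderiv
    rw [this]
    exact (pointwiseApply K E F).contDiff.comp
      (ih (f := fderiv ℝ f) (hf.fderiv_right (m := ∞) (by simp)))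

/-- Composition with a smooth map is a smooth operation on the Banach space of continuous maps. -/
theorem contDiff_continuousMap_comp {E F : Type u} [NormedAddCommGroup E]
    [NormedSpace ℝ E] [NormedAddCommGroup F] [NormedSpace ℝ F] {f : E → F} (hf : ContDiff ℝ ∞ f) :
    ContDiff ℝ ∞ (fun α : C(K, E) => (⟨f, hf.continuous⟩ : C(E, F)).comp α) :=
  contDiff_infty.2 fun n => contDiff_continuousMap_comp_nat n hf

end Nemytskii

section Primitive

theorem continuous_extend_unitInterval {E : Type*} [NormedAddCommGroup E]
    (α : C(unitInterval, E)) :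
    Continuous fun s : ℝ => α (projIcc 0 1 zero_le_one s) :=
  α.continuous.comp continuous_projIcc

variable {E : Type*} [NormedAddCommGroup E] [NormedSpace ℝ E] [CompleteSpace E]

/-- The operator `α ↦ (t ↦ ∫ s in 0..t, α s)` on continuous maps on the unit interval. -/
noncomputable def primitiveCLM (E : Type*) [NormedAddCommGroup E] [NormedSpace ℝ E]
    [CompleteSpace E] : C(unitInterval, E) →L[ℝ] C(unitInterval, E) :=
  LinearMap.mkContinuous
    { toFun := fun α => ⟨fun t => ∫ s in (0 : ℝ)..t, α (projIcc 0 1 zero_le_one s),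
        (intervalIntegral.continuous_primitive
          (fun a b => (continuous_extend_unitInterval α).intervalIntegrable a b) 0).comp
          continuous_subtype_val⟩
      map_add' := fun α β => by
        ext t
        simpa using intervalIntegral.integral_add
          ((continuous_extend_unitInterval α).intervalIntegrable 0 t)
          ((continuous_extend_unitInterval β).intervalIntegrable 0 t)
      map_smul' := fun c α => by
        ext t
        simp } 1
    (fun α => by
      rw [one_mul]
      refine (ContinuousMap.norm_le _ (norm_nonneg _)).2 fun t => ?_
      have h := intervalIntegral.norm_integral_le_of_norm_le_const
        (a := (0 : ℝ)) (b := t) (C := ‖α‖) (f := fun s => α (projIcc 0 1 zero_le_one s))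
        (fun s _ => α.norm_coe_le_norm _)
      refine h.trans ?_
      rw [sub_zero, abs_of_nonneg t.2.1]
      exact mul_le_of_le_one_right (norm_nonneg _) t.2.2)

theorem primitiveCLM_apply (α : C(unitInterval, E)) (t : unitInterval) :
    primitiveCLM E α t = ∫ s in (0 : ℝ)..t, α (projIcc 0 1 zero_le_one s) := rfl

theorem hasDerivWithinAt_of_eq_primitive {α β : C(unitInterval, E)} {x : E}
    (h : ∀ t, α t = x + primitiveCLM E β t) (t : ℝ) (ht : t ∈ Icc (0 : ℝ) 1) :
    HasDerivWithinAt (fun s : ℝ => α (projIcc 0 1 zero_le_one s))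
      (β (projIcc 0 1 zero_le_one t)) (Icc 0 1) t := by
  have h1 : HasDerivAt (fun u => ∫ s in (0 : ℝ)..u, β (projIcc 0 1 zero_le_one s))
      (β (projIcc 0 1 zero_le_one t)) t :=
    intervalIntegral.integral_hasDerivAt_right
      ((continuous_extend_unitInterval β).intervalIntegrable _ _)
      ((continuous_extend_unitInterval β).stronglyMeasurableAtFilter _ _)
      (continuous_extend_unitInterval β).continuousAt
  refine (h1.const_add x).hasDerivWithinAt.congr_of_mem ?_ ht
  intro s hs
  rw [h, primitiveCLM_apply, projIcc_of_mem zero_le_one hs]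

/-- The integral over `[0, 1]` of a smooth family of functions is smooth in the parameter, and may
be differentiated under the integral sign. -/
theorem contDiff_integral_param {E P : Type} [NormedAddCommGroup E] [NormedSpace ℝ E]
    [CompleteSpace E] [NormedAddCommGroup P] [NormedSpace ℝ P]
    {f : ℝ × P → E} (hf : ContDiff ℝ ∞ f) :
    ContDiff ℝ ∞ (fun p => ∫ s in (0 : ℝ)..1, f (s, p)) ∧
      ∀ p v, fderiv ℝ (fun p => ∫ s in (0 : ℝ)..1, f (s, p)) p v =
        ∫ s in (0 : ℝ)..1, fderiv ℝ f (s, p) (0, v) := by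
  have hf1 : ContDiff ℝ 1 f := hf.of_le (by exact_mod_cast le_top)
  let j : P →L[ℝ] C(unitInterval, ℝ × P) :=
    (ContinuousLinearMap.const (R := ℝ) unitInterval).comp (ContinuousLinearMap.inr ℝ ℝ P)
  let i : P → C(unitInterval, ℝ × P) := fun p =>
    (⟨fun s => ((s : ℝ), (0 : P)), by fun_prop⟩ : C(unitInterval, ℝ × P)) + j p
  let L : C(unitInterval, E) →L[ℝ] E :=
    (ContinuousMap.evalCLM ℝ (1 : unitInterval)).comp (primitiveCLM E)
  have hi : ContDiff ℝ ∞ i := contDiff_const.add j.contDiff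
  have hi' : ∀ p, HasFDerivAt i j p := fun p => j.hasFDerivAt.const_add _
  have hL : ∀ (α : C(unitInterval, E)) (g : ℝ → E), (∀ s : unitInterval, α s = g s) →
      L α = ∫ s in (0 : ℝ)..1, g s := by
    intro α g hg
    change primitiveCLM E α 1 = _
    rw [primitiveCLM_apply, Icc.coe_one]
    refine intervalIntegral.integral_congr fun s hs => ?_
    rw [uIcc_of_le (zero_le_one' ℝ)] at hs
    simp [projIcc_of_mem zero_le_one hs, hg]
  have heq : (fun p => ∫ s in (0 : ℝ)..1, f (s, p)) =
      fun p => L ((⟨f, hf.continuous⟩ : C(ℝ × P, E)).comp (i p)) :=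
    funext fun p => (hL _ (fun s => f (s, p)) fun s => by simp [i, j]).symm
  rw [heq]
  refine ⟨L.contDiff.comp ((contDiff_continuousMap_comp (K := unitInterval) hf).comp hi),
    fun p v => ?_⟩
  have h := L.hasFDerivAt.comp p ((hasFDerivAt_continuousMap_comp hf1 (i p)).comp p (hi' p))
  have h' : HasFDerivAt (fun p => L ((⟨f, hf.continuous⟩ : C(ℝ × P, E)).comp (i p))) _ p := h
  rw [h'.fderiv]
  exact hL _ (fun s => fderiv ℝ f (s, p) (0, v)) fun s => by simp [i, j]

end Primitive

/-- The inverse function theorem for maps smooth on an open set, with an inverse smooth on all of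
its domain. -/
theorem exists_openPartialHomeomorph_contDiffOn_symm {E F : Type*} [NormedAddCommGroup E]
    [NormedSpace ℝ E] [CompleteSpace E] [NormedAddCommGroup F] [NormedSpace ℝ F] {f : E → F}
    {s : Set E} (hs : IsOpen s) (hf : ContDiffOn ℝ ∞ f s) {a : E} (ha : a ∈ s) {f' : E ≃L[ℝ] F}
    (hf' : HasFDerivAt f (f' : E →L[ℝ] F) a) :
    ∃ φ : OpenPartialHomeomorph E F, a ∈ φ.source ∧ φ.source ⊆ s ∧ (∀ x, φ x = f x) ∧
      ContDiffOn ℝ ∞ φ.symm φ.target := by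
  have hne : (∞ : WithTop ℕ∞) ≠ 0 := by simp
  have hat : ∀ x ∈ s, ContDiffAt ℝ ∞ f x := fun x hx => hf.contDiffAt (hs.mem_nhds hx)
  let φ₀ := (hat a ha).toOpenPartialHomeomorph f hf' hne
  let u : Set E := {x ∈ s | fderiv ℝ f x ∈ range ((↑) : (E ≃L[ℝ] F) → E →L[ℝ] F)}
  have hu : IsOpen u := by
    have hc : ContinuousOn (fderiv ℝ f) s :=
      (hf.fderiv_of_isOpen hs (m := 0) (by simp)).continuousOn
    exact hc.isOpen_inter_preimage hs ContinuousLinearEquiv.isOpen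
  have hau : a ∈ u := ⟨ha, f', hf'.fderiv.symm⟩
  refine ⟨φ₀.restrOpen u hu, ⟨(hat a ha).mem_toOpenPartialHomeomorph_source hf' hne, hau⟩,
    fun x hx => hx.2.1, fun x => rfl, fun y hy => ?_⟩
  have hx := (φ₀.restrOpen u hu).map_target hy
  obtain ⟨hxs, g', hg'⟩ : (φ₀.restrOpen u hu).symm y ∈ u := hx.2
  refine ContDiffAt.contDiffWithinAt ?_
  refine (φ₀.restrOpen u hu).contDiffAt_symm (f₀' := g') hy ?_ (hat _ hxs)
  rw [hg']
  exact ((hat _ hxs).differentiableAt hne).hasFDerivAt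

/-- Smooth dependence on initial values: if the linearization of `f` along the solution `α₀` is
nilpotent, then the solutions on `[0, 1]` starting near `α₀ 0` form a smooth family, whose
derivatives solve the linearized equation. -/
theorem exists_smooth_family_of_solutions {E : Type*} [NormedAddCommGroup E] [NormedSpace ℝ E]
    [CompleteSpace E] {f : E → E} (hf : ContDiff ℝ ∞ f) (α₀ : C(unitInterval, E)) (x₀ : E)
    (hα₀ : ∀ t, α₀ t = x₀ + primitiveCLM E ((⟨f, hf.continuous⟩ : C(E, E)).comp α₀) t)
    (hnil : ∀ s t, (fderiv ℝ f (α₀ s)).comp (fderiv ℝ f (α₀ t)) = 0) :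
    ∃ (A : E → C(unitInterval, E)) (u : Set E), IsOpen u ∧ x₀ ∈ u ∧ ContDiffOn ℝ ∞ A u ∧
      A x₀ = α₀ ∧ ∀ x ∈ u,
      A x 0 = x ∧
      (∀ t ∈ Icc (0 : ℝ) 1, HasDerivWithinAt (fun s : ℝ => A x (projIcc 0 1 zero_le_one s))
        (f (A x (projIcc 0 1 zero_le_one t))) (Icc 0 1) t) ∧
      ∀ v, fderiv ℝ A x v 0 = v ∧ ∀ t ∈ Icc (0 : ℝ) 1,
        HasDerivWithinAt (fun s : ℝ => fderiv ℝ A x v (projIcc 0 1 zero_le_one s))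
        (fderiv ℝ f (A x (projIcc 0 1 zero_le_one t))
          (fderiv ℝ A x v (projIcc 0 1 zero_le_one t))) (Icc 0 1) t := by
  have hf1 : ContDiff ℝ 1 f := hf.of_le (by exact_mod_cast le_top)
  let N : C(unitInterval, E) → C(unitInterval, E) := fun α => (⟨f, hf.continuous⟩ : C(E, E)).comp α
  let N' : C(unitInterval, E) → C(unitInterval, E) →L[ℝ] C(unitInterval, E) := fun α =>
    pointwiseApply unitInterval E E ((⟨fderiv ℝ f, hf1.continuous_fderiv one_ne_zero⟩ :
        C(E, E →L[ℝ] E)).comp α)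
  let c : E →L[ℝ] C(unitInterval, E) := ContinuousLinearMap.const (R := ℝ) unitInterval
  have hN' : ∀ α, HasFDerivAt N (N' α) α := hasFDerivAt_continuousMap_comp hf1
  let G : E × C(unitInterval, E) → C(unitInterval, E) := fun q =>
    q.2 - c q.1 - primitiveCLM E (N q.2)
  have hG : ContDiff ℝ ∞ G := by
    refine (contDiff_snd.sub (c.contDiff.comp contDiff_fst)).sub ?_
    exact (primitiveCLM E).contDiff.comp ((contDiff_continuousMap_comp hf).comp contDiff_snd)
  have hG' : ∀ q, HasFDerivAt G (ContinuousLinearMap.snd ℝ E C(unitInterval, E) -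
      c.comp (ContinuousLinearMap.fst ℝ _ _) -
      (primitiveCLM E).comp ((N' q.2).comp (ContinuousLinearMap.snd ℝ _ _))) q := by
    intro q
    refine ((ContinuousLinearMap.snd ℝ E C(unitInterval, E)).hasFDerivAt.sub
      (c.comp (ContinuousLinearMap.fst ℝ _ _)).hasFDerivAt).sub ?_
    exact (primitiveCLM E).hasFDerivAt.comp q ((hN' q.2).comp q hasFDerivAt_snd)
  let T : C(unitInterval, E) →L[ℝ] C(unitInterval, E) := (primitiveCLM E).comp (N' α₀)
  -- the square of the integral operator vanishes by nilpotency
  have hT : ∀ k, T (T k) = 0 := by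
    intro k
    ext t
    change primitiveCLM E (N' α₀ (primitiveCLM E (N' α₀ k))) t = 0
    rw [primitiveCLM_apply]
    refine intervalIntegral.integral_zero_ae (Filter.Eventually.of_forall fun s _ => ?_)
    change fderiv ℝ f (α₀ _) (primitiveCLM E (N' α₀ k) _) = 0
    rw [primitiveCLM_apply, ← ContinuousLinearMap.intervalIntegral_comp_comm _
      ((continuous_extend_unitInterval _).intervalIntegrable _ _)]
    refine intervalIntegral.integral_zero_ae (Filter.Eventually.of_forall fun r _ => ?_)
    have := congrArg (fun L => L (k (projIcc 0 1 zero_le_one r)))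
      (hnil (projIcc 0 1 zero_le_one (projIcc (0 : ℝ) 1 zero_le_one s : ℝ))
      (projIcc 0 1 zero_le_one r))
    simpa [N'] using this
  have hG0 : G (x₀, α₀) = 0 := by
    ext t
    simp only [G, ContinuousMap.sub_apply, ContinuousMap.zero_apply]
    rw [hα₀ t]
    simp [c, N]
  -- the inverse of the map `(x, α) ↦ (x, G (x, α))` solves the equation `G (x, α) = 0`
  let Q : E × C(unitInterval, E) → E × C(unitInterval, E) := fun q => (q.1, G q)
  have hQ : ContDiff ℝ ∞ Q := contDiff_fst.prodMk hG
  let Q' : (E × C(unitInterval, E)) ≃L[ℝ] (E × C(unitInterval, E)) :=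
    ContinuousLinearEquiv.equivOfInverse
      ((ContinuousLinearMap.fst ℝ E C(unitInterval, E)).prod
        (ContinuousLinearMap.snd ℝ E C(unitInterval, E) -
          c.comp (ContinuousLinearMap.fst ℝ _ _) - T.comp (ContinuousLinearMap.snd ℝ _ _)))
      ((ContinuousLinearMap.fst ℝ E C(unitInterval, E)).prod
        (((ContinuousLinearMap.id ℝ _) + T).comp
          (ContinuousLinearMap.snd ℝ E C(unitInterval, E) +
            c.comp (ContinuousLinearMap.fst ℝ _ _))))
      (fun q => by ext <;> simp [hT]) (fun q => by ext <;> simp [hT]; abel)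
  have hQ' : HasFDerivAt Q (Q' : E × C(unitInterval, E) →L[ℝ] E × C(unitInterval, E))
      (x₀, α₀) := by
    refine (hasFDerivAt_fst.prodMk (hG' (x₀, α₀))).congr_fderiv ?_
    rfl
  obtain ⟨φ, hφ0, -, hφ, hφs⟩ := exists_openPartialHomeomorph_contDiffOn_symm isOpen_univ
    hQ.contDiffOn (mem_univ (x₀, α₀)) hQ'
  let A : E → C(unitInterval, E) := fun x => (φ.symm (x, 0)).2
  let u : Set E := (fun x : E => (x, (0 : C(unitInterval, E)))) ⁻¹' φ.target
  have hu : IsOpen u := φ.open_target.preimage (by fun_prop)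
  have hQ0 : Q (x₀, α₀) = (x₀, 0) := by simp [Q, hG0]
  have hx₀ : x₀ ∈ u := by
    have := φ.map_source hφ0
    rwa [hφ, hQ0] at this
  have hA : ContDiffOn ℝ ∞ A u :=
    contDiff_snd.comp_contDiffOn (hφs.comp (by fun_prop) fun x hx => hx)
  have hev : ∀ x ∈ u, G (x, A x) = 0 := by
    intro x hx
    have h1 : Q (φ.symm (x, 0)) = (x, 0) := by rw [← hφ]; exact φ.right_inv hx
    have h2 : (φ.symm (x, 0)).1 = x := congrArg Prod.fst h1
    have h2 : φ.symm (x, 0) = (x, A x) := Prod.ext h2 rfl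
    rw [h2] at h1
    exact congrArg Prod.snd h1
  refine ⟨A, u, hu, hx₀, hA, ?_, ?_⟩
  · have := φ.left_inv hφ0
    rw [hφ, hQ0] at this
    simp [A, this]
  intro x hxu
  have hx : ∀ᶠ y in 𝓝 x, G (y, A y) = 0 :=
    Filter.mem_of_superset (hu.mem_nhds hxu) fun y hy => hev y hy
  have hdx : DifferentiableAt ℝ A x :=
    (hA.contDiffAt (hu.mem_nhds hxu)).differentiableAt (by simp)
  have hsol : ∀ t, A x t = x + primitiveCLM E (N (A x)) t := by
    intro t
    have := congrArg (fun β => β t) hx.self_of_nhds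
    simp only [G, ContinuousMap.sub_apply, ContinuousMap.zero_apply] at this
    rw [sub_sub, sub_eq_zero] at this
    simpa [c] using this
  have hlin : ∀ v t, fderiv ℝ A x v t = v + primitiveCLM E (N' (A x) (fderiv ℝ A x v)) t := by
    intro v t
    have h1 : HasFDerivAt (fun y => G (y, A y)) _ x :=
      (hG' (x, A x)).comp x ((hasFDerivAt_id x).prodMk hdx.hasFDerivAt)
    have h2 : HasFDerivAt (fun y => G (y, A y)) (0 : E →L[ℝ] C(unitInterval, E)) x :=
      (hasFDerivAt_const (0 : C(unitInterval, E)) x).congr_of_eventuallyEq hx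
    have := congrArg (fun L => L v t) (h1.unique h2)
    simp only [ContinuousLinearMap.comp_apply, sub_apply,
      ContinuousMap.sub_apply, ContinuousLinearMap.prod_apply, zero_apply,
      ContinuousMap.zero_apply] at this
    rw [sub_sub, sub_eq_zero] at this
    simpa [c] using this
  have hz : ∀ β : C(unitInterval, E), primitiveCLM E β 0 = 0 := fun β => by
    rw [primitiveCLM_apply]; simp
  refine ⟨by rw [hsol, hz, add_zero], fun t ht => ?_, fun v => ⟨by rw [hlin, hz, add_zero],
    fun t ht => ?_⟩⟩
  · exact hasDerivWithinAt_of_eq_primitive hsol t ht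
  · exact hasDerivWithinAt_of_eq_primitive (hlin v) t ht

/-! ### Straightening a vector field -/

/-- A map which is smooth near a compact set agrees near this set with a compactly supported smooth
map. -/
theorem exists_contDiff_eventuallyEq_nhdsSet {E F : Type*} [NormedAddCommGroup E]
    [NormedSpace ℝ E] [FiniteDimensional ℝ E] [NormedAddCommGroup F] [NormedSpace ℝ F]
    {X : E → F} {s K : Set E} (hs : IsOpen s) (hX : ContDiffOn ℝ ∞ X s) (hK : IsCompact K)
    (hKs : K ⊆ s) :
    ∃ f : E → F, ContDiff ℝ ∞ f ∧ HasCompactSupport f ∧ ∀ᶠ x in 𝓝ˢ K, f x = X x := by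
  have : ProperSpace E := FiniteDimensional.proper ℝ E
  obtain ⟨u, hu, hKu, hus, huc⟩ := exists_open_between_and_isCompact_closure hK hs hKs
  obtain ⟨g, hg0, hg1, -⟩ := exists_contMDiffMap_zero_one_nhds_of_isClosed (n := ⊤) 𝓘(ℝ, E)
    hu.isClosed_compl hK.isClosed (disjoint_left.2 fun x hx hxK => hx (hKu hxK))
  have hgc : ContDiff ℝ ∞ g := contMDiff_iff_contDiff.1 g.contMDiff
  have hsupp : Function.support (fun x => g x • X x) ⊆ u := by
    intro x hx
    by_contra hxu
    have h0 : g x = 0 := hg0.self_of_nhdsSet x hxu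
    exact hx (by simp [h0])
  refine ⟨fun x => g x • X x, contDiff_iff_contDiffAt.2 fun x => ?_, ?_, ?_⟩
  · by_cases hx : x ∈ u
    · exact hgc.contDiffAt.smul (hX.contDiffAt (hs.mem_nhds (hus (subset_closure hx))))
    · have h0 : ∀ᶠ y in 𝓝 x, g y = 0 := Filter.Eventually.filter_mono (nhds_le_nhdsSet hx) hg0
      refine (contDiffAt_const (c := (0 : F))).congr_of_eventuallyEq ?_
      filter_upwards [h0] with y hy
      simp [hy]
  · exact huc.of_isClosed_subset isClosed_closure (closure_mono hsupp)
  · filter_upwards [hg1] with x hx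
    simp [hx]

section FlowBox

variable {E : Type*} [NormedAddCommGroup E] [NormedSpace ℝ E] [CompleteSpace E]

/-- The local flow of a Lipschitz smooth vector field is smooth in time and in the initial value. -/
theorem exists_smooth_local_flow {f : E → E} (hf : ContDiff ℝ ∞ f) {C : NNReal}
    (hC : LipschitzWith C f) (x₀ : E) :
    ∃ (φ : ℝ × E → E) (u : Set (ℝ × E)), IsOpen u ∧ (0, x₀) ∈ u ∧ ContDiffOn ℝ ∞ φ u ∧
      ∀ q ∈ u, (q.1 = 0 → φ q = q.2) ∧ fderiv ℝ φ q (1, 0) = f (φ q) := by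
  let F : ℝ × E → ℝ × E := fun q => (0, q.1 • f q.2)
  have hF : ContDiff ℝ ∞ F := contDiff_const.prodMk (contDiff_fst.smul (hf.comp contDiff_snd))
  have hfd : Differentiable ℝ f := hf.differentiable (by simp)
  have hF' : ∀ v, fderiv ℝ F (0, x₀) v = (0, v.1 • f x₀) := by
    intro v
    have h1 : HasFDerivAt (fun q : ℝ × E => q.1 • f q.2) _ ((0 : ℝ), x₀) :=
      hasFDerivAt_fst.smul ((hfd x₀).hasFDerivAt.comp ((0 : ℝ), x₀) hasFDerivAt_snd)
    have h2 := (hasFDerivAt_const (0 : ℝ) ((0 : ℝ), x₀)).prodMk h1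
    rw [h2.fderiv]
    simp
  let α₀ : C(unitInterval, ℝ × E) := ContinuousMap.const _ (0, x₀)
  -- rescaling time turns the flow for small times into a flow for time one
  obtain ⟨A, u, hu, hu0, hA, -, hAu⟩ := exists_smooth_family_of_solutions hF α₀ (0, x₀)
    (fun t => by simp [primitiveCLM_apply, α₀, F])
    (fun s t => by
      refine ContinuousLinearMap.ext fun v => ?_
      simp [α₀, hF'])
  obtain ⟨ρ, hρ, hball⟩ := Metric.isOpen_iff.1 hu _ hu0
  have hmem : ∀ {ε : ℝ} {x : E}, |ε| < ρ → ‖x - x₀‖ < ρ → (ε, x) ∈ u := by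
    intro ε x h1 h2
    refine hball ?_
    simp [dist_eq_norm, h1, h2]
  let φ : ℝ × E → E := fun q => (A q 1).2
  let a : ℝ → E → ℝ → E := fun ε x s => (A (ε, x) (projIcc 0 1 zero_le_one s)).2
  have hφ : ContDiffOn ℝ ∞ φ u :=
    contDiff_snd.comp_contDiffOn
      ((ContinuousMap.evalCLM ℝ (1 : unitInterval) : C(unitInterval, ℝ × E) →L[ℝ] ℝ × E).contDiff
        |>.comp_contDiffOn hA)
  have hfst : ∀ q ∈ u, ∀ t ∈ Icc (0 : ℝ) 1, (A q (projIcc 0 1 zero_le_one t)).1 = q.1 := by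
    intro q hq t ht
    have hd : ∀ t ∈ Icc (0 : ℝ) 1,
        HasDerivWithinAt (fun s => (A q (projIcc 0 1 zero_le_one s)).1) 0 (Icc 0 1) t :=
      fun t ht => (ContinuousLinearMap.fst ℝ ℝ E).hasFDerivAt.comp_hasDerivWithinAt t
        ((hAu q hq).2.1 t ht)
    have hd' := constant_of_has_deriv_right_zero
      (fun t ht => (hd t ht).continuousWithinAt)
      (fun t ht => ((hd t (Ico_subset_Icc_self ht)).mono_of_mem_nhdsWithin
        (Icc_mem_nhdsGE_of_mem ht))) t ht
    rw [hd']
    have : projIcc (0 : ℝ) 1 zero_le_one 0 = 0 := by simp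
    rw [this, (hAu q hq).1]
  have had : ∀ ε x, (ε, x) ∈ u → ∀ t ∈ Icc (0 : ℝ) 1,
      HasDerivWithinAt (a ε x) (ε • f (a ε x t)) (Icc 0 1) t := by
    intro ε x hq t ht
    have h1 := hasFDerivAt_snd.comp_hasDerivWithinAt t ((hAu _ hq).2.1 t ht)
    simp only [F, ContinuousLinearMap.coe_snd', hfst _ hq t ht] at h1
    exact h1
  have ha0 : ∀ ε x, (ε, x) ∈ u → a ε x 0 = x := by
    intro ε x hq
    simp [a, (hAu _ hq).1]
  have ha1 : ∀ ε x, a ε x 1 = φ (ε, x) := by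
    intro ε x
    simp [a, φ]
  have hscale : ∀ ε x, |ε| < ρ → ‖x - x₀‖ < ρ → ∀ s ∈ Icc (0 : ℝ) 1,
      φ (ε * s, x) = a ε x s := by
    intro ε x hε hx s hs
    have hεs : |ε * s| < ρ := by
      rw [abs_mul, abs_of_nonneg hs.1]
      nlinarith [abs_nonneg ε, hs.2]
    have hq := hmem hε hx
    have hqs := hmem hεs hx
    have hmaps : MapsTo (fun r => s * r) (Icc (0 : ℝ) 1) (Icc 0 1) := fun r hr =>
      ⟨mul_nonneg hs.1 hr.1, mul_le_one₀ hs.2 hr.1 hr.2⟩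
    have hg : ∀ r ∈ Icc (0 : ℝ) 1, HasDerivWithinAt (fun r => a ε x (s * r))
        ((ε * s) • f (a ε x (s * r))) (Icc 0 1) r := by
      intro r hr
      have h1 : HasDerivWithinAt (fun r => s * r) s (Icc 0 1) r := by
        simpa using ((hasDerivAt_id r).const_mul s).hasDerivWithinAt
      have h2 := (had ε x hq _ (hmaps hr)).scomp r h1 hmaps
      rw [smul_smul, mul_comm s ε] at h2
      exact h2
    have := ODE_solution_unique (v := fun _ y => (ε * s) • f y) (K := ‖ε * s‖₊ * C)
      (f := a (ε * s) x) (g := fun r => a ε x (s * r)) (a := 0) (b := 1)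
      (fun _ => (lipschitzWith_smul (ε * s)).comp hC)
      (fun r hr => (had _ x hqs r hr).continuousWithinAt)
      (fun r hr => (had _ x hqs r (Ico_subset_Icc_self hr)).mono_of_mem_nhdsWithin
        (Icc_mem_nhdsGE_of_mem hr))
      (fun r hr => (hg r hr).continuousWithinAt)
      (fun r hr => (hg r (Ico_subset_Icc_self hr)).mono_of_mem_nhdsWithin
        (Icc_mem_nhdsGE_of_mem hr))
      (by simp only [mul_zero]; rw [ha0 _ _ hqs, ha0 _ _ hq])
    have h1 := this (right_mem_Icc.2 zero_le_one)
    rw [ha1] at h1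
    simpa using h1
  refine ⟨φ, u ∩ Metric.ball (0, x₀) ρ, hu.inter Metric.isOpen_ball,
    ⟨hu0, Metric.mem_ball_self hρ⟩, hφ.mono inter_subset_left, ?_⟩
  rintro ⟨t, x⟩ ⟨hq, hqb⟩
  have hqb : |t| < ρ ∧ ‖x - x₀‖ < ρ := by
    simpa [Prod.dist_eq, dist_eq_norm] using hqb
  obtain ⟨ht, hx⟩ := hqb
  -- every time is a nonzero multiple of a time in the unit interval
  obtain ⟨ε, s, hε, hε0, hs, rfl⟩ : ∃ ε s : ℝ, |ε| < ρ ∧ ε ≠ 0 ∧ s ∈ Icc (0 : ℝ) 1 ∧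
      ε * s = t := by
    by_cases h0 : t = 0
    · exact ⟨ρ / 2, 0, by rw [abs_of_pos (by positivity)]; linarith, by positivity,
        left_mem_Icc.2 zero_le_one, by simp [h0]⟩
    · exact ⟨t, 1, ht, h0, right_mem_Icc.2 zero_le_one, mul_one t⟩
  constructor
  · intro h0
    have hs0 : s = 0 := by simpa [hε0] using h0
    rw [hscale ε x hε hx s hs, hs0, ha0 _ _ (hmem hε hx)]
  · have hd : HasFDerivAt φ (fderiv ℝ φ (ε * s, x)) (ε * s, x) :=
      ((hφ.contDiffAt (hu.mem_nhds hq)).differentiableAt (by simp)).hasFDerivAt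
    have hc : HasDerivWithinAt (fun r => (ε * r, x)) (ε, (0 : E)) (Icc 0 1) s := by
      have : HasDerivAt (fun r => ε * r) ε s := by simpa using (hasDerivAt_id s).const_mul ε
      exact (this.prodMk (hasDerivAt_const s x)).hasDerivWithinAt
    have h1 := (HasFDerivAt.comp_hasDerivWithinAt s hd hc)
    have h2 := (had ε x (hmem hε hx) s hs).congr_of_mem
      (f₁ := φ ∘ fun r => (ε * r, x)) (fun r hr => hscale ε x hε hx r hr) hs
    have h3 := (uniqueDiffOn_Icc_zero_one s hs).eq_deriv _ h1 h2
    have h4 : ((ε, (0 : E)) : ℝ × E) = ε • (1, 0) := by simp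
    rw [h4, map_smul, ← hscale ε x hε hx s hs] at h3
    exact smul_right_injective _ hε0 h3

/-- The flow box theorem: near a point where it does not vanish, a vector field is constant in
suitable coordinates, which may be prescribed on a transversal hyperplane. -/
theorem exists_flow_box [FiniteDimensional ℝ E] {X : E → E} {s : Set E} (hs : IsOpen s)
    (h0 : (0 : E) ∈ s) (hX : ContDiffOn ℝ ∞ X s) (θ : E →L[ℝ] ℝ) (hθ : θ (X 0) = 1) :
    ∃ (Ψ : E → E) (u : Set E), IsOpen u ∧ (0 : E) ∈ u ∧ ContDiffOn ℝ ∞ Ψ u ∧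
      HasFDerivAt Ψ (ContinuousLinearMap.id ℝ E) 0 ∧
      ∀ y ∈ u, Ψ y ∈ s ∧ fderiv ℝ Ψ y (X 0) = X (Ψ y) ∧ (θ y = 0 → Ψ y = y) := by
  obtain ⟨f, hf, hfc, hfX⟩ := exists_contDiff_eventuallyEq_nhdsSet hs hX
    (isCompact_singleton (x := (0 : E))) (singleton_subset_iff.2 h0)
  rw [nhdsSet_singleton] at hfX
  obtain ⟨C, hC⟩ := hf.lipschitzWith_of_hasCompactSupport hfc (by simp)
  obtain ⟨φ, u, hu, hu0, hφ, hφu⟩ := exists_smooth_local_flow hf hC 0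
  have hf0 : f 0 = X 0 := hfX.self_of_nhds
  let p : E →L[ℝ] ℝ × E := θ.prod (ContinuousLinearMap.id ℝ E - θ.smulRight (X 0))
  have hp0 : p 0 = (0, 0) := by simp [p]
  have hΨ : ContDiffOn ℝ ∞ (φ ∘ p) (p ⁻¹' u) := hφ.comp p.contDiff.contDiffOn fun x hx => hx
  have hpu : IsOpen (p ⁻¹' u) := hu.preimage p.continuous
  have h0pu : (0 : E) ∈ p ⁻¹' u := by rw [mem_preimage, hp0]; exact hu0
  have hΨ0 : (φ ∘ p) 0 = 0 := by
    rw [Function.comp_apply, hp0]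
    exact (hφu _ hu0).1 rfl
  have hder : ∀ y ∈ p ⁻¹' u, HasFDerivAt (φ ∘ p) ((fderiv ℝ φ (p y)).comp p) y := fun y hy =>
    ((hφ.contDiffAt (hu.mem_nhds hy)).differentiableAt (by simp)).hasFDerivAt.comp y
      p.hasFDerivAt
  have hnhds : ∀ᶠ y in 𝓝 (0 : E), (φ ∘ p) y ∈ {z | z ∈ s ∧ f z = X z} := by
    refine ((hΨ.contDiffAt (hpu.mem_nhds h0pu)).continuousAt).eventually ?_
    rw [hΨ0]
    exact Filter.inter_mem (hs.mem_nhds h0) hfX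
  obtain ⟨w, hw, hwo, hw0⟩ := eventually_nhds_iff.1 hnhds
  refine ⟨φ ∘ p, p ⁻¹' u ∩ w, hpu.inter hwo, ⟨h0pu, hw0⟩, hΨ.mono inter_subset_left, ?_, ?_⟩
  · refine (hder 0 h0pu).congr_fderiv (ContinuousLinearMap.ext fun v => ?_)
    have hφ2 : ∀ v : E, fderiv ℝ φ (0, 0) (0, v) = v := by
      intro v
      have h1 : HasFDerivAt (fun x : E => φ (0, x)) _ (0 : E) :=
        (((hφ.contDiffAt (hu.mem_nhds hu0)).differentiableAt (by simp)).hasFDerivAt).comp (0 : E)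
          (hasFDerivAt_prodMk_right (0 : ℝ) (0 : E))
      have h2 : HasFDerivAt (fun x : E => φ (0, x)) (ContinuousLinearMap.id ℝ E) (0 : E) := by
        refine (hasFDerivAt_id (0 : E)).congr_of_eventuallyEq ?_
        have : ContinuousAt (fun x : E => ((0 : ℝ), x)) 0 := by fun_prop
        filter_upwards [this.preimage_mem_nhds (hu.mem_nhds hu0)] with x hx
        exact (hφu _ hx).1 rfl
      simpa using congrArg (fun L => L v) (h1.unique h2)
    have hv : p v = θ v • ((1 : ℝ), (0 : E)) + (0, v - θ v • X 0) := by simp [p]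
    rw [ContinuousLinearMap.comp_apply, hp0, hv, map_add, map_smul, (hφu _ hu0).2, hφ2,
      (hφu _ hu0).1 rfl, hf0]
    simp
  · rintro y ⟨hy, hyw⟩
    refine ⟨(hw y hyw).1, ?_, fun hθy => ?_⟩
    · have hv : p (X 0) = (1, 0) := by simp [p, hθ]
      rw [(hder y hy).fderiv, ContinuousLinearMap.comp_apply, hv, (hφu _ hy).2]
      exact (hw y hyw).2
    · rw [Function.comp_apply, (hφu _ hy).1 (by simpa [p] using hθy)]
      simp [p, hθy]

end FlowBox

/-! ### Constant coordinates for a symplectic form -/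

section PoincareLemma

variable {E : Type} [NormedAddCommGroup E] [NormedSpace ℝ E]

theorem hasFDerivAt_apply_apply {P F G : Type*} [NormedAddCommGroup P] [NormedSpace ℝ P]
    [NormedAddCommGroup F] [NormedSpace ℝ F] [NormedAddCommGroup G] [NormedSpace ℝ G]
    {B : P → F →L[ℝ] F →L[ℝ] G} {B' : P →L[ℝ] F →L[ℝ] F →L[ℝ] G} {x : P}
    (h : HasFDerivAt B B' x) (v w : F) :
    HasFDerivAt (fun y => B y v w) ((B'.flip v).flip w) x := by
  have := (h.clm_apply (hasFDerivAt_const v x)).clm_apply (hasFDerivAt_const w x)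
  exact this.congr_fderiv (ContinuousLinearMap.ext fun u => by simp)

/-- A 2-form on a normed space, as a field of bilinear forms, is closed on `s`. The forms are
assumed to be alternating on `s`, and `s` to be open. -/
structure IsClosedTwoFormOn (B : E → E →L[ℝ] E →L[ℝ] ℝ) (s : Set E) : Prop where
  contDiffOn : ContDiffOn ℝ ∞ B s
  antisymm : ∀ x ∈ s, ∀ v w, B x v w = -B x w v
  closed : ∀ x ∈ s, ∀ u v w,
    fderiv ℝ B x u v w + fderiv ℝ B x v w u + fderiv ℝ B x w u v = 0

theorem IsClosedTwoFormOn.fderiv_antisymm {B : E → E →L[ℝ] E →L[ℝ] ℝ} {s : Set E}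
    (hB : IsClosedTwoFormOn B s) (hs : IsOpen s) {x : E} (hx : x ∈ s) (u v w : E) :
    fderiv ℝ B x u v w = -fderiv ℝ B x u w v := by
  have hd : HasFDerivAt B (fderiv ℝ B x) x :=
    ((hB.contDiffOn.contDiffAt (hs.mem_nhds hx)).differentiableAt (by simp)).hasFDerivAt
  have h1 := hasFDerivAt_apply_apply hd
  have h2 := (h1 w v).neg.congr_of_eventuallyEq
    (f₁ := fun y => B y v w) (Filter.mem_of_superset (hs.mem_nhds hx) fun y hy =>
      hB.antisymm y hy v w)
  simpa using congrArg (fun L => L u) ((h1 v w).unique h2)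

/-- The Poincaré lemma with its standard homotopy operator: a closed 2-form `η` which vanishes at
the origin is the differential of a 1-form `α` vanishing to second order at the origin; `α`
annihilates every constant vector field annihilated by `η`. -/
theorem exists_primitive_of_closed {η : E → E →L[ℝ] E →L[ℝ] ℝ} (hη : ContDiff ℝ ∞ η) {r : ℝ}
    (hcl : IsClosedTwoFormOn η (Metric.ball 0 r)) (h0 : η 0 = 0) :
    ∃ α : E → E →L[ℝ] ℝ, ContDiff ℝ ∞ α ∧ α 0 = 0 ∧ fderiv ℝ α 0 = 0 ∧
      (∀ y ∈ Metric.ball (0 : E) r, ∀ v w,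
        fderiv ℝ α y v w - fderiv ℝ α y w v = η y v w) ∧
      ∀ v, (∀ y ∈ Metric.ball (0 : E) r, η y v = 0) → ∀ y ∈ Metric.ball (0 : E) r, α y v = 0 := by
  have hηd : Differentiable ℝ η := hη.differentiable (by simp)
  let F : ℝ × E → E →L[ℝ] ℝ := fun q => q.1 • η (q.1 • q.2) q.2
  have hF : ContDiff ℝ ∞ F :=
    contDiff_fst.smul ((hη.comp (contDiff_fst.smul contDiff_snd)).clm_apply contDiff_snd)
  obtain ⟨hα, hα'⟩ := contDiff_integral_param hF
  have hF' : ∀ s y v, fderiv ℝ F (s, y) (0, v) =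
      s • (s • fderiv ℝ η (s • y) v y + η (s • y) v) := by
    intro s y v
    have hf1 : HasFDerivAt (fun q : ℝ × E => q.1) (ContinuousLinearMap.fst ℝ ℝ E) (s, y) :=
      hasFDerivAt_fst
    have hi : HasFDerivAt (fun q : ℝ × E => q.1 • q.2) _ (s, y) := hf1.smul hasFDerivAt_snd
    have h1 : HasFDerivAt F _ (s, y) := hf1.smul
      (((hηd (s • y)).hasFDerivAt.comp (s, y) hi).clm_apply hasFDerivAt_snd)
    rw [h1.fderiv]
    ext w
    simp
    ring
  have hint : ∀ {g : ℝ → E →L[ℝ] ℝ}, Continuous g → ∀ w,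
      (∫ s in (0 : ℝ)..1, g s) w = ∫ s in (0 : ℝ)..1, g s w := fun {g} hg w =>
    (ContinuousLinearMap.intervalIntegral_comp_comm (ContinuousLinearMap.apply ℝ ℝ w)
      (hg.intervalIntegrable 0 1)).symm
  have hFc : ∀ y, Continuous fun s => F (s, y) := fun y =>
    hF.continuous.comp (by fun_prop)
  have hF'c : ∀ y v, Continuous fun s => fderiv ℝ F (s, y) (0, v) := fun y v =>
    ((hF.continuous_fderiv (by simp)).comp (by fun_prop)).clm_apply continuous_const
  have hmem : ∀ y ∈ Metric.ball (0 : E) r, ∀ s ∈ uIcc (0 : ℝ) 1, s • y ∈ Metric.ball (0 : E) r := by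
    intro y hy s hs
    rw [uIcc_of_le zero_le_one] at hs
    rw [mem_ball_zero_iff] at hy ⊢
    rw [norm_smul, Real.norm_of_nonneg hs.1]
    nlinarith [norm_nonneg y, hs.2]
  refine ⟨_, hα, by simp [F], ?_, ?_, ?_⟩
  · ext v w
    rw [hα', hint (hF'c 0 v)]
    simp [hF', h0]
  · intro y hy v w
    rw [hα', hα', hint (hF'c y v), hint (hF'c y w), ← intervalIntegral.integral_sub]
    · have hd : ∀ s ∈ uIcc (0 : ℝ) 1, HasDerivAt (fun s : ℝ => s ^ 2 * η (s • y) v w)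
          (fderiv ℝ F (s, y) (0, v) w - fderiv ℝ F (s, y) (0, w) v) s := by
        intro s hs
        have hsy := hmem y hy s hs
        have h1 : HasDerivAt (fun s : ℝ => s • y) y s := by
          simpa using (hasDerivAt_id s).smul_const y
        have h2 : HasDerivAt (fun s : ℝ => η (s • y) v w) (fderiv ℝ η (s • y) y v w) s :=
          HasFDerivAt.comp_hasDerivAt (f := fun s : ℝ => s • y) s
            (hasFDerivAt_apply_apply (hηd (s • y)).hasFDerivAt v w) h1
        refine ((hasDerivAt_pow 2 s).mul h2).congr_deriv ?_
        rw [hF', hF']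
        have h3 := hcl.closed _ hsy v y w
        have h4 := hcl.antisymm _ hsy w v
        have h5 := hcl.fderiv_antisymm Metric.isOpen_ball hsy y w v
        have h6 := hcl.fderiv_antisymm Metric.isOpen_ball hsy w v y
        simp only [smul_apply, add_apply, smul_eq_mul]
        rw [h5] at h3
        rw [h6] at h3
        rw [h4]
        push_cast
        linear_combination (-s ^ 2) * h3
      rw [intervalIntegral.integral_eq_sub_of_hasDerivAt hd]
      · simp
      · exact (((hF'c y v).clm_apply continuous_const).sub
          ((hF'c y w).clm_apply continuous_const)).intervalIntegrable _ _
    · exact ((hF'c y v).clm_apply continuous_const).intervalIntegrable _ _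
    · exact ((hF'c y w).clm_apply continuous_const).intervalIntegrable _ _
  · intro v hv y hy
    rw [hint (hFc y)]
    refine intervalIntegral.integral_zero_ae (Filter.Eventually.of_forall fun s hs => ?_)
    have hsy := hmem y hy s (uIoc_subset_uIcc hs)
    simp only [F, smul_apply]
    rw [hcl.antisymm _ hsy, hv _ hsy]
    simp

variable [FiniteDimensional ℝ E]

/-- An injective linear map from a finite-dimensional space to its dual is invertible. -/
theorem exists_continuousLinearEquiv_of_nondegenerate {b : E →L[ℝ] E →L[ℝ] ℝ}
    (hb : ∀ v, (∀ w, b v w = 0) → v = 0) :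
    ∃ e : E ≃L[ℝ] (E →L[ℝ] ℝ), (e : E →L[ℝ] E →L[ℝ] ℝ) = b := by
  have hinj : Function.Injective (b : E →ₗ[ℝ] E →L[ℝ] ℝ) := by
    rw [injective_iff_map_eq_zero]
    intro v hv
    exact hb v fun w => congrArg (fun L => L w) hv
  have hfin : Module.finrank ℝ E = Module.finrank ℝ (E →L[ℝ] ℝ) := by
    rw [← LinearEquiv.finrank_eq (LinearMap.toContinuousLinearMap (𝕜 := ℝ) (E := E) (F' := ℝ))]
    exact Subspace.dual_finrank_eq.symm
  exact ⟨(LinearEquiv.ofInjectiveOfFinrankEq _ hinj hfin).toContinuousLinearEquiv, by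
    ext v w; rfl⟩

end PoincareLemma

section Moser

variable {E : Type} [NormedAddCommGroup E] [NormedSpace ℝ E]

/-- The linear interpolation, at time `p.1` and at the point `p.2`, between the constant form
`B 0` and the form `B`. -/
noncomputable def interpolatedForm (B : E → E →L[ℝ] E →L[ℝ] ℝ) (p : ℝ × E) : E →L[ℝ] E →L[ℝ] ℝ :=
  B 0 + p.1 • (B p.2 - B 0)

theorem contDiff_interpolatedForm {B : E → E →L[ℝ] E →L[ℝ] ℝ} (hB : ContDiff ℝ ∞ B) :
    ContDiff ℝ ∞ (interpolatedForm B) :=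
  contDiff_const.add (contDiff_fst.smul ((hB.comp contDiff_snd).sub contDiff_const))

theorem fderiv_interpolatedForm {B : E → E →L[ℝ] E →L[ℝ] ℝ} (hB : ContDiff ℝ ∞ B) (p q : ℝ × E) :
    fderiv ℝ (interpolatedForm B) p q = p.1 • fderiv ℝ B p.2 q.2 + q.1 • (B p.2 - B 0) := by
  have h1 : HasFDerivAt (fun q : ℝ × E => q.1) (ContinuousLinearMap.fst ℝ ℝ E) p :=
    hasFDerivAt_fst
  have h2 : HasFDerivAt (fun q : ℝ × E => B q.2) ((fderiv ℝ B p.2).comp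
      (ContinuousLinearMap.snd ℝ ℝ E)) p :=
    ((hB.differentiable (by simp)) p.2).hasFDerivAt.comp p hasFDerivAt_snd
  have h : HasFDerivAt (interpolatedForm B) _ p := (h1.smul (h2.sub_const (B 0))).const_add (B 0)
  rw [h.fderiv]
  simp

theorem interpolatedForm_antisymm {B : E → E →L[ℝ] E →L[ℝ] ℝ} {r : ℝ} (hr : 0 < r)
    (hcl : IsClosedTwoFormOn B (Metric.ball 0 r)) {p : ℝ × E} (hp : p.2 ∈ Metric.ball (0 : E) r)
    (v w : E) : interpolatedForm B p v w = -interpolatedForm B p w v := by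
  have h1 := hcl.antisymm _ hp v w
  have h2 := hcl.antisymm _ (Metric.mem_ball_self hr) v w
  simp only [interpolatedForm, add_apply, smul_apply, sub_apply, smul_eq_mul, h1, h2]
  ring

/-- The infinitesimal form of Moser's argument: the forms `interpolatedForm B (t, ·)` are carried
along by the time-dependent vector field `X` if `X` contracted with these forms is a primitive
of `B 0 - B`. -/
theorem moser_infinitesimal {B : E → E →L[ℝ] E →L[ℝ] ℝ} (hB : ContDiff ℝ ∞ B) {r : ℝ} (hr : 0 < r)
    (hcl : IsClosedTwoFormOn B (Metric.ball 0 r)) {α : E → E →L[ℝ] ℝ} (hα : ContDiff ℝ ∞ α)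
    (hdα : ∀ y ∈ Metric.ball (0 : E) r, ∀ v w,
      fderiv ℝ α y v w - fderiv ℝ α y w v = (B y - B 0) v w)
    {X : ℝ × E → E} {p : ℝ × E} (hp : p.2 ∈ Metric.ball (0 : E) r) (hXd : DifferentiableAt ℝ X p)
    (hX : ∀ᶠ q in 𝓝 p, ∀ w, interpolatedForm B q (X q) w = -α q.2 w) (V W : E) :
    fderiv ℝ (interpolatedForm B) p (1, X p) V W
      + interpolatedForm B p (fderiv ℝ X p (0, V)) W
      + interpolatedForm B p V (fderiv ℝ X p (0, W)) = 0 := by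
  have hΩd := ((contDiff_interpolatedForm hB).differentiable (by simp) p).hasFDerivAt
  have key : ∀ V W, fderiv ℝ (interpolatedForm B) p (0, V) (X p) W
      + interpolatedForm B p (fderiv ℝ X p (0, V)) W = -fderiv ℝ α p.2 V W := by
    intro V W
    have h1 : HasFDerivAt (fun q => interpolatedForm B q (X q)) _ p :=
      hΩd.clm_apply hXd.hasFDerivAt
    have h2 : HasFDerivAt (fun q : ℝ × E => -α q.2) _ p :=
      (((hα.differentiable (by simp)) p.2).hasFDerivAt.comp p hasFDerivAt_snd).neg
    have h3 := h2.congr_of_eventuallyEq (f₁ := fun q => interpolatedForm B q (X q))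
      (hX.mono fun q hq => by ext w; exact hq w)
    have := congrArg (fun L => L (0, V) W) (h1.unique h3)
    simp only [add_apply, ContinuousLinearMap.comp_apply, ContinuousLinearMap.flip_apply,
      neg_apply, ContinuousLinearMap.coe_snd'] at this
    linarith
  have k1 := key V W
  have k2 := key W V
  rw [interpolatedForm_antisymm hr hcl hp V]
  rw [fderiv_interpolatedForm hB] at k1 k2 ⊢
  have hc := hcl.closed _ hp (X p) V W
  have ha := hcl.fderiv_antisymm Metric.isOpen_ball hp V (X p) W
  have hd := hdα _ hp V W
  simp only [add_apply, smul_apply, sub_apply, smul_eq_mul, one_mul, add_zero,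
    zero_smul] at k1 k2 hd ⊢
  linear_combination k1 - k2 + p.1 * hc - p.1 * ha - hd

variable [FiniteDimensional ℝ E]

/-- The vector field of Moser's argument. -/
theorem exists_moser_field {B : E → E →L[ℝ] E →L[ℝ] ℝ} (hB : ContDiff ℝ ∞ B) {r : ℝ} (hr : 0 < r)
    (hcl : IsClosedTwoFormOn B (Metric.ball 0 r)) (hnd : ∀ v, (∀ w, B 0 v w = 0) → v = 0)
    (v₀ : E) (hv₀ : ∀ y ∈ Metric.ball (0 : E) r, B y v₀ = B 0 v₀) :
    ∃ (X : ℝ × E → E) (s : Set (ℝ × E)), IsOpen s ∧ (∀ t : ℝ, (t, (0 : E)) ∈ s) ∧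
      (∀ p ∈ s, p.2 ∈ Metric.ball (0 : E) r) ∧ ContDiffOn ℝ ∞ X s ∧
      (∀ t : ℝ, X (t, 0) = 0 ∧ fderiv ℝ X (t, 0) = 0) ∧
      (∀ p ∈ s, B 0 v₀ (X p) = 0) ∧
      ∀ p ∈ s, ∀ V W, fderiv ℝ (interpolatedForm B) p (1, X p) V W
        + interpolatedForm B p (fderiv ℝ X p (0, V)) W
        + interpolatedForm B p V (fderiv ℝ X p (0, W)) = 0 := by
  have h0r : (0 : E) ∈ Metric.ball (0 : E) r := Metric.mem_ball_self hr
  have hclη : IsClosedTwoFormOn (fun y => B y - B 0) (Metric.ball 0 r) := by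
    refine ⟨(hB.sub contDiff_const).contDiffOn, fun x hx v w => ?_, fun x hx u v w => ?_⟩
    · simp [hcl.antisymm x hx v w, hcl.antisymm 0 h0r v w]; ring
    · have hd : fderiv ℝ (fun y => B y - B 0) x = fderiv ℝ B x := fderiv_sub_const _
      rw [hd]
      exact hcl.closed x hx u v w
  obtain ⟨α, hα, hα0, hα'0, hdα, hαv⟩ := exists_primitive_of_closed
    (hB.sub contDiff_const) hclη (sub_self _)
  have hαv₀ := hαv v₀ (fun y hy => by simp [hv₀ y hy])
  let Ω := interpolatedForm B
  have hΩ : ContDiff ℝ ∞ Ω := contDiff_interpolatedForm hB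
  obtain ⟨e, he⟩ := exists_continuousLinearEquiv_of_nondegenerate hnd
  have hΩ0 : ∀ t : ℝ, Ω (t, 0) = B 0 := fun t => by simp [Ω, interpolatedForm]
  let s : Set (ℝ × E) := {p | p.2 ∈ Metric.ball (0 : E) r ∧
    Ω p ∈ range ((↑) : (E ≃L[ℝ] (E →L[ℝ] ℝ)) → E →L[ℝ] E →L[ℝ] ℝ)}
  have hs : IsOpen s := (Metric.isOpen_ball.preimage continuous_snd).inter
    (ContinuousLinearEquiv.isOpen.preimage hΩ.continuous)
  have h0s : ∀ t : ℝ, (t, (0 : E)) ∈ s := fun t => ⟨h0r, e, by rw [he, hΩ0]⟩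
  let X : ℝ × E → E := fun p => -(Ω p).inverse (α p.2)
  have hinv : ContDiffOn ℝ ∞ (fun p => (Ω p).inverse) s := by
    rintro p ⟨-, e', he'⟩
    refine ContDiffAt.contDiffWithinAt ?_
    have := contDiffAt_map_inverse (n := ∞) e'
    rw [he'] at this
    exact this.comp p hΩ.contDiffAt
  have hα2 : ContDiff ℝ ∞ fun p : ℝ × E => α p.2 := hα.comp contDiff_snd
  have hX : ContDiffOn ℝ ∞ X s := (hinv.clm_apply hα2.contDiffOn).neg
  have hXeq : ∀ p ∈ s, ∀ w, Ω p (X p) w = -α p.2 w := by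
    rintro p ⟨-, e', he'⟩ w
    simp only [X, map_neg, ← he']
    simp
  refine ⟨X, s, hs, h0s, fun p hp => hp.1, hX, fun t => ⟨by simp [X, hα0], ?_⟩, ?_, ?_⟩
  · have h1 : HasFDerivAt (fun p => (Ω p).inverse) _ (t, (0 : E)) :=
      ((hinv.contDiffAt (hs.mem_nhds (h0s t))).differentiableAt (by simp)).hasFDerivAt
    have h2 : HasFDerivAt (fun p : ℝ × E => α p.2) (0 : ℝ × E →L[ℝ] E →L[ℝ] ℝ) (t, (0 : E)) := by
      have h : HasFDerivAt α (0 : E →L[ℝ] E →L[ℝ] ℝ) (0 : E) := by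
        rw [← hα'0]; exact ((hα.differentiable (by simp)) 0).hasFDerivAt
      have := HasFDerivAt.comp (f := Prod.snd) (t, (0 : E)) h (hasFDerivAt_snd (𝕜 := ℝ))
      exact this.congr_fderiv (ContinuousLinearMap.ext fun q => rfl)
    have h3 : HasFDerivAt X (0 : ℝ × E →L[ℝ] E) (t, (0 : E)) :=
      (h1.clm_apply h2).neg.congr_fderiv (by simp [hα0])
    exact h3.fderiv
  · intro p hp
    have h1 : Ω p v₀ = B 0 v₀ := by simp [Ω, interpolatedForm, hv₀ _ hp.1]
    rw [← h1, interpolatedForm_antisymm hr hcl hp.1, hXeq p hp, hαv₀ _ hp.1]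
    simp
  · intro p hp V W
    exact moser_infinitesimal hB hr hcl hα hdα hp.1
      ((hX.contDiffAt (hs.mem_nhds hp)).differentiableAt (by simp))
      (Filter.mem_of_superset (hs.mem_nhds hp) hXeq) V W

theorem eq_of_hasDerivWithinAt_zero {F : Type*} [NormedAddCommGroup F] [NormedSpace ℝ F]
    {g : ℝ → F} (hg : ∀ t ∈ Icc (0 : ℝ) 1, HasDerivWithinAt g 0 (Icc 0 1) t) :
    ∀ t ∈ Icc (0 : ℝ) 1, g t = g 0 :=
  constant_of_has_deriv_right_zero (fun t ht => (hg t ht).continuousWithinAt)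
    (fun t ht => (hg t (Ico_subset_Icc_self ht)).mono_of_mem_nhdsWithin
      (Icc_mem_nhdsGE_of_mem ht))

/-- Darboux's theorem by Moser's argument, relative to a vector `v₀` whose contraction with the form
is already constant: the coordinate change preserves the function `B 0 v₀`. -/
theorem exists_moser {B : E → E →L[ℝ] E →L[ℝ] ℝ} {s : Set E} (hs : IsOpen s) (h0 : (0 : E) ∈ s)
    (hcl : IsClosedTwoFormOn B s) (hnd : ∀ v, (∀ w, B 0 v w = 0) → v = 0)
    (v₀ : E) (hv₀ : ∀ y ∈ s, B y v₀ = B 0 v₀) :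
    ∃ (Ψ : E → E) (u : Set E), IsOpen u ∧ (0 : E) ∈ u ∧ ContDiffOn ℝ ∞ Ψ u ∧ Ψ 0 = 0 ∧
      HasFDerivAt Ψ (ContinuousLinearMap.id ℝ E) 0 ∧
      ∀ y ∈ u, Ψ y ∈ s ∧ (∀ v w, B (Ψ y) (fderiv ℝ Ψ y v) (fderiv ℝ Ψ y w) = B 0 v w) ∧
        B 0 v₀ (Ψ y) = B 0 v₀ y := by
  obtain ⟨B', hB', -, hBB'⟩ := exists_contDiff_eventuallyEq_nhdsSet hs hcl.contDiffOn
    (isCompact_singleton (x := (0 : E))) (singleton_subset_iff.2 h0)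
  rw [nhdsSet_singleton] at hBB'
  obtain ⟨r, hr, hball⟩ := Metric.eventually_nhds_iff_ball.1 (hBB'.and (hs.mem_nhds h0))
  have h0r : (0 : E) ∈ Metric.ball (0 : E) r := Metric.mem_ball_self hr
  have hcl' : IsClosedTwoFormOn B' (Metric.ball 0 r) := by
    refine ⟨hB'.contDiffOn, fun x hx v w => ?_, fun x hx u v w => ?_⟩
    · rw [(hball x hx).1]; exact hcl.antisymm x (hball x hx).2 v w
    · have : B' =ᶠ[𝓝 x] B := Filter.mem_of_superset (Metric.isOpen_ball.mem_nhds hx)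
        fun y hy => (hball y hy).1
      rw [this.fderiv_eq]
      exact hcl.closed x (hball x hx).2 u v w
  have hB0 : B' 0 = B 0 := (hball 0 h0r).1
  obtain ⟨X, O, hO, h0O, hOr, hX, hX0, hXv, hXm⟩ := exists_moser_field hB' hr hcl'
    (by rwa [hB0]) v₀ (fun y hy => by rw [(hball y hy).1, hB0, hv₀ y (hball y hy).2])
  -- the suspended vector field, cut off outside a neighborhood of the time axis
  let Kt : Set (ℝ × E) := Icc (0 : ℝ) 1 ×ˢ {0}
  obtain ⟨F, hF, -, hFX⟩ := exists_contDiff_eventuallyEq_nhdsSet (X := fun p : ℝ × E => ((1 : ℝ), X p))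
    hO (contDiffOn_const.prodMk hX) (isCompact_Icc.prod isCompact_singleton : IsCompact Kt)
    (by rintro ⟨t, y⟩ ⟨-, rfl⟩; exact h0O t)
  obtain ⟨O', hO', hKO', hO'F⟩ := eventually_nhdsSet_iff_exists.1 hFX
  have hXd : ∀ p ∈ O, HasFDerivAt X (fderiv ℝ X p) p := fun p hp =>
    ((hX.contDiffAt (hO.mem_nhds hp)).differentiableAt (by simp)).hasFDerivAt
  have hF' : ∀ p ∈ O ∩ O', ∀ q, fderiv ℝ F p q = (0, fderiv ℝ X p q) := by
    rintro p ⟨hp, hp'⟩ q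
    have h1 := ((hasFDerivAt_const (1 : ℝ) p).prodMk (hXd p hp)).congr_of_eventuallyEq
      (f₁ := F) (Filter.mem_of_superset (hO'.mem_nhds hp') hO'F)
    rw [h1.fderiv]
    rfl
  let α₀ : C(unitInterval, ℝ × E) := ⟨fun t => ((t : ℝ), 0), by fun_prop⟩
  have hα₀K : ∀ t, α₀ t ∈ Kt := fun t => ⟨t.2, rfl⟩
  have hα₀O : ∀ t, α₀ t ∈ O ∩ O' := fun t => ⟨h0O t, hKO' (hα₀K t)⟩
  have hα₀F : ∀ t, F (α₀ t) = (1, 0) := fun t => by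
    rw [hO'F _ (hα₀O t).2]; simp only [α₀, ContinuousMap.coe_mk, (hX0 t).1]
  have hα₀F' : ∀ t, fderiv ℝ F (α₀ t) = 0 := fun t => by
    refine ContinuousLinearMap.ext fun q => ?_
    rw [hF' _ (hα₀O t)]
    simp [α₀, (hX0 t).2]
  obtain ⟨A, u, hu, hu0, hA, hA0, hAu⟩ := exists_smooth_family_of_solutions hF α₀ (0, 0)
    (fun t => by
      rw [primitiveCLM_apply]
      simp only [ContinuousMap.comp_apply, ContinuousMap.coe_mk, hα₀F]
      simp [α₀])
    (fun s t => by rw [hα₀F']; simp)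
  let j : E →L[ℝ] ℝ × E := ContinuousLinearMap.inr ℝ ℝ E
  let p1 : unitInterval := 1
  let ev : C(unitInterval, ℝ × E) →L[ℝ] E :=
    (ContinuousLinearMap.snd ℝ ℝ E).comp (ContinuousMap.evalCLM ℝ p1)
  let Ψ : E → E := fun y => ev (A (j y))
  have hju : IsOpen (j ⁻¹' u) := hu.preimage j.continuous
  have h0ju : (0 : E) ∈ j ⁻¹' u := hu0
  have hAj : ContDiffOn ℝ ∞ (fun y => A (j y)) (j ⁻¹' u) :=
    hA.comp j.contDiff.contDiffOn fun y hy => hy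
  let w : Set E := j ⁻¹' u ∩ (fun y => A (j y)) ⁻¹' {β | MapsTo β univ (O ∩ O')}
  have hw : IsOpen w := hAj.continuousOn.isOpen_inter_preimage hju
    (ContinuousMap.isOpen_setOfPred_mapsTo isCompact_univ (hO.inter hO'))
  have h0w : (0 : E) ∈ w := by
    refine ⟨h0ju, ?_⟩
    change MapsTo (A (0, 0)) univ (O ∩ O')
    rw [hA0]
    exact fun t _ => hα₀O t
  have hΨ : ContDiffOn ℝ ∞ Ψ (j ⁻¹' u) := ev.contDiff.comp_contDiffOn hAj
  have hΨ' : ∀ y ∈ j ⁻¹' u, HasFDerivAt Ψ (ev.comp ((fderiv ℝ A (j y)).comp j)) y :=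
    fun y hy => ev.hasFDerivAt.comp y ((((hA.contDiffAt (hu.mem_nhds hy)).differentiableAt
      (by simp)).hasFDerivAt).comp y j.hasFDerivAt)
  refine ⟨Ψ, w, hw, h0w, hΨ.mono inter_subset_left, ?_, ?_, ?_⟩
  · change ev (A (0, 0)) = 0
    rw [hA0]; rfl
  · refine (hΨ' 0 h0ju).congr_fderiv (ContinuousLinearMap.ext fun v => ?_)
    obtain ⟨h1, h2⟩ := (hAu (0, 0) hu0).2.2 (0, v)
    have h3 := eq_of_hasDerivWithinAt_zero (fun t ht => by
      have := h2 t ht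
      rwa [hA0, hα₀F', zero_apply] at this) 1 (right_mem_Icc.2 zero_le_one)
    have e1 : projIcc (0 : ℝ) 1 zero_le_one 1 = 1 := by simp
    have e0 : projIcc (0 : ℝ) 1 zero_le_one 0 = 0 := by simp
    rw [e1, e0, h1] at h3
    exact congrArg Prod.snd h3
  · rintro y ⟨hy, hyO⟩
    obtain ⟨hy0, hysol, hylin⟩ := hAu (j y) hy
    let P : ℝ → ℝ × E := fun t => A (j y) (projIcc 0 1 zero_le_one t)
    have hPO : ∀ t, P t ∈ O ∩ O' := fun t => hyO (mem_univ _)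
    have e1 : projIcc (0 : ℝ) 1 zero_le_one 1 = 1 := by simp
    have e0 : projIcc (0 : ℝ) 1 zero_le_one 0 = 0 := by simp
    have hP0 : P 0 = (0, y) := by simp only [P, e0]; exact hy0
    have hP' : ∀ t ∈ Icc (0 : ℝ) 1, HasDerivWithinAt P (1, X (P t)) (Icc 0 1) t := by
      intro t ht
      have := hysol t ht
      rwa [hO'F _ (hPO t).2] at this
    have hP1 : P 1 = (1, Ψ y) := by
      have h1 : ∀ t ∈ Icc (0 : ℝ) 1, HasDerivWithinAt (fun t => (P t).1 - t) 0 (Icc 0 1) t := by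
        intro t ht
        have := ((ContinuousLinearMap.fst ℝ ℝ E).hasFDerivAt.comp_hasDerivWithinAt t
          (hP' t ht)).sub (hasDerivWithinAt_id t _)
        exact this.congr_deriv (by simp)
      have h2 := eq_of_hasDerivWithinAt_zero h1 1 (right_mem_Icc.2 zero_le_one)
      rw [hP0] at h2
      refine Prod.ext (by simpa [sub_eq_zero] using h2) ?_
      simp only [P, e1]; rfl
    refine ⟨?_, fun v w' => ?_, ?_⟩
    · have := hOr _ (hPO 1).1
      rw [hP1] at this
      exact (hball _ this).2
    · let Q : E → ℝ → ℝ × E := fun v t => fderiv ℝ A (j y) (j v) (projIcc 0 1 zero_le_one t)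
      have hQ' : ∀ v, ∀ t ∈ Icc (0 : ℝ) 1,
          HasDerivWithinAt (Q v) (0, fderiv ℝ X (P t) (Q v t)) (Icc 0 1) t := by
        intro v t ht
        have := (hylin (j v)).2 t ht
        rwa [hF' _ (hPO t)] at this
      have hQ0 : ∀ v, Q v 0 = (0, v) := fun v => by
        simp only [Q, e0]; exact (hylin (j v)).1
      have hQ1 : ∀ v, (Q v 1).2 = fderiv ℝ Ψ y v := fun v => by
        rw [(hΨ' y hy).fderiv]; simp only [Q, e1]; rfl
      have hQf : ∀ v, ∀ t ∈ Icc (0 : ℝ) 1, Q v t = (0, (Q v t).2) := by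
        intro v t ht
        have h2 := eq_of_hasDerivWithinAt_zero (fun t ht =>
          (ContinuousLinearMap.fst ℝ ℝ E).hasFDerivAt.comp_hasDerivWithinAt t (hQ' v t ht)) t ht
        refine Prod.ext ?_ rfl
        have h3 : (Q v t).1 = (Q v 0).1 := h2
        rw [h3, hQ0]
      have hQs : ∀ v, ∀ t ∈ Icc (0 : ℝ) 1, HasDerivWithinAt (fun t => (Q v t).2)
          (fderiv ℝ X (P t) (0, (Q v t).2)) (Icc 0 1) t := by
        intro v t ht
        have := (ContinuousLinearMap.snd ℝ ℝ E).hasFDerivAt.comp_hasDerivWithinAt t (hQ' v t ht)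
        rw [← hQf v t ht]
        exact this
      have hg : ∀ t ∈ Icc (0 : ℝ) 1, HasDerivWithinAt
          (fun t => interpolatedForm B' (P t) (Q v t).2 (Q w' t).2) 0 (Icc 0 1) t := by
        intro t ht
        have hΩ := ((contDiff_interpolatedForm hB').differentiable (by simp) (P t)).hasFDerivAt
        have h1 := ((hΩ.comp_hasDerivWithinAt t (hP' t ht)).clm_apply (hQs v t ht)).clm_apply
          (hQs w' t ht)
        refine h1.congr_deriv ?_
        have := hXm _ (hPO t).1 (Q v t).2 (Q w' t).2
        simp only [Function.comp_apply, add_apply]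
        exact this
      have h2 := eq_of_hasDerivWithinAt_zero hg 1 (right_mem_Icc.2 zero_le_one)
      rw [hP1, hP0, hQ0, hQ0, hQ1, hQ1] at h2
      have h3 : Ψ y ∈ Metric.ball (0 : E) r := by
        have := hOr _ (hPO 1).1
        rwa [hP1] at this
      simpa [interpolatedForm, hB0, (hball _ h3).1] using h2
    · have h1 : ∀ t ∈ Icc (0 : ℝ) 1, HasDerivWithinAt (fun t => B 0 v₀ (P t).2) 0 (Icc 0 1) t := by
        intro t ht
        have := ((B 0 v₀).comp (ContinuousLinearMap.snd ℝ ℝ E)).hasFDerivAt.comp_hasDerivWithinAt t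
          (hP' t ht)
        have h0 := hXv _ (hPO t).1
        rw [hB0] at h0
        exact this.congr_deriv (by simp [h0])
      have h2 := eq_of_hasDerivWithinAt_zero h1 1 (right_mem_Icc.2 zero_le_one)
      rwa [hP1, hP0] at h2

end Moser

/-! ### Darboux coordinates -/

section Pullback

variable {E : Type} [NormedAddCommGroup E] [NormedSpace ℝ E]

/-- The pullback of a field of bilinear forms by a map. -/
noncomputable def pullbackForm (B : E → E →L[ℝ] E →L[ℝ] ℝ) (Ψ : E → E) (y : E) :
    E →L[ℝ] E →L[ℝ] ℝ :=
  (B (Ψ y)).bilinearComp (fderiv ℝ Ψ y) (fderiv ℝ Ψ y)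

theorem pullbackForm_apply (B : E → E →L[ℝ] E →L[ℝ] ℝ) (Ψ : E → E) (y v w : E) :
    pullbackForm B Ψ y v w = B (Ψ y) (fderiv ℝ Ψ y v) (fderiv ℝ Ψ y w) := rfl

theorem IsClosedTwoFormOn.pullback [FiniteDimensional ℝ E] {B : E → E →L[ℝ] E →L[ℝ] ℝ}
    {s u : Set E} (hB : IsClosedTwoFormOn B s) (hs : IsOpen s) (hu : IsOpen u) {Ψ : E → E}
    (hΨ : ContDiffOn ℝ ∞ Ψ u) (hΨs : MapsTo Ψ u s) : IsClosedTwoFormOn (pullbackForm B Ψ) u := by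
  have hD : ContDiffOn ℝ ∞ (fderiv ℝ Ψ) u := hΨ.fderiv_of_isOpen hu (by simp)
  have hDv : ∀ v, ContDiffOn ℝ ∞ (fun y => fderiv ℝ Ψ y v) u := fun v =>
    hD.clm_apply contDiffOn_const
  have hsm : ContDiffOn ℝ ∞ (pullbackForm B Ψ) u := by
    refine contDiffOn_clm_apply.2 fun v => contDiffOn_clm_apply.2 fun w => ?_
    exact ((hB.contDiffOn.comp hΨ hΨs).clm_apply (hDv v)).clm_apply (hDv w)
  refine ⟨hsm, fun x hx v w => hB.antisymm _ (hΨs hx) _ _, fun x hx u' v w => ?_⟩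
  have hΨx : ContDiffAt ℝ ∞ Ψ x := hΨ.contDiffAt (hu.mem_nhds hx)
  have hdΨ := (hΨx.differentiableAt (by simp)).hasFDerivAt
  have hd2 : HasFDerivAt (fderiv ℝ Ψ) (fderiv ℝ (fderiv ℝ Ψ) x) x :=
    ((hD.contDiffAt (hu.mem_nhds hx)).differentiableAt (by simp)).hasFDerivAt
  have hBx : HasFDerivAt B (fderiv ℝ B (Ψ x)) (Ψ x) :=
    ((hB.contDiffOn.contDiffAt (hs.mem_nhds (hΨs hx))).differentiableAt (by simp)).hasFDerivAt
  have hsymm : ∀ a b, fderiv ℝ (fderiv ℝ Ψ) x a b = fderiv ℝ (fderiv ℝ Ψ) x b a := fun a b =>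
    (hΨx.isSymmSndFDerivAt (by
      rw [minSmoothness_of_isRCLikeNormedField]
      exact WithTop.coe_le_coe.2 (le_top : (2 : ℕ∞) ≤ ⊤))).eq a b
  have key : ∀ a b c, fderiv ℝ (pullbackForm B Ψ) x a b c =
      fderiv ℝ B (Ψ x) (fderiv ℝ Ψ x a) (fderiv ℝ Ψ x b) (fderiv ℝ Ψ x c)
      + B (Ψ x) (fderiv ℝ (fderiv ℝ Ψ) x a b) (fderiv ℝ Ψ x c)
      + B (Ψ x) (fderiv ℝ Ψ x b) (fderiv ℝ (fderiv ℝ Ψ) x a c) := by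
    intro a b c
    have h1 := hasFDerivAt_apply_apply ((hsm.contDiffAt (hu.mem_nhds hx)).differentiableAt
      (by simp)).hasFDerivAt b c
    have h2 : HasFDerivAt (fun y => pullbackForm B Ψ y b c) _ x :=
      ((hBx.comp x hdΨ).clm_apply (hd2.clm_apply (hasFDerivAt_const b x))).clm_apply
        (hd2.clm_apply (hasFDerivAt_const c x))
    have := congrArg (fun L => L a) (h1.unique h2)
    simp only [ContinuousLinearMap.flip_apply] at this
    rw [this]
    simp
    ring
  rw [key, key, key, hsymm v u', hsymm w u', hsymm w v]
  have hcl := hB.closed _ (hΨs hx) (fderiv ℝ Ψ x u') (fderiv ℝ Ψ x v) (fderiv ℝ Ψ x w)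
  have ha := hB.antisymm _ (hΨs hx)
  have a1 := ha (fderiv ℝ Ψ x v) (fderiv ℝ (fderiv ℝ Ψ) x u' w)
  have a2 := ha (fderiv ℝ Ψ x w) (fderiv ℝ (fderiv ℝ Ψ) x u' v)
  have a3 := ha (fderiv ℝ Ψ x u') (fderiv ℝ (fderiv ℝ Ψ) x v w)
  linear_combination hcl + a1 + a2 + a3

variable [FiniteDimensional ℝ E]

/-- A smooth function with nonzero differential is linear in suitable coordinates. -/
theorem exists_straighten_function {H : E → ℝ} {s : Set E} (hs : IsOpen s) (h0 : (0 : E) ∈ s)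
    (hH : ContDiffOn ℝ ∞ H s) (hdH : fderiv ℝ H 0 ≠ 0) :
    ∃ (Ψ : E → E) (u : Set E), IsOpen u ∧ (0 : E) ∈ u ∧ ContDiffOn ℝ ∞ Ψ u ∧ Ψ 0 = 0 ∧
      HasFDerivAt Ψ (ContinuousLinearMap.id ℝ E) 0 ∧ ∀ y ∈ u, Ψ y ∈ s ∧
        H (Ψ y) = H 0 + fderiv ℝ H 0 y := by
  set ℓ := fderiv ℝ H 0 with hℓ
  obtain ⟨v, hv⟩ : ∃ v, ℓ v = 1 := by
    obtain ⟨v, hv⟩ : ∃ v, ℓ v ≠ 0 := by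
      by_contra! h
      exact hdH (ContinuousLinearMap.ext h)
    exact ⟨(ℓ v)⁻¹ • v, by simp [hv]⟩
  let G : E → E := fun x => x + (H x - H 0 - ℓ x) • v
  have hG : ContDiffOn ℝ ∞ G s := contDiffOn_id.add
    (((hH.sub contDiffOn_const).sub ℓ.contDiff.contDiffOn).smul contDiffOn_const)
  have hG' : HasFDerivAt G ((ContinuousLinearEquiv.refl ℝ E : E ≃L[ℝ] E) : E →L[ℝ] E) 0 := by
    have hd : HasFDerivAt H ℓ 0 :=
      ((hH.contDiffAt (hs.mem_nhds h0)).differentiableAt (by simp)).hasFDerivAt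
    have h1 := (hasFDerivAt_id (𝕜 := ℝ) (0 : E)).add
      (((hd.sub_const (H 0)).sub ℓ.hasFDerivAt).smul_const v)
    refine h1.congr_fderiv (ContinuousLinearMap.ext fun w => by simp)
  obtain ⟨φ, hφ0, hφs, hφG, hφ⟩ := exists_openPartialHomeomorph_contDiffOn_symm hs hG h0 hG'
  have hG0 : G 0 = 0 := by simp [G]
  have h0t : (0 : E) ∈ φ.target := by
    have := φ.map_source hφ0
    rwa [hφG, hG0] at this
  have hsymm0 : φ.symm 0 = 0 := by
    have := φ.left_inv hφ0
    rwa [hφG, hG0] at this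
  refine ⟨φ.symm, φ.target, φ.open_target, h0t, hφ, hsymm0, ?_, fun y hy => ⟨hφs (φ.map_target hy),
    ?_⟩⟩
  · have := φ.hasFDerivAt_symm (f' := ContinuousLinearEquiv.refl ℝ E) h0t (by
      rw [hsymm0]
      exact hG'.congr_of_eventuallyEq (Filter.Eventually.of_forall hφG))
    simpa using this
  · have h1 := φ.right_inv hy
    rw [hφG] at h1
    have h2 := congrArg ℓ h1
    simp only [G, map_add, map_smul, hv, smul_eq_mul, mul_one] at h2
    linarith

/-- The vector field which is dual to a 1-form `ℓ` with respect to a 2-form which is nondegenerate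
at a point `x₀`, near `x₀`. -/
theorem exists_dual_field {B : E → E →L[ℝ] E →L[ℝ] ℝ} {s : Set E} (hs : IsOpen s) {x₀ : E}
    (h0 : x₀ ∈ s) (hB : ContDiffOn ℝ ∞ B s) (hnd : ∀ v, (∀ w, B x₀ v w = 0) → v = 0)
    {ℓ : E → E →L[ℝ] ℝ} (hℓ : ContDiffOn ℝ ∞ ℓ s) :
    ∃ (X : E → E) (u : Set E), IsOpen u ∧ x₀ ∈ u ∧ u ⊆ s ∧ ContDiffOn ℝ ∞ X u ∧
      ∀ y ∈ u, B y (X y) = ℓ y := by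
  obtain ⟨e, he⟩ := exists_continuousLinearEquiv_of_nondegenerate hnd
  let u : Set E := s ∩ B ⁻¹' range ((↑) : (E ≃L[ℝ] (E →L[ℝ] ℝ)) → E →L[ℝ] E →L[ℝ] ℝ)
  refine ⟨fun y => (B y).inverse (ℓ y), u, hB.continuousOn.isOpen_inter_preimage hs
    ContinuousLinearEquiv.isOpen, ⟨h0, e, he⟩, inter_subset_left, ?_, ?_⟩
  · refine ContDiffOn.clm_apply ?_ (hℓ.mono inter_subset_left)
    rintro y ⟨hy, e', he'⟩
    refine ContDiffAt.contDiffWithinAt ?_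
    have := contDiffAt_map_inverse (n := ∞) e'
    rw [he'] at this
    exact this.comp y (hB.contDiffAt (hs.mem_nhds hy))
  · rintro y ⟨hy, e', he'⟩
    simp only [← he']
    simp

/-- Darboux's theorem for a closed nondegenerate 2-form `B` together with a function `H` with
nonzero differential: in suitable coordinates `B` is constant, and `H` is affine with Hamiltonian
vector field the constant field `v₀`. -/
theorem exists_darboux {B : E → E →L[ℝ] E →L[ℝ] ℝ} {s : Set E} (hs : IsOpen s)
    (h0 : (0 : E) ∈ s) (hB : IsClosedTwoFormOn B s) (hnd : ∀ v, (∀ w, B 0 v w = 0) → v = 0)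
    {H : E → ℝ} (hH : ContDiffOn ℝ ∞ H s) (hdH : fderiv ℝ H 0 ≠ 0) :
    ∃ (Ψ : E → E) (u : Set E) (v₀ : E), IsOpen u ∧ (0 : E) ∈ u ∧ ContDiffOn ℝ ∞ Ψ u ∧ Ψ 0 = 0 ∧
      HasFDerivAt Ψ (ContinuousLinearMap.id ℝ E) 0 ∧ v₀ ≠ 0 ∧ ∀ y ∈ u, Ψ y ∈ s ∧
        (∀ v w, B (Ψ y) (fderiv ℝ Ψ y v) (fderiv ℝ Ψ y w) = B 0 v w) ∧
        H (Ψ y) = H 0 + B 0 v₀ y := by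
  obtain ⟨Ψ₁, u₁, hu₁, h0u₁, hΨ₁, hΨ₁0, hΨ₁', hΨ₁u⟩ := exists_straighten_function hs h0 hH hdH
  have hB₁ := hB.pullback hs hu₁ hΨ₁ (fun y hy => (hΨ₁u y hy).1)
  set B₁ := pullbackForm B Ψ₁
  have hB₁0 : B₁ 0 = B 0 := by
    ext v w
    simp [B₁, pullbackForm_apply, hΨ₁'.fderiv, hΨ₁0]
  set ℓ := fderiv ℝ H 0 with hℓ
  obtain ⟨X, s₁, hs₁, h0s₁, hs₁u, hX, hXℓ⟩ := exists_dual_field hu₁ h0u₁ hB₁.contDiffOn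
    (by rwa [hB₁0]) (ℓ := fun _ => ℓ) contDiffOn_const
  have hX0 : X 0 ≠ 0 := by
    intro h
    have := hXℓ 0 h0s₁
    rw [h, map_zero] at this
    exact hdH this.symm
  obtain ⟨θ, hθ⟩ : ∃ θ : E →L[ℝ] ℝ, θ (X 0) = 1 := by
    obtain ⟨θ, hθ⟩ := SeparatingDual.exists_eq_one (R := ℝ) hX0
    exact ⟨θ, hθ⟩
  obtain ⟨Ψ₂, u₂, hu₂, h0u₂, hΨ₂, hΨ₂', hΨ₂u⟩ := exists_flow_box hs₁ h0s₁ hX θ hθ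
  have hΨ₂0 : Ψ₂ 0 = 0 := (hΨ₂u 0 h0u₂).2.2 (map_zero θ)
  have hℓX : ∀ y ∈ s₁, ℓ (X y) = 0 := by
    intro y hy
    have h1 := hB₁.antisymm y (hs₁u hy) (X y) (X y)
    rw [hXℓ y hy] at h1
    linarith
  -- on a convex neighborhood, the straightened function is preserved by the flow box
  let p : E →L[ℝ] E := ContinuousLinearMap.id ℝ E - θ.smulRight (X 0)
  obtain ⟨r, hr, hru⟩ := Metric.isOpen_iff.1 (hu₂.inter (hu₂.preimage p.continuous)) 0
    ⟨h0u₂, by simpa [p] using h0u₂⟩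
  have hd₂ : ∀ y ∈ u₂, HasFDerivAt Ψ₂ (fderiv ℝ Ψ₂ y) y := fun y hy =>
    ((hΨ₂.contDiffAt (hu₂.mem_nhds hy)).differentiableAt (by simp)).hasFDerivAt
  obtain ⟨r', hr', hr'u⟩ : ∃ r' > 0, ∀ y ∈ Metric.ball (0 : E) r', ∀ t ∈ Icc (0 : ℝ) 1,
      p y + t • (θ y • X 0) ∈ Metric.ball (0 : E) r := by
    have hc : ContinuousAt (fun y : E => ‖p y‖ + ‖θ y • X 0‖) 0 := by fun_prop
    obtain ⟨r', hr', h⟩ := Metric.eventually_nhds_iff_ball.1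
      (hc.eventually_lt continuousAt_const (by simpa using hr))
    refine ⟨r', hr', fun y hy t ht => ?_⟩
    rw [mem_ball_zero_iff]
    refine lt_of_le_of_lt (norm_add_le _ _) (lt_of_le_of_lt ?_ (h y hy))
    rw [norm_smul t, Real.norm_of_nonneg ht.1]
    have := mul_le_of_le_one_left (norm_nonneg (θ y • X 0)) ht.2
    linarith
  have hℓΨ : ∀ y ∈ Metric.ball (0 : E) r', ℓ (Ψ₂ y) = ℓ y := by
    intro y hy
    have hmem : ∀ t ∈ Icc (0 : ℝ) 1, p y + t • (θ y • X 0) ∈ u₂ := fun t ht =>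
      (hru (hr'u y hy t ht)).1
    have hpy : p y + (1 : ℝ) • (θ y • X 0) = y := by simp [p]
    have h1 : ∀ t ∈ Icc (0 : ℝ) 1, HasDerivWithinAt (fun t => ℓ (Ψ₂ (p y + t • (θ y • X 0)))) 0
        (Icc 0 1) t := by
      intro t ht
      have hl : HasDerivAt (fun t : ℝ => p y + t • (θ y • X 0)) (θ y • X 0) t := by
        simpa using ((hasDerivAt_id t).smul_const (θ y • X 0)).const_add (p y)
      have h2 := (ℓ.hasFDerivAt.comp_hasDerivAt t
        ((hd₂ _ (hmem t ht)).comp_hasDerivAt t hl)).hasDerivWithinAt (s := Icc 0 1)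
      refine h2.congr_deriv ?_
      rw [map_smul, (hΨ₂u _ (hmem t ht)).2.1, map_smul, hℓX _ (hΨ₂u _ (hmem t ht)).1, smul_zero]
    have h2 := eq_of_hasDerivWithinAt_zero h1 1 (right_mem_Icc.2 zero_le_one)
    rw [hpy] at h2
    rw [h2, zero_smul, add_zero]
    have hpyu : p y ∈ u₂ := by simpa using hmem 0 (left_mem_Icc.2 zero_le_one)
    rw [(hΨ₂u _ hpyu).2.2 (by simp [p, hθ])]
    simp [p, hℓX 0 h0s₁]
  have h0r' : (0 : E) ∈ Metric.ball (0 : E) r' := Metric.mem_ball_self hr'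
  have hr'u₂ : Metric.ball (0 : E) r' ⊆ u₂ := by
    intro y hy
    have := (hru (hr'u y hy 1 (right_mem_Icc.2 zero_le_one))).1
    simpa [p] using this
  have hB₂ := hB₁.pullback hu₁ Metric.isOpen_ball (hΨ₂.mono hr'u₂)
    (fun y hy => hs₁u (hΨ₂u y (hr'u₂ hy)).1)
  set B₂ := pullbackForm B₁ Ψ₂
  have hB₂0 : B₂ 0 = B 0 := by
    ext v w
    simp [B₂, pullbackForm_apply, hΨ₂'.fderiv, hΨ₂0, hB₁0]
  have hB0X : B 0 (X 0) = ℓ := by rw [← hB₁0]; exact hXℓ 0 h0s₁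
  obtain ⟨Ψ₃, u₃, hu₃, h0u₃, hΨ₃, hΨ₃0, hΨ₃', hΨ₃u⟩ := exists_moser Metric.isOpen_ball h0r' hB₂
    (by rwa [hB₂0]) (X 0) (by
      intro y hy
      rw [hB₂0, hB0X]
      ext w
      rw [pullbackForm_apply, (hΨ₂u y (hr'u₂ hy)).2.1, hXℓ _ (hΨ₂u y (hr'u₂ hy)).1]
      have h1 : HasFDerivAt (fun z => ℓ (Ψ₂ z)) (ℓ.comp (fderiv ℝ Ψ₂ y)) y :=
        ℓ.hasFDerivAt.comp y (hd₂ y (hr'u₂ hy))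
      have h2 := ℓ.hasFDerivAt.congr_of_eventuallyEq (f₁ := fun z => ℓ (Ψ₂ z)) (x := y)
        (Filter.mem_of_superset (Metric.isOpen_ball.mem_nhds hy) hℓΨ)
      exact congrArg (fun L => L w) (h1.unique h2))
  have hd₁ : ∀ y ∈ u₁, HasFDerivAt Ψ₁ (fderiv ℝ Ψ₁ y) y := fun y hy =>
    ((hΨ₁.contDiffAt (hu₁.mem_nhds hy)).differentiableAt (by simp)).hasFDerivAt
  have hd₃ : ∀ y ∈ u₃, HasFDerivAt Ψ₃ (fderiv ℝ Ψ₃ y) y := fun y hy =>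
    ((hΨ₃.contDiffAt (hu₃.mem_nhds hy)).differentiableAt (by simp)).hasFDerivAt
  have hm₃ : ∀ y ∈ u₃, Ψ₃ y ∈ u₂ := fun y hy => hr'u₂ (hΨ₃u y hy).1
  have hm₂ : ∀ y ∈ u₃, Ψ₂ (Ψ₃ y) ∈ u₁ := fun y hy => hs₁u (hΨ₂u _ (hm₃ y hy)).1
  refine ⟨fun y => Ψ₁ (Ψ₂ (Ψ₃ y)), u₃, X 0, hu₃, h0u₃, ?_, by simp [hΨ₃0, hΨ₂0, hΨ₁0], ?_, hX0, ?_⟩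
  · exact hΨ₁.comp (hΨ₂.comp hΨ₃ hm₃) hm₂
  · have h2 : HasFDerivAt Ψ₂ (ContinuousLinearMap.id ℝ E) (Ψ₃ 0) := by rwa [hΨ₃0]
    have h1 : HasFDerivAt Ψ₁ (ContinuousLinearMap.id ℝ E) (Ψ₂ (Ψ₃ 0)) := by rwa [hΨ₃0, hΨ₂0]
    exact h1.comp (0 : E) (h2.comp (0 : E) hΨ₃')
  · intro y hy
    have hd : HasFDerivAt (fun y => Ψ₁ (Ψ₂ (Ψ₃ y))) _ y :=
      (hd₁ _ (hm₂ y hy)).comp y ((hd₂ _ (hm₃ y hy)).comp y (hd₃ y hy))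
    refine ⟨(hΨ₁u _ (hm₂ y hy)).1, fun v w => ?_, ?_⟩
    · have := (hΨ₃u y hy).2.1 v w
      rw [hB₂0] at this
      rw [hd.fderiv, ← this]
      rfl
    · rw [(hΨ₁u _ (hm₂ y hy)).2, hℓΨ _ (hΨ₃u y hy).1, ← hB0X]
      have := (hΨ₃u y hy).2.2
      rw [hB₂0] at this
      rw [this]

end Pullback

/-! ### The linear model: phase space, time and energy -/

section Splitting

variable {m : ℕ}

/-- The projection of `ℝᵐ⁺²` to the first `m` coordinates. -/
noncomputable def zc : Euc (m + 2) →L[ℝ] Euc m :=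
  (EuclideanSpace.equiv (Fin m) ℝ).symm.toContinuousLinearMap.comp
    (ContinuousLinearMap.pi fun i => EuclideanSpace.proj (Fin.castAdd 2 i))

/-- The coordinate number `m` of `ℝᵐ⁺²`, the time. -/
noncomputable def tc : Euc (m + 2) →L[ℝ] ℝ := EuclideanSpace.proj (Fin.natAdd m 0)

/-- The coordinate number `m + 1` of `ℝᵐ⁺²`, the energy. -/
noncomputable def ec : Euc (m + 2) →L[ℝ] ℝ := EuclideanSpace.proj (Fin.natAdd m 1)

/-- The inclusion of `ℝᵐ` into `ℝᵐ⁺²` as the first `m` coordinates. -/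
noncomputable def zIncl : Euc m →L[ℝ] Euc (m + 2) :=
  LinearMap.toContinuousLinearMap
    { toFun := pad m (m + 2)
      map_add' := fun x y => by
        ext i
        simp only [pad, PiLp.add_apply]
        split_ifs <;> simp
      map_smul' := fun c x => by
        ext i
        simp only [pad, PiLp.smul_apply, RingHom.id_apply]
        split_ifs <;> simp }

/-- The unit vector of the time coordinate. -/
noncomputable def tVec : Euc (m + 2) := EuclideanSpace.single (Fin.natAdd m 0) 1

/-- The unit vector of the energy coordinate. -/
noncomputable def eVec : Euc (m + 2) := EuclideanSpace.single (Fin.natAdd m 1) 1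

theorem zIncl_eq_pad (z : Euc m) : zIncl z = pad m (m + 2) z := rfl

theorem zc_apply (y : Euc (m + 2)) (i : Fin m) : zc y i = y (Fin.castAdd 2 i) := rfl

theorem tc_apply (y : Euc (m + 2)) : tc y = y (Fin.natAdd m 0) := rfl

theorem ec_apply (y : Euc (m + 2)) : ec y = y (Fin.natAdd m 1) := rfl

@[simp] theorem zc_zIncl (z : Euc m) : zc (zIncl z) = z := by
  ext i
  simp [zc_apply, zIncl_eq_pad, pad]

@[simp] theorem tc_zIncl (z : Euc m) : tc (zIncl z) = 0 := by
  simp [tc_apply, zIncl_eq_pad, pad]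

@[simp] theorem ec_zIncl (z : Euc m) : ec (zIncl z) = 0 := by
  simp [ec_apply, zIncl_eq_pad, pad]

@[simp] theorem zc_tVec : zc (tVec : Euc (m + 2)) = 0 := by
  ext i
  simp [zc_apply, tVec, Fin.ext_iff, i.2.ne]

@[simp] theorem zc_eVec : zc (eVec : Euc (m + 2)) = 0 := by
  ext i
  have := i.2
  simp [zc_apply, eVec, Fin.ext_iff]
  omega

@[simp] theorem tc_tVec : tc (tVec : Euc (m + 2)) = 1 := by simp [tc_apply, tVec]

@[simp] theorem ec_tVec : ec (tVec : Euc (m + 2)) = 0 := by simp [ec_apply, tVec, Fin.ext_iff]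

@[simp] theorem tc_eVec : tc (eVec : Euc (m + 2)) = 0 := by simp [tc_apply, eVec, Fin.ext_iff]

@[simp] theorem ec_eVec : ec (eVec : Euc (m + 2)) = 1 := by simp [ec_apply, eVec]

theorem euc_ext {y y' : Euc (m + 2)} (hz : zc y = zc y') (ht : tc y = tc y') (he : ec y = ec y') :
    y = y' := by
  ext i
  refine Fin.addCases (fun i => ?_) (fun i => ?_) i
  · exact congrArg (fun z : Euc m => z i) hz
  · fin_cases i
    · exact ht
    · exact he

theorem euc_decomp (y : Euc (m + 2)) : zIncl (zc y) + tc y • tVec + ec y • eVec = y :=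
  euc_ext (by simp) (by simp) (by simp)

/-- Points with vanishing energy coordinate form the coordinate subspace of dimension `m + 1`. -/
theorem forall_coord_eq_zero_iff_ec (y : Euc (m + 2)) :
    (∀ i : Fin (m + 2), m + 1 ≤ (i : ℕ) → y i = 0) ↔ ec y = 0 := by
  constructor
  · exact fun h => h _ (by simp)
  · intro h i hi
    have : i = Fin.natAdd m 1 := Fin.ext (by simp; omega)
    rw [this]
    exact h

theorem forall_coord_eq_zero_iff (y : Euc (m + 2)) :
    (∀ i : Fin (m + 2), m ≤ (i : ℕ) → y i = 0) ↔ tc y = 0 ∧ ec y = 0 := by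
  constructor
  · exact fun h => ⟨h _ (by simp), h _ (by simp)⟩
  · rintro ⟨h1, h2⟩ i hi
    rcases hi.eq_or_lt with h | h
    · have : i = Fin.natAdd m 0 := Fin.ext (by simpa using h.symm)
      rw [this]
      exact h1
    · exact (forall_coord_eq_zero_iff_ec y).2 h2 i h

/-- The bilinear form `ωZ ⊕ (dt ∧ de)` on `ℝᵐ⁺²`. -/
noncomputable def stdForm (ωZ : Euc m →L[ℝ] Euc m →L[ℝ] ℝ) (y y' : Euc (m + 2)) : ℝ :=
  ωZ (zc y) (zc y') + tc y * ec y' - ec y * tc y'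

theorem stdForm_tVec (ωZ : Euc m →L[ℝ] Euc m →L[ℝ] ℝ) (y : Euc (m + 2)) :
    stdForm ωZ tVec y = ec y := by
  simp [stdForm]

/-- A nondegenerate antisymmetric form splits off a hyperbolic plane containing a given vector. -/
theorem exists_linear_normal_form {E : Type} [NormedAddCommGroup E] [NormedSpace ℝ E]
    [FiniteDimensional ℝ E] (hE : Module.finrank ℝ E = m + 2) (b : E →L[ℝ] E →L[ℝ] ℝ)
    (hb : ∀ v w, b v w = - b w v) (hnd : ∀ v, (∀ w, b v w = 0) → v = 0) {v₀ : E} (hv₀ : v₀ ≠ 0) :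
    ∃ (Λ : Euc (m + 2) ≃L[ℝ] E) (ωZ : Euc m →L[ℝ] Euc m →L[ℝ] ℝ),
      (∀ v w, ωZ v w = - ωZ w v) ∧ (∀ y y', b (Λ y) (Λ y') = stdForm ωZ y y') ∧ Λ tVec = v₀ := by
  obtain ⟨w, hw⟩ : ∃ w, b v₀ w ≠ 0 := by
    by_contra! h
    exact hv₀ (hnd _ h)
  set w₁ := (b v₀ w)⁻¹ • w with hw₁
  have h01 : b v₀ w₁ = 1 := by simp [hw₁, hw]
  have h10 : b w₁ v₀ = -1 := by rw [hb, h01]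
  have haa : ∀ v, b v v = 0 := fun v => by linarith [hb v v]
  let L : E →ₗ[ℝ] ℝ × ℝ := ((b v₀).prod (b w₁)).toLinearMap
  have hL : ∀ v, L v = (b v₀ v, b w₁ v) := fun v => rfl
  have hLsurj : LinearMap.range L = ⊤ := by
    rw [LinearMap.range_eq_top]
    rintro ⟨p, q⟩
    exact ⟨p • w₁ - q • v₀, by simp [hL, h01, h10, haa]⟩
  have hrank : Module.finrank ℝ (LinearMap.ker L) = Module.finrank ℝ (Euc m) := by
    have h1 := L.finrank_range_add_finrank_ker
    rw [hLsurj, finrank_top, Module.finrank_prod, Module.finrank_self, hE] at h1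
    rw [finrank_euclideanSpace_fin]
    omega
  let φ : Euc m ≃L[ℝ] LinearMap.ker L := ContinuousLinearEquiv.ofFinrankEq hrank.symm
  have hφ : ∀ z, b v₀ (φ z) = 0 ∧ b w₁ (φ z) = 0 := by
    intro z
    have := LinearMap.mem_ker.1 (φ z).2
    rw [hL] at this
    exact ⟨congrArg Prod.fst this, congrArg Prod.snd this⟩
  let ι : Euc m →L[ℝ] E := (LinearMap.ker L).subtypeL.comp φ.toContinuousLinearMap
  have hι : ∀ z, ι z = φ z := fun z => rfl
  let Λ₀ : Euc (m + 2) →L[ℝ] E := ι.comp zc + tc.smulRight v₀ + ec.smulRight w₁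
  have hΛ₀ : ∀ y, Λ₀ y = φ (zc y) + tc y • v₀ + ec y • w₁ := fun y => rfl
  have hinj : Function.Injective Λ₀ := by
    rw [injective_iff_map_eq_zero]
    intro y hy
    rw [hΛ₀] at hy
    have h1 := congrArg (b v₀) hy
    have h2 := congrArg (b w₁) hy
    simp [hφ, h01, haa, h10] at h1 h2
    rw [h1, h2] at hy
    refine euc_ext ?_ (by simpa using h2) (by simpa using h1)
    simpa using hy
  let Λ : Euc (m + 2) ≃L[ℝ] E := (LinearEquiv.ofInjectiveOfFinrankEq Λ₀.toLinearMap hinj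
    (by rw [hE, finrank_euclideanSpace_fin])).toContinuousLinearEquiv
  have hΛ : ∀ y, Λ y = φ (zc y) + tc y • v₀ + ec y • w₁ := fun y => rfl
  refine ⟨Λ, b.bilinearComp ι ι, fun v w => hb _ _, fun y y' => ?_, ?_⟩
  · rw [hΛ, hΛ]
    have h3 : ∀ z, b (φ z) v₀ = 0 := fun z => by rw [hb, (hφ z).1, neg_zero]
    have h4 : ∀ z, b (φ z) w₁ = 0 := fun z => by rw [hb, (hφ z).2, neg_zero]
    simp [stdForm, hφ, h01, h10, haa, h3, h4, hι]
    ring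
  · simp [hΛ]

end Splitting

/-! ### Symplectic forms and Hamiltonian vector fields in charts -/

section ChartCalculus

variable {d : ℕ} {Ω : Type*} [TopologicalSpace Ω] [ChartedSpace (Euc d) Ω]
  {σ : TwoForm d Ω} {H : Ω → ℝ} {e c : OpenPartialHomeomorph Ω (Euc d)}

/-- The expression of a 2-form in a chart, as a bilinear form. -/
noncomputable def formInChart (σ : TwoForm d Ω) (e : OpenPartialHomeomorph Ω (Euc d))
    (z : Euc d) : Euc d →L[ℝ] Euc d →L[ℝ] ℝ :=
  ((continuousMultilinearCurryFin1 ℝ (Euc d) ℝ).toContinuousLinearEquiv :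
      ContinuousMultilinearMap ℝ (fun _ : Fin 1 => Euc d) ℝ →L[ℝ] _).comp
    (σ.inChart e z).toContinuousMultilinearMap.curryLeft

theorem formInChart_apply (z v w : Euc d) : formInChart σ e z v w = σ.inChart e z ![v, w] := by
  change σ.inChart e z (Fin.cons v (Fin.snoc 0 w)) = _
  congr 1
  ext i
  fin_cases i <;> rfl

theorem formInChart_apply_eq (z v w : Euc d) : formInChart σ e z v w =
    σ (e.symm z) ![mfderiv (𝓡 d) (𝓡 d) e.symm z v, mfderiv (𝓡 d) (𝓡 d) e.symm z w] := by
  rw [formInChart_apply]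
  change σ (e.symm z) (_ ∘ ![v, w]) = _
  congr 1
  ext i
  fin_cases i <;> rfl

theorem mdifferentiable_of_mem_maximalAtlas (he : e ∈ IsManifold.maximalAtlas (𝓡 d) ∞ Ω) :
    e.MDifferentiable (𝓡 d) (𝓡 d) :=
  ⟨(contMDiffOn_of_mem_maximalAtlas he).mdifferentiableOn (by simp),
    (contMDiffOn_symm_of_mem_maximalAtlas he).mdifferentiableOn (by simp)⟩

theorem IsSymplecticForm.isClosedTwoFormOn_formInChart (hσ : IsSymplecticForm σ)
    (he : e ∈ IsManifold.maximalAtlas (𝓡 d) ∞ Ω) :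
    IsClosedTwoFormOn (formInChart σ e) e.target := by
  have hsm := hσ.smooth e he
  have hev : ∀ v w : Euc d, ContDiffOn ℝ ∞ (fun z => formInChart σ e z v w) e.target := by
    intro v w
    have : ContDiff ℝ ∞ (fun A : (Euc d) [⋀^Fin 2]→L[ℝ] ℝ => A ![v, w]) :=
      (ContinuousAlternatingMap.apply ℝ (Euc d) ℝ ![v, w]).contDiff
    exact (this.comp_contDiffOn hsm).congr fun z _ => formInChart_apply z v w
  have hB : ContDiffOn ℝ ∞ (formInChart σ e) e.target :=
    contDiffOn_clm_apply.2 fun v => contDiffOn_clm_apply.2 fun w => hev v w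
  refine ⟨hB, fun x _ v w => ?_, fun x hx u v w => ?_⟩
  · rw [formInChart_apply, formInChart_apply]
    have := (σ.inChart e x).toAlternatingMap.map_swap ![w, v] (i := 0) (j := 1) (by simp)
    rw [show ![w, v] ∘ (Equiv.swap (0 : Fin 2) 1) = ![v, w] by
      ext i; fin_cases i <;> rfl] at this
    exact this
  · have h0 := congrArg (fun A => A ![u, v, w]) (hσ.closed e he x hx)
    change extDeriv (σ.inChart e) x ![u, v, w] = 0 at h0
    have hd : DifferentiableAt ℝ (σ.inChart e) x :=
      (hsm.contDiffAt (e.open_target.mem_nhds hx)).differentiableAt (by simp)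
    have hdB : HasFDerivAt (formInChart σ e) (fderiv ℝ (formInChart σ e) x) x :=
      ((hB.contDiffAt (e.open_target.mem_nhds hx)).differentiableAt (by simp)).hasFDerivAt
    have key : ∀ a b c, fderiv ℝ (fun z => σ.inChart e z ![b, c]) x a =
        fderiv ℝ (formInChart σ e) x a b c := by
      intro a b c
      have h1 := (hasFDerivAt_apply_apply hdB b c).fderiv
      simp only [formInChart_apply] at h1
      rw [h1]
      rfl
    have hs : ∀ a b : Euc d, ∀ y, σ.inChart e y ![a, b] = - σ.inChart e y ![b, a] := by
      intro a b y
      have := (σ.inChart e y).toAlternatingMap.map_swap ![b, a] (i := 0) (j := 1) (by simp)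
      rw [show ![b, a] ∘ (Equiv.swap (0 : Fin 2) 1) = ![a, b] by
        ext i; fin_cases i <;> rfl] at this
      exact this
    have hsw : fderiv ℝ (formInChart σ e) x v u w = - fderiv ℝ (formInChart σ e) x v w u := by
      rw [← key, ← key, show (fun z => σ.inChart e z ![u, w]) = -fun z => σ.inChart e z ![w, u] from
        funext fun z => hs u w z, fderiv_neg]
      rfl
    rw [extDeriv_apply hd, Fin.sum_univ_three] at h0
    have r0 : (0 : Fin 3).removeNth ![u, v, w] = ![v, w] := by
      ext i; fin_cases i <;> rfl
    have r1 : (1 : Fin 3).removeNth ![u, v, w] = ![u, w] := by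
      ext i; fin_cases i <;> rfl
    have r2 : (2 : Fin 3).removeNth ![u, v, w] = ![u, v] := by
      ext i; fin_cases i <;> rfl
    simp only [r0, r1, r2, key] at h0
    simp at h0
    linarith

theorem formInChart_nondegenerate (hσ : IsSymplecticForm σ)
    (he : e ∈ IsManifold.maximalAtlas (𝓡 d) ∞ Ω) {z : Euc d} (hz : z ∈ e.target) (v : Euc d)
    (hv : ∀ w, formInChart σ e z v w = 0) : v = 0 := by
  have hM := (mdifferentiable_of_mem_maximalAtlas he).symm
  have h1 := hσ.nondegenerate (e.symm z) (mfderiv (𝓡 d) (𝓡 d) e.symm z v) fun w => by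
    obtain ⟨w', rfl⟩ := hM.mfderiv_surjective hz w
    exact (formInChart_apply_eq z v w').symm.trans (hv w')
  exact hM.mfderiv_injective hz (h1.trans (map_zero _).symm)

theorem dAt_mfderiv_symm (he : e ∈ IsManifold.maximalAtlas (𝓡 d) ∞ Ω) {z : Euc d}
    (hz : z ∈ e.target) (hH : MDifferentiableAt (𝓡 d) 𝓘(ℝ, ℝ) H (e.symm z)) (b : Euc d) :
    dAt H (e.symm z) (mfderiv (𝓡 d) (𝓡 d) e.symm z b) = fderiv ℝ (fun y => H (e.symm y)) z b := by
  have := mfderiv_comp z hH ((mdifferentiable_of_mem_maximalAtlas he).mdifferentiableAt_symm hz)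
  rw [← mfderiv_eq_fderiv]
  exact (congrArg (fun L => L b) this).symm

/-- Hamilton's equation in a chart. -/
theorem mfderiv_symm_eq_hamiltonianVectorField_iff (hσ : IsSymplecticForm σ)
    (he : e ∈ IsManifold.maximalAtlas (𝓡 d) ∞ Ω) {z : Euc d} (hz : z ∈ e.target)
    (hH : MDifferentiableAt (𝓡 d) 𝓘(ℝ, ℝ) H (e.symm z)) (a : Euc d) :
    mfderiv (𝓡 d) (𝓡 d) e.symm z a = hamiltonianVectorField σ H (e.symm z) ↔
      ∀ b, formInChart σ e z a b = fderiv ℝ (fun y => H (e.symm y)) z b := by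
  have hM := (mdifferentiable_of_mem_maximalAtlas he).symm
  refine (hamiltonianVectorField_eq_iff hσ H _ _).trans ⟨fun h b => ?_, fun h w => ?_⟩
  · rw [formInChart_apply_eq, ← dAt_mfderiv_symm he hz hH]
    exact h _
  · obtain ⟨w', rfl⟩ := hM.mfderiv_surjective hz w
    exact (formInChart_apply_eq z a w').symm.trans
      ((h w').trans (dAt_mfderiv_symm he hz hH w').symm)

theorem hasMFDerivWithinAt_symm_comp (he : e ∈ IsManifold.maximalAtlas (𝓡 d) ∞ Ω) {ξ : ℝ → Euc d}
    {a : Euc d} {s : Set ℝ} {t : ℝ} (hξ : HasDerivWithinAt ξ a s t) (ht : ξ t ∈ e.target) :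
    HasMFDerivWithinAt 𝓘(ℝ, ℝ) (𝓡 d) (fun t => e.symm (ξ t)) s t
      ((1 : ℝ →L[ℝ] ℝ).smulRight (mfderiv (𝓡 d) (𝓡 d) e.symm (ξ t) a)) := by
  have h1 : HasMFDerivWithinAt 𝓘(ℝ, ℝ) (𝓡 d) ξ s t _ := hξ.hasFDerivWithinAt.hasMFDerivWithinAt
  have h2 := ((mdifferentiable_of_mem_maximalAtlas he).mdifferentiableAt_symm ht).hasMFDerivAt
  refine (h2.comp_hasMFDerivWithinAt t h1).congr_mfderiv ?_
  refine ContinuousLinearMap.ext fun (r : ℝ) => ?_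
  change mfderiv (𝓡 d) (𝓡 d) e.symm (ξ t) (r • a) = r • mfderiv (𝓡 d) (𝓡 d) e.symm (ξ t) a
  exact map_smul _ r a

theorem hasDerivWithinAt_comp_of_mfderiv_symm_eq (he : e ∈ IsManifold.maximalAtlas (𝓡 d) ∞ Ω)
    {γ : ℝ → Ω} {s : Set ℝ} {t : ℝ} {X : TangentSpace (𝓡 d) (γ t)}
    (hγ : HasMFDerivWithinAt 𝓘(ℝ, ℝ) (𝓡 d) γ s t ((1 : ℝ →L[ℝ] ℝ).smulRight X))
    (ht : γ t ∈ e.source) {z a : Euc d} (hz : z = e (γ t))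
    (ha : (show Euc d from mfderiv (𝓡 d) (𝓡 d) e.symm z a) = X) :
    HasDerivWithinAt (fun t => e (γ t)) a s t := by
  subst hz
  have hM := mdifferentiable_of_mem_maximalAtlas he
  have h1 := (hM.mdifferentiableAt ht).hasMFDerivAt.comp_hasMFDerivWithinAt t hγ
  have h2 : HasFDerivWithinAt (fun t => e (γ t)) _ s t := h1.hasFDerivWithinAt
  rw [hasDerivWithinAt_iff_hasFDerivWithinAt]
  refine h2.congr_fderiv ?_
  refine ContinuousLinearMap.ext fun (r : ℝ) => ?_
  have h3 := hM.comp_symm_deriv (e.map_source ht)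
  have h4 := congrArg (fun L => L a) h3
  rw [e.left_inv ht] at h4
  have h5 : (mfderiv (𝓡 d) (𝓡 d) e (γ t)) X = a := by
    rw [← ha]
    exact h4
  change mfderiv (𝓡 d) (𝓡 d) e (γ t) (r • X) = r • a
  exact (map_smul _ r X).trans (congrArg (r • ·) h5)

theorem trans_mem_maximalAtlas [IsManifold (𝓡 d) ∞ Ω]
    (he : e ∈ IsManifold.maximalAtlas (𝓡 d) ∞ Ω) (φ : OpenPartialHomeomorph (Euc d) (Euc d))
    (hφ : ContDiffOn ℝ ∞ φ φ.source) (hφ' : ContDiffOn ℝ ∞ φ.symm φ.target) :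
    e.trans φ ∈ IsManifold.maximalAtlas (𝓡 d) ∞ Ω := by
  refine OpenPartialHomeomorph.mem_maximalAtlas_of_contMDiffOn _ ?_ ?_
  · exact hφ.contMDiffOn.comp ((contMDiffOn_of_mem_maximalAtlas he).mono (by simp))
      (by intro x hx; simpa using hx.2)
  · refine (contMDiffOn_symm_of_mem_maximalAtlas he).comp (hφ'.contMDiffOn.mono ?_) ?_
    · intro x hx; simpa using hx.1
    · intro x hx; simpa using hx.2

/-- Charts obtained by postcomposing a chart with a local diffeomorphism. -/
theorem exists_chart_of_coord [IsManifold (𝓡 d) ∞ Ω]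
    (he : e ∈ IsManifold.maximalAtlas (𝓡 d) ∞ Ω) {x : Ω} (hx : x ∈ e.source) {Φ : Euc d → Euc d}
    {s : Set (Euc d)} (hs : IsOpen s) (hxs : e x ∈ s) (hΦ : ContDiffOn ℝ ∞ Φ s)
    {Φ' : Euc d ≃L[ℝ] Euc d} (hΦ' : HasFDerivAt Φ (Φ' : Euc d →L[ℝ] Euc d) (e x)) :
    ∃ c ∈ IsManifold.maximalAtlas (𝓡 d) ∞ Ω, x ∈ c.source ∧ c.source ⊆ e.source ∧
      (∀ y ∈ c.source, e y ∈ s) ∧ ∀ y, c y = Φ (e y) := by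
  obtain ⟨φ, hφx, hφs, hφ, hφ'⟩ := exists_openPartialHomeomorph_contDiffOn_symm hs hΦ hxs hΦ'
  refine ⟨e.trans φ, trans_mem_maximalAtlas he φ ((hΦ.mono hφs).congr fun y _ => hφ y) hφ', ?_, ?_,
    ?_, fun y => by simp [hφ]⟩
  · simp [hx, hφx]
  · simp
  · intro y hy
    simp at hy
    exact hφs hy.2

/-- Charts whose inverse is obtained by precomposing the inverse of a chart with a local
diffeomorphism. -/
theorem exists_chart_of_param [IsManifold (𝓡 d) ∞ Ω]
    (he : e ∈ IsManifold.maximalAtlas (𝓡 d) ∞ Ω) {f : Euc d → Euc d} {s : Set (Euc d)}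
    (hs : IsOpen s) {w₀ : Euc d} (h0 : w₀ ∈ s) (hf : ContDiffOn ℝ ∞ f s) (hfs : MapsTo f s e.target)
    {f' : Euc d ≃L[ℝ] Euc d} (hf' : HasFDerivAt f (f' : Euc d →L[ℝ] Euc d) w₀) :
    ∃ c ∈ IsManifold.maximalAtlas (𝓡 d) ∞ Ω, w₀ ∈ c.target ∧ c.target ⊆ s ∧
      c.source ⊆ e.source ∧ ∀ w, c.symm w = e.symm (f w) := by
  obtain ⟨φ, hφx, hφs, hφ, hφ'⟩ := exists_openPartialHomeomorph_contDiffOn_symm hs hf h0 hf'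
  refine ⟨e.trans φ.symm, trans_mem_maximalAtlas he φ.symm hφ'
    ((hf.mono hφs).congr fun y _ => by simp [hφ]), ?_, ?_, ?_, fun w => by simp [hφ]⟩
  · simpa [hφx, hφ] using hfs h0
  · intro w hw
    simp at hw
    exact hφs hw.1
  · simp

theorem formInChart_of_symm_eq (he : e ∈ IsManifold.maximalAtlas (𝓡 d) ∞ Ω) {f : Euc d → Euc d}
    {w : Euc d} (hc : ∀ᶠ y in 𝓝 w, c.symm y = e.symm (f y)) (hf : DifferentiableAt ℝ f w)
    (hfw : f w ∈ e.target) : formInChart σ c w = pullbackForm (formInChart σ e) f w := by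
  have h1 : ∀ a, (show Euc d from mfderiv (𝓡 d) (𝓡 d) c.symm w a) =
      mfderiv (𝓡 d) (𝓡 d) e.symm (f w) (fderiv ℝ f w a) := by
    intro a
    have h2 : (show Euc d →L[ℝ] Euc d from mfderiv (𝓡 d) (𝓡 d) c.symm w) =
      mfderiv (𝓡 d) (𝓡 d) (fun y => e.symm (f y)) w := Filter.EventuallyEq.mfderiv_eq hc
    have h3 := mfderiv_comp w
      ((mdifferentiable_of_mem_maximalAtlas he).mdifferentiableAt_symm hfw) hf.mdifferentiableAt
    rw [mfderiv_eq_fderiv] at h3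
    exact congrArg (fun L : Euc d →L[ℝ] Euc d => L a) (h2.trans h3)
  ext a b
  rw [pullbackForm_apply, formInChart_apply_eq, formInChart_apply_eq]
  have h4 : ∀ (x y : Ω) (_ : x = y) (p q : Euc d),
      σ x ![(show TangentSpace (𝓡 d) x from p), (show TangentSpace (𝓡 d) x from q)] =
        σ y ![(show TangentSpace (𝓡 d) y from p), (show TangentSpace (𝓡 d) y from q)] := by
    rintro x y rfl p q
    rfl
  refine (h4 _ _ hc.self_of_nhds _ _).trans ?_
  rw [← h1 a, ← h1 b]

end ChartCalculus

/-! ### Uniqueness of trajectories -/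

section Trajectories

variable {d : ℕ} {Ω : Type*} [TopologicalSpace Ω] [ChartedSpace (Euc d) Ω]
  {σ : TwoForm d Ω} {H : Ω → ℝ} {e c : OpenPartialHomeomorph Ω (Euc d)}

theorem contDiffOn_comp_chart_symm (he : e ∈ IsManifold.maximalAtlas (𝓡 d) ∞ Ω)
    (hH : ContMDiff (𝓡 d) 𝓘(ℝ, ℝ) ∞ H) : ContDiffOn ℝ ∞ (fun z => H (e.symm z)) e.target :=
  contMDiffOn_iff_contDiffOn.1 (hH.comp_contMDiffOn (contMDiffOn_symm_of_mem_maximalAtlas he))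

/-- A Hamiltonian vector field is smooth in charts. -/
theorem exists_hamiltonianVectorField_inChart (hσ : IsSymplecticForm σ)
    (hH : ContMDiff (𝓡 d) 𝓘(ℝ, ℝ) ∞ H) (he : e ∈ IsManifold.maximalAtlas (𝓡 d) ∞ Ω) {x : Ω}
    (hx : x ∈ e.source) :
    ∃ (X : Euc d → Euc d) (u : Set (Euc d)), IsOpen u ∧ e x ∈ u ∧ u ⊆ e.target ∧
      ContDiffOn ℝ ∞ X u ∧
      ∀ z ∈ u, mfderiv (𝓡 d) (𝓡 d) e.symm z (X z) = hamiltonianVectorField σ H (e.symm z) := by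
  have hHe := contDiffOn_comp_chart_symm he hH
  obtain ⟨X, u, hu, hxu, hue, hX, h⟩ := exists_dual_field e.open_target (e.map_source hx)
    (hσ.isClosedTwoFormOn_formInChart he).contDiffOn
    (formInChart_nondegenerate hσ he (e.map_source hx))
    (hHe.fderiv_of_isOpen e.open_target (m := ∞) (by simp))
  refine ⟨X, u, hu, hxu, hue, hX, fun z hz => ?_⟩
  rw [mfderiv_symm_eq_hamiltonianVectorField_iff hσ he (hue hz) (hH.mdifferentiable (by simp) _)]
  intro b
  rw [h z hz]

variable [IsManifold (𝓡 d) ∞ Ω]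

theorem IsMIntegralCurveOn.eventuallyEq_of_eq (hσ : IsSymplecticForm σ)
    (hH : ContMDiff (𝓡 d) 𝓘(ℝ, ℝ) ∞ H) {γ γ' : ℝ → Ω} {a b t₀ : ℝ}
    (hγ : IsMIntegralCurveOn (I := 𝓡 d) γ (hamiltonianVectorField σ H) (Icc a b))
    (hγ' : IsMIntegralCurveOn (I := 𝓡 d) γ' (hamiltonianVectorField σ H) (Icc a b))
    (ht₀ : t₀ ∈ Icc a b) (h : γ t₀ = γ' t₀) : ∀ᶠ t in 𝓝[Icc a b] t₀, γ t = γ' t := by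
  have he : chartAt (Euc d) (γ t₀) ∈ IsManifold.maximalAtlas (𝓡 d) ∞ Ω :=
    IsManifold.chart_mem_maximalAtlas _
  set e := chartAt (Euc d) (γ t₀)
  have hx : γ t₀ ∈ e.source := mem_chart_source _ _
  obtain ⟨X, u, hu, hxu, hue, hX, hXe⟩ := exists_hamiltonianVectorField_inChart hσ hH he hx
  obtain ⟨K, v, hv, hK⟩ := ((hX.contDiffAt (hu.mem_nhds hxu)).of_le
    (by simp : (1 : WithTop ℕ∞) ≤ ∞)).exists_lipschitzOnWith
  have hN : e.source ∩ e ⁻¹' (u ∩ v) ∈ 𝓝 (γ t₀) :=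
    Filter.inter_mem (e.open_source.mem_nhds hx)
      ((e.continuousAt hx).preimage_mem_nhds (Filter.inter_mem (hu.mem_nhds hxu) hv))
  have hN' : e.source ∩ e ⁻¹' (u ∩ v) ∈ 𝓝 (γ' t₀) := by rwa [← h]
  have h1 := (hγ.continuousWithinAt ht₀).eventually hN
  have h2 := (hγ'.continuousWithinAt ht₀).eventually hN'
  obtain ⟨ε, hε, hball⟩ := Metric.mem_nhdsWithin_iff.1 (h1.and h2)
  have hde : ∀ γ : ℝ → Ω, IsMIntegralCurveOn (I := 𝓡 d) γ (hamiltonianVectorField σ H) (Icc a b) →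
      ∀ t ∈ Icc a b, γ t ∈ e.source ∩ e ⁻¹' (u ∩ v) →
      HasDerivWithinAt (fun t => e (γ t)) (X (e (γ t))) (Icc a b) t := by
    intro γ hγ t ht hmem
    refine hasDerivWithinAt_comp_of_mfderiv_symm_eq he (hγ t ht) hmem.1 rfl ?_
    have h3 := hXe _ hmem.2.1
    have h4 : ∀ y, y = γ t → (show Euc d from hamiltonianVectorField σ H y) =
      hamiltonianVectorField σ H (γ t) := by rintro y rfl; rfl
    exact h3.trans (h4 _ (e.left_inv hmem.1))
  refine Metric.mem_nhdsWithin_iff.2 ⟨ε, hε, fun t ht => ?_⟩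
  have hsub : ∀ t' ∈ uIcc t₀ t, t' ∈ Icc a b ∧ γ t' ∈ e.source ∩ e ⁻¹' (u ∩ v) ∧
      γ' t' ∈ e.source ∩ e ⁻¹' (u ∩ v) := by
    intro t' ht'
    have h3 : t' ∈ Icc a b := (uIcc_subset_Icc ht₀ ht.2) ht'
    refine ⟨h3, hball ⟨?_, h3⟩⟩
    have h4 := Metric.mem_ball.1 ht.1
    rw [Metric.mem_ball, Real.dist_eq]
    rw [Real.dist_eq] at h4
    exact (abs_sub_left_of_mem_uIcc ht').trans_lt h4
  have hcont : ∀ γ : ℝ → Ω,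
      IsMIntegralCurveOn (I := 𝓡 d) γ (hamiltonianVectorField σ H) (Icc a b) →
      (∀ t' ∈ uIcc t₀ t, t' ∈ Icc a b ∧ γ t' ∈ e.source ∩ e ⁻¹' (u ∩ v)) →
      ContinuousOn (fun t => e (γ t)) (uIcc t₀ t) := fun γ hγ hs t' ht' =>
    ((hde γ hγ t' (hs t' ht').1 (hs t' ht').2).continuousWithinAt).mono
      fun t'' ht'' => (hs t'' ht'').1
  have hc := hcont γ hγ fun t' ht' => ⟨(hsub t' ht').1, (hsub t' ht').2.1⟩
  have hc' := hcont γ' hγ' fun t' ht' => ⟨(hsub t' ht').1, (hsub t' ht').2.2⟩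
  have heq : e (γ t) = e (γ' t) := by
    rcases le_total t₀ t with hle | hle
    · rw [uIcc_of_le hle] at hsub hc hc'
      have hm : ∀ t' ∈ Ico t₀ t, t' ∈ Ico a b := fun t' ht' =>
        ⟨ht₀.1.trans ht'.1, ht'.2.trans_le ht.2.2⟩
      exact ODE_solution_unique_of_mem_Icc_right (v := fun _ => X) (s := fun _ => v) (K := K)
        (fun t' _ => hK) hc
        (fun t' ht' => (hde γ hγ t' (hsub t' (Ico_subset_Icc_self ht')).1
          (hsub t' (Ico_subset_Icc_self ht')).2.1).mono_of_mem_nhdsWithin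
            (Icc_mem_nhdsGE_of_mem (hm t' ht')))
        (fun t' ht' => (hsub t' (Ico_subset_Icc_self ht')).2.1.2.2) hc'
        (fun t' ht' => (hde γ' hγ' t' (hsub t' (Ico_subset_Icc_self ht')).1
          (hsub t' (Ico_subset_Icc_self ht')).2.2).mono_of_mem_nhdsWithin
            (Icc_mem_nhdsGE_of_mem (hm t' ht')))
        (fun t' ht' => (hsub t' (Ico_subset_Icc_self ht')).2.2.2.2)
        (by simp only [h]) ⟨hle, le_rfl⟩
    · rw [uIcc_of_ge hle] at hsub hc hc'
      have hm : ∀ t' ∈ Ioc t t₀, t' ∈ Ioc a b := fun t' ht' =>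
        ⟨ht.2.1.trans_lt ht'.1, ht'.2.trans ht₀.2⟩
      exact ODE_solution_unique_of_mem_Icc_left (v := fun _ => X) (s := fun _ => v) (K := K)
        (fun t' _ => hK) hc
        (fun t' ht' => (hde γ hγ t' (hsub t' (Ioc_subset_Icc_self ht')).1
          (hsub t' (Ioc_subset_Icc_self ht')).2.1).mono_of_mem_nhdsWithin
            (Icc_mem_nhdsLE_of_mem (hm t' ht')))
        (fun t' ht' => (hsub t' (Ioc_subset_Icc_self ht')).2.1.2.2) hc'
        (fun t' ht' => (hde γ' hγ' t' (hsub t' (Ioc_subset_Icc_self ht')).1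
          (hsub t' (Ioc_subset_Icc_self ht')).2.2).mono_of_mem_nhdsWithin
            (Icc_mem_nhdsLE_of_mem (hm t' ht')))
        (fun t' ht' => (hsub t' (Ioc_subset_Icc_self ht')).2.2.2.2)
        (by simp only [h]) ⟨le_rfl, hle⟩
  exact e.injOn (hsub t right_mem_uIcc).2.1.1 (hsub t right_mem_uIcc).2.2.1 heq

/-- Trajectories of a Hamiltonian vector field are determined by one of their points. -/
theorem IsMIntegralCurveOn.eqOn_of_eq [T2Space Ω] (hσ : IsSymplecticForm σ)
    (hH : ContMDiff (𝓡 d) 𝓘(ℝ, ℝ) ∞ H) {γ γ' : ℝ → Ω} {a b t₀ : ℝ}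
    (hγ : IsMIntegralCurveOn (I := 𝓡 d) γ (hamiltonianVectorField σ H) (Icc a b))
    (hγ' : IsMIntegralCurveOn (I := 𝓡 d) γ' (hamiltonianVectorField σ H) (Icc a b))
    (ht₀ : t₀ ∈ Icc a b) (h : γ t₀ = γ' t₀) : EqOn γ γ' (Icc a b) := by
  intro t ht
  refine (isPreconnected_Icc.induction₂ (fun x y => γ x = γ' x ↔ γ y = γ' y) (fun x hx => ?_)
    (fun x y z _ _ _ h1 h2 => h1.trans h2) (fun x y _ _ h1 => h1.symm) ht₀ ht).1 h
  by_cases hxx : γ x = γ' x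
  · filter_upwards [IsMIntegralCurveOn.eventuallyEq_of_eq hσ hH hγ hγ' hx hxx] with y hy
    simp [hxx, hy]
  · have := ((hγ.continuousWithinAt hx).prodMk (hγ'.continuousWithinAt hx)).eventually
      (isClosed_diagonal.isOpen_compl.mem_nhds hxx)
    filter_upwards [this] with y hy
    simp only [hxx, false_iff]
    exact hy

theorem hamiltonianVectorField_ne_zero_of_trajectory [T2Space Ω] (hσ : IsSymplecticForm σ)
    (hH : ContMDiff (𝓡 d) 𝓘(ℝ, ℝ) ∞ H) {γ : ℝ → Ω} {a b t₀ t : ℝ}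
    (hγ : IsMIntegralCurveOn (I := 𝓡 d) γ (hamiltonianVectorField σ H) (Icc a b))
    (ht₀ : t₀ ∈ Icc a b) (ht : t ∈ Icc a b) (h : hamiltonianVectorField σ H (γ t₀) ≠ 0) :
    hamiltonianVectorField σ H (γ t) ≠ 0 := by
  intro h0
  have hconst : IsMIntegralCurveOn (I := 𝓡 d) (fun _ => γ t) (hamiltonianVectorField σ H)
      (Icc a b) := by
    intro s _
    simp only [h0]
    refine (hasMFDerivWithinAt_const _ _ _).congr_mfderiv ?_
    refine ContinuousLinearMap.ext fun (r : ℝ) => ?_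
    exact (smul_zero r).symm
  have := IsMIntegralCurveOn.eqOn_of_eq hσ hH hγ hconst ht rfl ht₀
  simp only at this
  rw [this] at h
  exact h h0

end Trajectories

/-! ### Flow charts -/

section FlowCharts

variable {m : ℕ} {Ω : Type*} [TopologicalSpace Ω] [ChartedSpace (Euc (m + 2)) Ω]
  {σ : TwoForm (m + 2) Ω} {H : Ω → ℝ} {h : ℝ} {ωZ : Euc m →L[ℝ] Euc m →L[ℝ] ℝ}
  {c k : OpenPartialHomeomorph Ω (Euc (m + 2))}

/-- A chart in which the symplectic form is the constant form `ωZ ⊕ (dt ∧ de)` and in which the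
function `H` is `h + e`, so that the Hamiltonian vector field is `∂/∂t`. -/
structure IsFlowChart (σ : TwoForm (m + 2) Ω) (H : Ω → ℝ) (h : ℝ)
    (ωZ : Euc m →L[ℝ] Euc m →L[ℝ] ℝ) (c : OpenPartialHomeomorph Ω (Euc (m + 2))) : Prop where
  mem : c ∈ IsManifold.maximalAtlas (𝓡 (m + 2)) ∞ Ω
  form : ∀ w ∈ c.target, ∀ a b, formInChart σ c w a b = stdForm ωZ a b
  energy : ∀ w ∈ c.target, H (c.symm w) = h + ec w

theorem IsFlowChart.ec_eq (hc : IsFlowChart σ H h ωZ c) {x : Ω} (hx : x ∈ c.source) :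
    H x = h + ec (c x) := by
  rw [← hc.energy _ (c.map_source hx), c.left_inv hx]

theorem IsFlowChart.fderiv_energy (hc : IsFlowChart σ H h ωZ c) {w : Euc (m + 2)}
    (hw : w ∈ c.target) : HasFDerivAt (fun y => H (c.symm y)) ec w :=
  ((ec : Euc (m + 2) →L[ℝ] ℝ).hasFDerivAt.const_add h).congr_of_eventuallyEq
    (Filter.mem_of_superset (c.open_target.mem_nhds hw) hc.energy)

theorem IsFlowChart.mfderiv_tVec (hσ : IsSymplecticForm σ)
    (hH : ContMDiff (𝓡 (m + 2)) 𝓘(ℝ, ℝ) ∞ H) (hc : IsFlowChart σ H h ωZ c) {w : Euc (m + 2)}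
    (hw : w ∈ c.target) :
    mfderiv (𝓡 (m + 2)) (𝓡 (m + 2)) c.symm w tVec = hamiltonianVectorField σ H (c.symm w) := by
  refine (mfderiv_symm_eq_hamiltonianVectorField_iff hσ hc.mem hw
    (hH.mdifferentiable (by simp) _) _).2 fun b => ?_
  rw [hc.form w hw, stdForm_tVec, (hc.fderiv_energy hw).fderiv]

theorem IsFlowChart.isMIntegralCurveOn (hσ : IsSymplecticForm σ)
    (hH : ContMDiff (𝓡 (m + 2)) 𝓘(ℝ, ℝ) ∞ H) (hc : IsFlowChart σ H h ωZ c) {w : Euc (m + 2)}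
    {s : Set ℝ} (hs : ∀ t ∈ s, w + t • tVec ∈ c.target) :
    IsMIntegralCurveOn (I := 𝓡 (m + 2)) (fun t => c.symm (w + t • tVec))
      (hamiltonianVectorField σ H) s := by
  intro t ht
  have h1 : HasDerivWithinAt (fun t : ℝ => w + t • (tVec : Euc (m + 2))) tVec s t := by
    simpa using (((hasDerivAt_id t).smul_const (tVec : Euc (m + 2))).const_add w).hasDerivWithinAt
  have h2 := hasMFDerivWithinAt_symm_comp hc.mem h1 (hs t ht)
  rw [hc.mfderiv_tVec hσ hH (hs t ht)] at h2
  exact h2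

variable [IsManifold (𝓡 (m + 2)) ∞ Ω]

/-- Flow charts exist at every point which is not an equilibrium. -/
theorem exists_isFlowChart (hσ : IsSymplecticForm σ) (hH : ContMDiff (𝓡 (m + 2)) 𝓘(ℝ, ℝ) ∞ H)
    {x : Ω} (hx : hamiltonianVectorField σ H x ≠ 0) :
    ∃ (ωZ : Euc m →L[ℝ] Euc m →L[ℝ] ℝ) (c : OpenPartialHomeomorph Ω (Euc (m + 2))),
      (∀ v w, ωZ v w = - ωZ w v) ∧ IsFlowChart σ H (H x) ωZ c ∧ x ∈ c.source ∧ c x = 0 := by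
  have he : chartAt (Euc (m + 2)) x ∈ IsManifold.maximalAtlas (𝓡 (m + 2)) ∞ Ω :=
    IsManifold.chart_mem_maximalAtlas _
  set e := chartAt (Euc (m + 2)) x
  have hxe : x ∈ e.source := mem_chart_source _ _
  let τ : Euc (m + 2) → Euc (m + 2) := fun y => e x + y
  have hτ : ContDiff ℝ ∞ τ := contDiff_const.add contDiff_id
  have hτd : ∀ y, HasFDerivAt τ (ContinuousLinearMap.id ℝ _) y := fun y =>
    (hasFDerivAt_id y).const_add (e x)
  set s : Set (Euc (m + 2)) := τ ⁻¹' e.target with hs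
  have hso : IsOpen s := e.open_target.preimage hτ.continuous
  have h0s : (0 : Euc (m + 2)) ∈ s := by simpa [s, τ] using e.map_source hxe
  have hB := (hσ.isClosedTwoFormOn_formInChart he).pullback e.open_target hso hτ.contDiffOn
    (mapsTo_preimage _ _)
  have hBnd : ∀ v, (∀ w, pullbackForm (formInChart σ e) τ 0 v w = 0) → v = 0 := by
    intro v hv
    refine formInChart_nondegenerate hσ he h0s v fun w => ?_
    have := hv w
    rwa [pullbackForm_apply, (hτd 0).fderiv] at this
  have hHs : ContDiffOn ℝ ∞ (fun y => H (e.symm (τ y))) s :=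
    (contDiffOn_comp_chart_symm he hH).comp hτ.contDiffOn (mapsTo_preimage _ _)
  have hdH : fderiv ℝ (fun y => H (e.symm (τ y))) 0 ≠ 0 := by
    intro h0
    have h1 : HasFDerivAt (fun y => H (e.symm (τ y))) _ 0 :=
      (((contDiffOn_comp_chart_symm he hH).contDiffAt
        (e.open_target.mem_nhds h0s)).differentiableAt (by simp)).hasFDerivAt.comp 0 (hτd 0)
    rw [h1.fderiv, ContinuousLinearMap.comp_id] at h0
    have h2 := (mfderiv_symm_eq_hamiltonianVectorField_iff hσ he h0s
      (hH.mdifferentiable (by simp) _) 0).2 fun b => by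
        rw [h0, map_zero]
    have h3 : e.symm (τ 0) = x := by simp [τ, e.left_inv hxe]
    rw [h3] at h2
    exact hx (h2.symm.trans (map_zero _))
  obtain ⟨Ψ, u, v₀, hu, h0u, hΨ, hΨ0, hΨ', hv₀, hΨu⟩ := exists_darboux hso h0s hB hBnd hHs hdH
  obtain ⟨Λ, ωZ, hωZ, hΛ, hΛt⟩ := exists_linear_normal_form (m := m) (by simp)
    (pullbackForm (formInChart σ e) τ 0) (hB.antisymm 0 h0s) hBnd hv₀
  let f : Euc (m + 2) → Euc (m + 2) := fun w => τ (Ψ (Λ w))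
  have hf : ContDiffOn ℝ ∞ f (Λ ⁻¹' u) :=
    hτ.comp_contDiffOn (hΨ.comp Λ.contDiff.contDiffOn (mapsTo_preimage _ _))
  have hf' : HasFDerivAt f (Λ : Euc (m + 2) →L[ℝ] Euc (m + 2)) 0 := by
    have h1 : HasFDerivAt Ψ (ContinuousLinearMap.id ℝ _) (Λ 0) := by rwa [map_zero]
    exact (hτd _).comp (0 : Euc (m + 2)) (h1.comp (0 : Euc (m + 2)) Λ.hasFDerivAt)
  obtain ⟨c, hc, h0c, hcu, -, hcf⟩ := exists_chart_of_param he (hu.preimage Λ.continuous)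
    (by simpa using h0u) hf (fun w hw => (hΨu _ hw).1) hf'
  have hc0 : c.symm 0 = x := by simp [hcf, f, hΨ0, τ, e.left_inv hxe]
  have hH0 : H (e.symm (τ 0)) = H x := by simp [τ, e.left_inv hxe]
  refine ⟨ωZ, c, hωZ, ⟨hc, fun w hw a b => ?_, fun w hw => ?_⟩, ?_, ?_⟩
  · have hΨw : HasFDerivAt Ψ (fderiv ℝ Ψ (Λ w)) (Λ w) :=
      ((hΨ.contDiffAt (hu.mem_nhds (hcu hw))).differentiableAt (by simp)).hasFDerivAt
    have hfw : HasFDerivAt f _ w := (hτd _).comp w (hΨw.comp w Λ.hasFDerivAt)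
    rw [formInChart_of_symm_eq he (Filter.Eventually.of_forall hcf) hfw.differentiableAt
      (hΨu _ (hcu hw)).1, pullbackForm_apply, hfw.fderiv, ← hΛ]
    have h2 := (hΨu _ (hcu hw)).2.1 (Λ a) (Λ b)
    rw [← h2, pullbackForm_apply, (hτd _).fderiv]
    rfl
  · rw [hcf, (hΨu _ (hcu hw)).2.2, hH0, ← hΛt, hΛ, stdForm_tVec]
  · rw [← hc0]
    exact c.map_target h0c
  · rw [← hc0]
    exact c.right_inv h0c

/-- Moving a flow chart along the flow, inside another flow chart `k`, by the time `t`. -/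
theorem IsFlowChart.translate {ω' : Euc m →L[ℝ] Euc m →L[ℝ] ℝ} (hc : IsFlowChart σ H h ωZ c)
    (hk : IsFlowChart σ H h ω' k) (t : ℝ) : ∃ c', IsFlowChart σ H h ωZ c' ∧
      (∀ w, w ∈ c'.target ↔
        w ∈ c.target ∧ c.symm w ∈ k.source ∧ k (c.symm w) + t • tVec ∈ k.target) ∧
      ∀ w, c'.symm w = k.symm (k (c.symm w) + t • tVec) := by
  let τ : OpenPartialHomeomorph (Euc (m + 2)) (Euc (m + 2)) :=
    (Homeomorph.addRight (-(t • (tVec : Euc (m + 2))))).toOpenPartialHomeomorph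
  let ψ := τ.trans (k.symm.trans c)
  have hτ : ∀ z, (Homeomorph.addRight (-(t • (tVec : Euc (m + 2))))).symm z = z + t • tVec :=
    fun z => by simp [Homeomorph.addRight]
  have hgr : ∀ {a b : OpenPartialHomeomorph Ω (Euc (m + 2))},
      a ∈ IsManifold.maximalAtlas (𝓡 (m + 2)) ∞ Ω → b ∈ IsManifold.maximalAtlas (𝓡 (m + 2)) ∞ Ω →
      ContDiffOn ℝ ∞ (fun z => b (a.symm z)) (a.symm.trans b).source := by
    intro a b ha hb
    rw [← contMDiffOn_iff_contDiffOn]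
    exact (contMDiffOn_of_mem_maximalAtlas hb).comp
      ((contMDiffOn_symm_of_mem_maximalAtlas ha).mono (by simp))
      (by intro z hz; simpa using hz.2)
  have htr : ∀ v : Euc (m + 2), ContDiff ℝ ∞ fun z : Euc (m + 2) => z + v := fun v =>
    contDiff_id.add contDiff_const
  have hck := hgr hc.mem hk.mem
  refine ⟨k.trans ψ, ⟨trans_mem_maximalAtlas hk.mem ψ ?_ ?_, fun w hw a b => ?_, fun w hw => ?_⟩,
    fun w => ?_, fun w => ?_⟩
  · refine (hgr hk.mem hc.mem).comp (htr _).contDiffOn ?_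
    intro z hz
    simpa [ψ, τ, hτ] using hz
  · refine ((htr (t • tVec)).comp_contDiffOn (hck.mono (?_ : ψ.target ⊆ _))).congr ?_
    · intro z hz
      simpa [ψ, τ, hτ] using hz
    · intro z hz
      simp [ψ, τ, hτ]
  · have hw' : w ∈ c.target ∧ c.symm w ∈ k.source ∧ k (c.symm w) + t • tVec ∈ k.target := by
      simpa [ψ, τ, hτ, and_assoc] using hw
    have hwo : (c.symm.trans k).source ∈ 𝓝 w :=
      (c.symm.trans k).open_source.mem_nhds (by simpa using ⟨hw'.1, hw'.2.1⟩)
    have hd : DifferentiableAt ℝ (fun z => k (c.symm z)) w :=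
      (hck.contDiffAt hwo).differentiableAt (by simp)
    have hd' : HasFDerivAt (fun z => k (c.symm z) + t • tVec) (fderiv ℝ (fun z => k (c.symm z)) w)
      w := hd.hasFDerivAt.add_const _
    rw [formInChart_of_symm_eq hk.mem (f := fun z => k (c.symm z) + t • tVec)
      (Filter.Eventually.of_forall fun y => by simp [ψ, τ, hτ]) hd'.differentiableAt hw'.2.2,
      pullbackForm_apply, hk.form _ hw'.2.2, hd'.fderiv, ← hc.form w hw'.1,
      formInChart_of_symm_eq hk.mem (f := fun z => k (c.symm z))
      (by
        filter_upwards [hwo] with y hy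
        rw [OpenPartialHomeomorph.trans_source] at hy
        exact (k.left_inv hy.2).symm) hd (k.map_source hw'.2.1), pullbackForm_apply,
      hk.form _ (k.map_source hw'.2.1)]
  · have hw' : w ∈ c.target ∧ c.symm w ∈ k.source ∧ k (c.symm w) + t • tVec ∈ k.target := by
      simpa [ψ, τ, hτ, and_assoc] using hw
    have h1 : (k.trans ψ).symm w = k.symm (k (c.symm w) + t • tVec) := by simp [ψ, τ, hτ]
    rw [h1, hk.energy _ hw'.2.2, ← hc.energy _ hw'.1, hk.ec_eq hw'.2.1]
    simp
  · simp [ψ, τ, hτ, and_assoc]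
  · simp [ψ, τ, hτ]

end FlowCharts

/-! ### Transport of flow charts along trajectories -/

section Gluing

variable {d : ℕ} {Ω : Type*} [TopologicalSpace Ω] [ChartedSpace (Euc d) Ω]
  {v : ∀ x : Ω, TangentSpace (𝓡 d) x}

theorem hasMFDerivWithinAt_congr_curve {γ γ' : ℝ → Ω} {s : Set ℝ} {t : ℝ}
    (h : HasMFDerivWithinAt 𝓘(ℝ, ℝ) (𝓡 d) γ s t ((1 : ℝ →L[ℝ] ℝ).smulRight (v (γ t))))
    (heq : γ' =ᶠ[𝓝[s] t] γ) (ht : γ' t = γ t) :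
    HasMFDerivWithinAt 𝓘(ℝ, ℝ) (𝓡 d) γ' s t ((1 : ℝ →L[ℝ] ℝ).smulRight (v (γ' t))) := by
  have key : ∀ y, y = γ t → ((1 : ℝ →L[ℝ] ℝ).smulRight (show Euc d from v y)) =
      (1 : ℝ →L[ℝ] ℝ).smulRight (show Euc d from v (γ t)) := by
    rintro y rfl
    rfl
  exact (h.congr_of_eventuallyEq heq ht).congr_mfderiv (key _ ht).symm

/-- Two integral curves which agree on an interval can be glued. -/
theorem IsMIntegralCurveOn.exists_glue {η η' : ℝ → Ω} {a b' b c : ℝ} (hb : b' < b)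
    (hη : IsMIntegralCurveOn (I := 𝓡 d) η v (Icc a b))
    (hη' : IsMIntegralCurveOn (I := 𝓡 d) η' v (Icc b' c)) (h : EqOn η η' (Icc b' b)) :
    ∃ γ : ℝ → Ω, IsMIntegralCurveOn (I := 𝓡 d) γ v (Icc a c) ∧ EqOn γ η (Icc a b) ∧
      EqOn γ η' (Icc b' c) := by
  classical
  have h1 : ∀ t ≤ b, (fun t => if t ≤ b then η t else η' t) t = η t := fun t ht => if_pos ht
  have h2 : ∀ t, b' ≤ t → (fun t => if t ≤ b then η t else η' t) t = η' t := by
    intro t ht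
    by_cases hle : t ≤ b
    · rw [h1 t hle, h ⟨ht, hle⟩]
    · exact if_neg hle
  refine ⟨fun t => if t ≤ b then η t else η' t, fun t ht => ?_, fun t ht => h1 t ht.2,
    fun t ht => h2 t ht.1⟩
  rcases lt_or_ge t b with hlt | hge
  · have hm : Icc a b ∈ 𝓝[Icc a c] t := by
      filter_upwards [self_mem_nhdsWithin, mem_nhdsWithin_of_mem_nhds (Iio_mem_nhds hlt)]
        with s hs hs' using ⟨hs.1, le_of_lt hs'⟩
    refine hasMFDerivWithinAt_congr_curve ((hη t ⟨ht.1, hlt.le⟩).mono_of_mem_nhdsWithin hm) ?_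
      (h1 t hlt.le)
    filter_upwards [mem_nhdsWithin_of_mem_nhds (Iio_mem_nhds hlt)] with s hs using h1 s (le_of_lt hs)
  · have hlt : b' < t := hb.trans_le hge
    have hm : Icc b' c ∈ 𝓝[Icc a c] t := by
      filter_upwards [self_mem_nhdsWithin, mem_nhdsWithin_of_mem_nhds (Ioi_mem_nhds hlt)]
        with s hs hs' using ⟨le_of_lt hs', hs.2⟩
    refine hasMFDerivWithinAt_congr_curve ((hη' t ⟨hlt.le, ht.2⟩).mono_of_mem_nhdsWithin hm) ?_
      (h2 t hlt.le)
    filter_upwards [mem_nhdsWithin_of_mem_nhds (Ioi_mem_nhds hlt)] with s hs using h2 s (le_of_lt hs)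

theorem IsMIntegralCurveOn.shift {η : ℝ → Ω} {a b : ℝ}
    (hη : IsMIntegralCurveOn (I := 𝓡 d) η v (Icc a b)) (T : ℝ) :
    IsMIntegralCurveOn (I := 𝓡 d) (fun t => η (t - T)) v (Icc (a + T) (b + T)) := by
  have := hη.comp_add (-T)
  refine (this.mono (s' := Icc (a + T) (b + T)) ?_)
  intro t ht
  exact ⟨by linarith [ht.1], by linarith [ht.2]⟩

end Gluing

section Tubes

variable {m : ℕ} {Ω : Type*} [TopologicalSpace Ω] [ChartedSpace (Euc (m + 2)) Ω]
  {σ : TwoForm (m + 2) Ω} {H : Ω → ℝ} {h : ℝ} {ωZ : Euc m →L[ℝ] Euc m →L[ℝ] ℝ}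
  {c c' c'' k : OpenPartialHomeomorph Ω (Euc (m + 2))} {T T' δ δ' : ℝ} {w : Euc (m + 2)}

theorem norm_tVec : ‖(tVec : Euc (m + 2))‖ = 1 := by simp [tVec]

/-- The trajectory through the point `w` of the chart `c` reaches the point `w` of the chart `c'`
at time `T`; both charts are adapted to it for times in `[-δ, δ]` and `[T - δ, T + δ]`. -/
def IsFlowTube (σ : TwoForm (m + 2) Ω) (H : Ω → ℝ) (c c' : OpenPartialHomeomorph Ω (Euc (m + 2)))
    (T δ : ℝ) (w : Euc (m + 2)) : Prop :=
  (∀ t, |t| ≤ δ → w + t • tVec ∈ c.target ∧ w + t • tVec ∈ c'.target) ∧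
    ∃ η : ℝ → Ω, IsMIntegralCurveOn (I := 𝓡 (m + 2)) η (hamiltonianVectorField σ H)
      (Icc (-δ) (T + δ)) ∧
      ∀ t, |t| ≤ δ → η t = c.symm (w + t • tVec) ∧ η (T + t) = c'.symm (w + t • tVec)

theorem IsFlowTube.mono (htube : IsFlowTube σ H c c' T δ w) (hle : δ' ≤ δ) :
    IsFlowTube σ H c c' T δ' w := by
  obtain ⟨h1, η, hη, h2⟩ := htube
  exact ⟨fun t ht => h1 t (ht.trans hle), η,
    hη.mono (Icc_subset_Icc (by linarith) (by linarith)), fun t ht => h2 t (ht.trans hle)⟩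

theorem IsFlowTube.exists_trajectory (hδ : 0 < δ) (h1 : IsFlowTube σ H c c' T δ w)
    (h2 : IsFlowTube σ H c' c'' T' δ w) (hT : 0 ≤ T) (hT' : 0 ≤ T') :
    ∃ η : ℝ → Ω, IsMIntegralCurveOn (I := 𝓡 (m + 2)) η (hamiltonianVectorField σ H)
      (Icc (-δ) (T + T' + δ)) ∧
      ∀ t, |t| ≤ δ → η t = c.symm (w + t • tVec) ∧ η (T + t) = c'.symm (w + t • tVec) ∧
        η (T + T' + t) = c''.symm (w + t • tVec) := by
  obtain ⟨-, η, hη, hηe⟩ := h1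
  obtain ⟨-, η', hη', hηe'⟩ := h2
  have hs := IsMIntegralCurveOn.shift hη' T
  obtain ⟨γ, hγ, hγη, hγη'⟩ := IsMIntegralCurveOn.exists_glue (b' := -δ + T) (b := T + δ)
    (by linarith) hη hs (by
      intro t ht
      have h3 : |t - T| ≤ δ := abs_le.2 ⟨by linarith [ht.1], by linarith [ht.2]⟩
      have h4 := (hηe _ h3).2
      rw [add_sub_cancel] at h4
      rw [h4]
      exact ((hηe' _ h3).1).symm)
  refine ⟨γ, ?_, fun t ht => ?_⟩
  · rwa [show T + T' + δ = T' + δ + T by ring]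
  · have ht' := abs_le.1 ht
    refine ⟨?_, ?_, ?_⟩
    · rw [hγη ⟨ht'.1, by linarith⟩, (hηe t ht).1]
    · rw [hγη ⟨by linarith, by linarith⟩, (hηe t ht).2]
    · rw [hγη' ⟨by linarith, by linarith⟩, ← (hηe' t ht).2]
      change η' (T + T' + t - T) = _
      congr 1
      ring

theorem IsFlowTube.trans (hδ : 0 < δ) (h1 : IsFlowTube σ H c c' T δ w)
    (h2 : IsFlowTube σ H c' c'' T' δ w) (hT : 0 ≤ T) (hT' : 0 ≤ T') :
    IsFlowTube σ H c c'' (T + T') δ w := by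
  obtain ⟨η, hη, hηe⟩ := h1.exists_trajectory hδ h2 hT hT'
  exact ⟨fun t ht => ⟨(h1.1 t ht).1, (h2.1 t ht).2⟩, η, hη, fun t ht =>
    ⟨(hηe t ht).1, (hηe t ht).2.2⟩⟩

/-- The energy is constant along trajectories. -/
theorem energy_eq_of_trajectory (hσ : IsSymplecticForm σ)
    (hH : ContMDiff (𝓡 (m + 2)) 𝓘(ℝ, ℝ) ∞ H) {γ : ℝ → Ω} {L s : ℝ}
    (hγ : IsMIntegralCurveOn (I := 𝓡 (m + 2)) γ (hamiltonianVectorField σ H) (Icc 0 L))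
    (hs : s ∈ Icc 0 L) : H (γ s) = H (γ 0) := by
  have hd : ∀ t ∈ Icc 0 L, HasDerivWithinAt (fun t => H (γ t)) 0 (Icc 0 L) t := by
    intro t ht
    have h1 : HasMFDerivWithinAt 𝓘(ℝ, ℝ) 𝓘(ℝ, ℝ) (fun t => H (γ t)) (Icc 0 L) t _ :=
      (hH.mdifferentiable (by simp) (γ t)).hasMFDerivAt.comp_hasMFDerivWithinAt t (hγ t ht)
    have h2 := h1.hasFDerivWithinAt
    rw [hasDerivWithinAt_iff_hasFDerivWithinAt]
    refine h2.congr_fderiv (ContinuousLinearMap.ext fun (r : ℝ) => ?_)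
    have h3 : dAt H (γ t) (hamiltonianVectorField σ H (γ t)) = 0 := by
      rw [← hamiltonianVectorField_spec hσ H]
      exact (σ (γ t)).map_eq_zero_of_eq _ (i := 0) (j := 1) rfl (by simp)
    change mfderiv (𝓡 (m + 2)) 𝓘(ℝ, ℝ) H (γ t) (r • hamiltonianVectorField σ H (γ t)) = r • (0 : ℝ)
    rw [map_smul]
    exact congrArg (r • ·) h3
  exact constant_of_has_deriv_right_zero (fun t ht => (hd t ht).continuousWithinAt)
    (fun t ht => (hd t (Ico_subset_Icc_self ht)).mono_of_mem_nhdsWithin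
      (Icc_mem_nhdsGE_of_mem ht)) s hs

variable [IsManifold (𝓡 (m + 2)) ∞ Ω] [T2Space Ω]

/-- Transport of a flow chart by a short time, inside another flow chart `k`. -/
theorem exists_flowTube_of_flowChart (hσ : IsSymplecticForm σ)
    (hH : ContMDiff (𝓡 (m + 2)) 𝓘(ℝ, ℝ) ∞ H) {ω' : Euc m →L[ℝ] Euc m →L[ℝ] ℝ}
    (hk : IsFlowChart σ H h ω' k) {ρ : ℝ} (hρ : 0 < ρ) (hkρ : Metric.ball 0 ρ ⊆ k.target)
    (hc : IsFlowChart σ H h ωZ c) (h0c : 0 ∈ c.target) {α : ℝ} (hα : |α| < ρ / 4)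
    (hcα : c.symm 0 = k.symm (α • tVec)) (hT0 : 0 ≤ T) (hTρ : T ≤ ρ / 2) :
    ∃ c', IsFlowChart σ H h ωZ c' ∧ 0 ∈ c'.target ∧ c'.symm 0 = k.symm ((α + T) • tVec) ∧
      ∃ δ > 0, ∀ᶠ w in 𝓝 (0 : Euc (m + 2)), IsFlowTube σ H c c' T δ w := by
  obtain ⟨c', hc', hc't, hc's⟩ := hc.translate hk T
  have hball : ∀ x : Euc (m + 2), ∀ t : ℝ, ‖x‖ < ρ / 4 → |t| ≤ T + ρ / 4 →
      x + t • tVec ∈ k.target := by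
    intro x t hx ht
    refine hkρ (mem_ball_zero_iff.2 ((norm_add_le _ _).trans_lt ?_))
    rw [norm_smul, norm_tVec, Real.norm_eq_abs]
    linarith
  have hαk : α • (tVec : Euc (m + 2)) ∈ k.target := by
    refine hkρ (mem_ball_zero_iff.2 ?_)
    rw [norm_smul, norm_tVec, Real.norm_eq_abs]
    linarith
  set g : Euc (m + 2) → Euc (m + 2) := fun w => k (c.symm w) with hg
  have h0k : c.symm 0 ∈ k.source := by
    rw [hcα]
    exact k.map_target hαk
  have hg0 : g 0 = α • tVec := by simp only [hg, hcα, k.right_inv hαk]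
  have hgn : ‖g 0‖ < ρ / 4 := by rw [hg0, norm_smul, norm_tVec, Real.norm_eq_abs]; linarith
  have h0c' : 0 ∈ c'.target := by
    rw [hc't]
    exact ⟨h0c, h0k, hball _ T hgn (by rw [abs_of_nonneg hT0]; linarith)⟩
  have hcont : ContinuousAt g 0 :=
    (k.continuousAt h0k).comp (c.continuousAt_symm h0c)
  have hev : ∀ᶠ w in 𝓝 (0 : Euc (m + 2)), w ∈ c.target ∧ w ∈ c'.target ∧ c.symm w ∈ k.source ∧
      ‖g w‖ < ρ / 4 :=
    (c.open_target.eventually_mem h0c).and ((c'.open_target.eventually_mem h0c').and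
      (((c.continuousAt_symm h0c).eventually (k.open_source.eventually_mem h0k)).and
        (hcont.norm.eventually_lt continuousAt_const hgn)))
  obtain ⟨r, hr, hrb⟩ := Metric.eventually_nhds_iff_ball.1 hev
  refine ⟨c', hc', h0c', ?_, min (r / 2) (ρ / 4), by positivity, ?_⟩
  · rw [hc's]
    change k.symm (g 0 + _) = _
    rw [hg0, add_smul]
  · filter_upwards [Metric.ball_mem_nhds (0 : Euc (m + 2)) (half_pos hr)] with w hw
    set δ := min (r / 2) (ρ / 4)
    have hδr : δ ≤ r / 2 := min_le_left _ _
    have hδρ : δ ≤ ρ / 4 := min_le_right _ _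
    have hδ0 : 0 < δ := by positivity
    have hwt : ∀ t : ℝ, |t| ≤ δ → w + t • tVec ∈ Metric.ball (0 : Euc (m + 2)) r := by
      intro t ht
      rw [mem_ball_zero_iff] at hw ⊢
      refine (norm_add_le _ _).trans_lt ?_
      rw [norm_smul, norm_tVec, Real.norm_eq_abs]
      linarith
    have hw0 := hrb w (Metric.ball_subset_ball (by linarith) hw)
    have hline := hk.isMIntegralCurveOn hσ hH (w := g w) (s := Icc (-δ) (T + δ)) fun t ht =>
      hball _ t hw0.2.2.2 (abs_le.2 ⟨by linarith [ht.1], by linarith [ht.2]⟩)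
    have hline' := hc.isMIntegralCurveOn hσ hH (w := w) (s := Icc (-δ) δ) fun t ht =>
      (hrb _ (hwt t (abs_le.2 ht))).1
    have heq := IsMIntegralCurveOn.eqOn_of_eq hσ hH (t₀ := 0)
      (hline.mono (Icc_subset_Icc_right (by linarith))) hline' ⟨by linarith, hδ0.le⟩
      (by simp [hg, k.left_inv hw0.2.2.1])
    refine ⟨fun t ht => ⟨(hrb _ (hwt t ht)).1, (hrb _ (hwt t ht)).2.1⟩, _, hline, fun t ht =>
      ⟨heq (abs_le.1 ht), ?_⟩⟩
    have h1 : g (w + t • tVec) = g w + t • tVec := by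
      have h2 := heq (abs_le.1 ht)
      simp only at h2
      change k (c.symm (w + t • tVec)) = _
      rw [← h2, k.right_inv (hball _ t hw0.2.2.2 (by linarith))]
    rw [hc's]
    change _ = k.symm (g (w + t • tVec) + _)
    rw [h1]
    simp only [add_smul]
    congr 1
    abel

/-- Transport of a flow chart along a trajectory. -/
theorem exists_flowTube_of_trajectory (hσ : IsSymplecticForm σ)
    (hH : ContMDiff (𝓡 (m + 2)) 𝓘(ℝ, ℝ) ∞ H) {γ : ℝ → Ω} {L : ℝ} (hL : 0 ≤ L)
    (hγ : IsMIntegralCurveOn (I := 𝓡 (m + 2)) γ (hamiltonianVectorField σ H) (Icc 0 L))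
    (hX : hamiltonianVectorField σ H (γ 0) ≠ 0) (hc : IsFlowChart σ H (H (γ 0)) ωZ c)
    (h0c : 0 ∈ c.target) (hc0 : c.symm 0 = γ 0) :
    ∃ c', IsFlowChart σ H (H (γ 0)) ωZ c' ∧ 0 ∈ c'.target ∧ c'.symm 0 = γ L ∧
      ∃ δ > 0, ∀ᶠ w in 𝓝 (0 : Euc (m + 2)), IsFlowTube σ H c c' L δ w := by
  have hloc : ∀ s : Icc 0 L, ∃ ε > 0, ∀ a ∈ Icc 0 L, ∀ b ∈ Icc 0 L, a ≤ b → |a - s| < ε →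
      |b - s| < ε → ∀ c, IsFlowChart σ H (H (γ 0)) ωZ c → 0 ∈ c.target → c.symm 0 = γ a →
      ∃ c', IsFlowChart σ H (H (γ 0)) ωZ c' ∧ 0 ∈ c'.target ∧ c'.symm 0 = γ b ∧
        ∃ δ > 0, ∀ᶠ w in 𝓝 (0 : Euc (m + 2)), IsFlowTube σ H c c' (b - a) δ w := by
    rintro ⟨s, hs⟩
    obtain ⟨ω', k, -, hk, hsk, hk0⟩ := exists_isFlowChart hσ hH
      (hamiltonianVectorField_ne_zero_of_trajectory hσ hH hγ ⟨le_rfl, hL⟩ hs hX)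
    rw [energy_eq_of_trajectory hσ hH hγ hs] at hk
    have h0k : 0 ∈ k.target := by
      rw [← hk0]
      exact k.map_source hsk
    have hk0' : k.symm 0 = γ s := by rw [← hk0, k.left_inv hsk]
    obtain ⟨ρ, hρ, hkρ⟩ := Metric.isOpen_iff.1 k.open_target 0 h0k
    have hline : ∀ t ∈ Icc 0 L, |t - s| < ρ / 8 → γ t = k.symm ((t - s) • tVec) := by
      intro t ht hts
      have hts' := abs_lt.1 hts
      have h1 := IsMIntegralCurveOn.shift (hk.isMIntegralCurveOn hσ hH (w := 0) (s := Icc (-(ρ / 8)) (ρ / 8))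
        fun t ht => hkρ (by
          rw [zero_add, mem_ball_zero_iff, norm_smul, norm_tVec, Real.norm_eq_abs, mul_one]
          exact (abs_le.2 ht).trans_lt (by linarith))) s
      have h2 := IsMIntegralCurveOn.eqOn_of_eq hσ hH (t₀ := s) (a := max 0 (-(ρ / 8) + s))
        (b := min L (ρ / 8 + s))
        (hγ.mono (Icc_subset_Icc (le_max_left _ _) (min_le_left _ _)))
        (h1.mono (Icc_subset_Icc (le_max_right _ _) (min_le_right _ _)))
        ⟨max_le hs.1 (by linarith), le_min hs.2 (by linarith)⟩ (by simp [hk0'])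
        (x := t) ⟨max_le ht.1 (by linarith), le_min ht.2 (by linarith)⟩
      simpa using h2
    refine ⟨ρ / 8, by positivity, fun a ha b hb hab has hbs c hc h0c hca => ?_⟩
    have has' := abs_lt.1 has
    have hbs' := abs_lt.1 hbs
    obtain ⟨c', h1, h2, h3, h4⟩ := exists_flowTube_of_flowChart hσ hH hk hρ hkρ hc h0c
      (α := a - s) (T := b - a) (has.trans (by linarith)) (by rw [hca, hline a ha has])
      (by linarith) (by simp only at has' hbs'; linarith)
    refine ⟨c', h1, h2, ?_, h4⟩
    rw [h3, hline b hb hbs]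
    congr 2
    ring
  choose ε hε hεP using hloc
  obtain ⟨t, ht0, htm, ⟨N, hN⟩, htc⟩ := exists_monotone_Icc_subset_open_cover_Icc hL
    (c := fun s : Icc 0 L => {x | |(x : ℝ) - s| < ε s})
    (fun s => isOpen_lt (by fun_prop) continuous_const)
    (fun x _ => mem_iUnion.2 ⟨x, by simpa using hε x⟩)
  have hind : ∀ n, ∃ c', IsFlowChart σ H (H (γ 0)) ωZ c' ∧ 0 ∈ c'.target ∧
      c'.symm 0 = γ (t n) ∧
      ∃ δ > 0, ∀ᶠ w in 𝓝 (0 : Euc (m + 2)), IsFlowTube σ H c c' (t n) δ w := by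
    intro n
    induction n with
    | zero =>
      obtain ⟨c', h1, h2, h3, δ, hδ, h4⟩ := hεP ⟨0, le_rfl, hL⟩ 0 ⟨le_rfl, hL⟩ 0 ⟨le_rfl, hL⟩ le_rfl
        (by simpa using hε _) (by simpa using hε _) c hc h0c hc0
      rw [ht0]
      exact ⟨c', h1, h2, h3, δ, hδ, by simpa using h4⟩
    | succ n ih =>
      obtain ⟨c', h1, h2, h3, δ, hδ, h4⟩ := ih
      obtain ⟨s, hs⟩ := htc n
      have hle : t n ≤ t (n + 1) := htm n.le_succ
      obtain ⟨c'', h1', h2', h3', δ', hδ', h4'⟩ := hεP s (t n) (t n).2 (t (n + 1)) (t (n + 1)).2 hle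
        (hs ⟨le_rfl, hle⟩) (hs ⟨hle, le_rfl⟩) c' h1 h2 h3
      refine ⟨c'', h1', h2', h3', min δ δ', lt_min hδ hδ', ?_⟩
      filter_upwards [h4, h4'] with w hw hw'
      have := (hw.mono (min_le_left δ δ')).trans (lt_min hδ hδ') (hw'.mono (min_le_right δ δ'))
        (t n).2.1 (sub_nonneg.2 hle)
      rwa [add_sub_cancel] at this
  have := hind N
  rwa [hN N le_rfl] at this

end Tubes

/-! ### Section charts -/

section SectionCharts

variable {m : ℕ} {Ω : Type*} [TopologicalSpace Ω] [ChartedSpace (Euc (m + 2)) Ω]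
  {σ : TwoForm (m + 2) Ω} {H : Ω → ℝ} {h : ℝ} {ωZ : Euc m →L[ℝ] Euc m →L[ℝ] ℝ} {S : Set Ω}
  {c e : OpenPartialHomeomorph Ω (Euc (m + 2))}

/-- A chart which straightens the section `S` and which differs from the flow chart `c` only in
the time coordinate. -/
structure IsSectionChart (S : Set Ω) (c e : OpenPartialHomeomorph Ω (Euc (m + 2))) : Prop where
  mem : e ∈ IsManifold.maximalAtlas (𝓡 (m + 2)) ∞ Ω
  source_subset : e.source ⊆ c.source
  zc_eq : ∀ x ∈ e.source, zc (e x) = zc (c x)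
  ec_eq : ∀ x ∈ e.source, ec (e x) = ec (c x)
  mem_iff : ∀ x ∈ e.source, x ∈ S ↔ tc (e x) = 0

theorem IsSectionChart.isSliceChart (he : IsSectionChart S c e) (hc : IsFlowChart σ H h ωZ c) :
    IsSliceChart m (slice H S h) e := by
  refine ⟨he.mem, fun x hx => ?_⟩
  rw [forall_coord_eq_zero_iff, he.ec_eq x hx, ← he.mem_iff x hx]
  refine and_congr_right fun _ => ?_
  rw [hc.ec_eq (he.source_subset hx)]
  simp

theorem contDiffOn_chart_symm_comp (hc : c ∈ IsManifold.maximalAtlas (𝓡 (m + 2)) ∞ Ω)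
    (he : e ∈ IsManifold.maximalAtlas (𝓡 (m + 2)) ∞ Ω) :
    ContDiffOn ℝ ∞ (fun w => c (e.symm w)) (e.symm.trans c).source := by
  rw [← contMDiffOn_iff_contDiffOn]
  exact (contMDiffOn_of_mem_maximalAtlas hc).comp
    ((contMDiffOn_symm_of_mem_maximalAtlas he).mono (by simp))
    (by intro z hz; simpa using hz.2)

/-- In a section chart, the symplectic form restricts to `ωZ` on the slices. -/
theorem IsSectionChart.formInChart_eq (he : IsSectionChart S c e) (hc : IsFlowChart σ H h ωZ c)
    {w : Euc (m + 2)} (hw : w ∈ e.target) {a b : Euc (m + 2)} (ha : ec a = 0) (hb : ec b = 0) :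
    formInChart σ e w a b = ωZ (zc a) (zc b) := by
  have hsub : e.target ⊆ (e.symm.trans c).source := fun y hy => by
    simpa using ⟨hy, he.source_subset (e.map_target hy)⟩
  have hd : HasFDerivAt (fun w => c (e.symm w)) (fderiv ℝ (fun w => c (e.symm w)) w) w :=
    ((((contDiffOn_chart_symm_comp hc.mem he.mem).mono hsub).contDiffAt
      (e.open_target.mem_nhds hw)).differentiableAt (by simp)).hasFDerivAt
  have hcw := c.map_source (he.source_subset (e.map_target hw))
  rw [formInChart_of_symm_eq hc.mem (f := fun w => c (e.symm w)) (by
    filter_upwards [e.open_target.mem_nhds hw] with y hy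
    rw [c.left_inv (he.source_subset (e.map_target hy))]) hd.differentiableAt hcw,
    pullbackForm_apply, hc.form _ hcw]
  have hz : ∀ a, zc (fderiv ℝ (fun w => c (e.symm w)) w a) = zc a := by
    intro a
    have h1 := ((zc : Euc (m + 2) →L[ℝ] Euc m).hasFDerivAt.comp w hd)
    have h2 := (zc : Euc (m + 2) →L[ℝ] Euc m).hasFDerivAt.congr_of_eventuallyEq (x := w)
      (f₁ := zc ∘ fun w => c (e.symm w)) (by
      filter_upwards [e.open_target.mem_nhds hw] with y hy
      change zc (c (e.symm y)) = zc y
      rw [← he.zc_eq _ (e.map_target hy), e.right_inv hy])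
    exact congrArg (fun L => L a) (h1.unique h2)
  have hec : ∀ a, ec (fderiv ℝ (fun w => c (e.symm w)) w a) = ec a := by
    intro a
    have h1 := ((ec : Euc (m + 2) →L[ℝ] ℝ).hasFDerivAt.comp w hd)
    have h2 := (ec : Euc (m + 2) →L[ℝ] ℝ).hasFDerivAt.congr_of_eventuallyEq (x := w)
      (f₁ := ec ∘ fun w => c (e.symm w)) (by
      filter_upwards [e.open_target.mem_nhds hw] with y hy
      change ec (c (e.symm y)) = ec y
      rw [← he.ec_eq _ (e.map_target hy), e.right_inv hy])
    exact congrArg (fun L => L a) (h1.unique h2)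
  simp [stdForm, hz, hec, ha, hb]

/-- The point of a section chart over `w` lies on the line of the flow chart over `w`. -/
theorem IsSectionChart.symm_eq (he : IsSectionChart S c e) {w : Euc (m + 2)} (hw : w ∈ e.target) :
    w + (tc (c (e.symm w)) - tc w) • tVec ∈ c.target ∧
      e.symm w = c.symm (w + (tc (c (e.symm w)) - tc w) • tVec) := by
  have hs := e.map_target hw
  have h1 : w + (tc (c (e.symm w)) - tc w) • tVec = c (e.symm w) := by
    refine euc_ext ?_ (by simp) ?_
    · rw [← he.zc_eq _ hs, e.right_inv hw]
      simp
    · rw [← he.ec_eq _ hs, e.right_inv hw]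
      simp
  rw [h1]
  exact ⟨c.map_source (he.source_subset hs), (c.left_inv (he.source_subset hs)).symm⟩

theorem IsSection.hamiltonianVectorField_ne_zero (hS : IsSection σ H S) {y : Ω} (hy : y ∈ S) :
    hamiltonianVectorField σ H y ≠ 0 := by
  intro h0
  obtain ⟨g, hg, hyg⟩ := hS.1 y hy
  refine hS.2 y hy ⟨g, hg, hy, hyg, fun i _ => ?_⟩
  rw [h0]
  have : (show Euc (m + 2) from mfderiv (𝓡 (m + 2)) (𝓡 (m + 2)) g y 0) = 0 := map_zero _
  rw [this]
  rfl

/-- A section chart is obtained from a flow chart by translation along the flow lines, which are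
transversal to the section. -/
theorem exists_isSectionChart [IsManifold (𝓡 (m + 2)) ∞ Ω] (hσ : IsSymplecticForm σ)
    (hH : ContMDiff (𝓡 (m + 2)) 𝓘(ℝ, ℝ) ∞ H) (hS : IsSection σ H S)
    (hc : IsFlowChart σ H h ωZ c) (h0c : 0 ∈ c.target) (hy : c.symm 0 ∈ S) :
    ∃ e, IsSectionChart S c e ∧ c.symm 0 ∈ e.source ∧ e (c.symm 0) = 0 := by
  obtain ⟨g, hg, hyg⟩ := hS.1 _ hy
  have hgec : ∀ x ∈ g.source, x ∈ S ↔ ec (g x) = 0 := fun x hx =>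
    (hg.2 x hx).trans (forall_coord_eq_zero_iff_ec _)
  have hnt : ec (show Euc (m + 2) from mfderiv (𝓡 (m + 2)) (𝓡 (m + 2)) g (c.symm 0)
      (hamiltonianVectorField σ H (c.symm 0))) ≠ 0 := fun h0 =>
    hS.2 _ hy ⟨g, hg, hy, hyg, (forall_coord_eq_zero_iff_ec _).2 h0⟩
  set s := (c.symm.trans g).source
  have hs : IsOpen s := (c.symm.trans g).open_source
  have h0s : (0 : Euc (m + 2)) ∈ s := by simpa [s] using ⟨h0c, hyg⟩
  have hgc := contDiffOn_chart_symm_comp hg.1 hc.mem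
  set f : Euc (m + 2) → ℝ := fun w => ec (g (c.symm w)) with hf
  have hfs : ContDiffOn ℝ ∞ f s := (ec : Euc (m + 2) →L[ℝ] ℝ).contDiff.comp_contDiffOn hgc
  have hf' : HasFDerivAt f (fderiv ℝ f 0) 0 :=
    ((hfs.contDiffAt (hs.mem_nhds h0s)).differentiableAt (by simp)).hasFDerivAt
  set ℓ := fderiv ℝ f 0 with hℓ
  have hℓt : ℓ tVec ≠ 0 := by
    have h1 : HasFDerivAt (fun w => g (c.symm w)) _ 0 :=
      ((hgc.contDiffAt (hs.mem_nhds h0s)).differentiableAt (by simp)).hasFDerivAt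
    have h2 : HasFDerivAt f _ 0 := (ec : Euc (m + 2) →L[ℝ] ℝ).hasFDerivAt.comp _ h1
    have h3 := mfderiv_comp (0 : Euc (m + 2))
      ((mdifferentiable_of_mem_maximalAtlas hg.1).mdifferentiableAt hyg)
      ((mdifferentiable_of_mem_maximalAtlas hc.mem).mdifferentiableAt_symm h0c)
    rw [mfderiv_eq_fderiv] at h3
    have h4 : fderiv ℝ (fun w => g (c.symm w)) 0 tVec =
        mfderiv (𝓡 (m + 2)) (𝓡 (m + 2)) g (c.symm 0) (hamiltonianVectorField σ H (c.symm 0)) := by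
      rw [← hc.mfderiv_tVec hσ hH h0c]
      exact congrArg (fun L : Euc (m + 2) →L[ℝ] Euc (m + 2) => L tVec) h3
    rw [hℓ, h2.fderiv]
    change ec (fderiv ℝ (fun w => g (c.symm w)) 0 tVec) ≠ 0
    rw [h4]
    exact hnt
  let Φ : Euc (m + 2) → Euc (m + 2) := fun w => w + (f w - tc w) • tVec
  let L : Euc (m + 2) →L[ℝ] Euc (m + 2) :=
    ContinuousLinearMap.id ℝ _ + (ℓ - tc).smulRight tVec
  have hL : ∀ u, L u = u + (ℓ u - tc u) • tVec := fun u => rfl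
  have hLinj : Function.Injective L := by
    rw [injective_iff_map_eq_zero]
    intro u hu
    rw [hL] at hu
    have h1 := congrArg zc hu
    have h2 := congrArg tc hu
    have h3 := congrArg ec hu
    simp at h1 h2 h3
    have h4 : u = tc u • tVec := euc_ext (by simp [h1]) (by simp) (by simp [h3])
    rw [h4, map_smul, smul_eq_mul] at h2
    have h5 : tc u = 0 := by
      rcases mul_eq_zero.1 h2 with h | h
      · exact h
      · exact absurd h hℓt
    rw [h4, h5, zero_smul]
  let Le : Euc (m + 2) ≃L[ℝ] Euc (m + 2) :=
    (LinearEquiv.ofInjectiveEndo L.toLinearMap hLinj).toContinuousLinearEquiv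
  have hΦ' : HasFDerivAt Φ (Le : Euc (m + 2) →L[ℝ] Euc (m + 2)) 0 :=
    ((hasFDerivAt_id (0 : Euc (m + 2))).add
      ((hf'.sub (tc : Euc (m + 2) →L[ℝ] ℝ).hasFDerivAt).smul_const tVec)).congr_fderiv
        (ContinuousLinearMap.ext fun u => rfl)
  have hΦs : ContDiffOn ℝ ∞ Φ s := contDiffOn_id.add
    ((hfs.sub (tc : Euc (m + 2) →L[ℝ] ℝ).contDiff.contDiffOn).smul contDiffOn_const)
  have hc0 : c (c.symm 0) = 0 := c.right_inv h0c
  obtain ⟨e, he, hye, hes, hesm, heΦ⟩ := exists_chart_of_coord hc.mem (c.map_target h0c) hs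
    (by rwa [hc0]) hΦs (Φ' := Le) (by rwa [hc0])
  have hmem : ∀ x ∈ e.source, x ∈ S ↔ tc (e x) = 0 := by
    intro x hx
    have h1 := hesm x hx
    simp only [s, OpenPartialHomeomorph.trans_source, mem_inter_iff, mem_preimage] at h1
    have h2 : c.symm (c x) = x := c.left_inv (hes hx)
    rw [h2] at h1
    rw [hgec x h1.2, heΦ]
    simp [Φ, hf, h2]
  refine ⟨e, ⟨he, hes, fun x hx => by simp [heΦ, Φ], fun x hx => by simp [heΦ, Φ], hmem⟩, hye, ?_⟩
  refine euc_ext ?_ ?_ ?_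
  · simp [heΦ, Φ, hc0]
  · rw [(hmem _ hye).1 hy, map_zero]
  · simp [heΦ, Φ, hc0]

end SectionCharts

/-! ### First hits -/

section FirstHits

variable {m : ℕ} {Ω : Type*} [TopologicalSpace Ω] [ChartedSpace (Euc (m + 2)) Ω]
  [IsManifold (𝓡 (m + 2)) ∞ Ω] [T2Space Ω]
  {σ : TwoForm (m + 2) Ω} {H : Ω → ℝ} {S S₁ : Set Ω} {x y v p q : Ω} {γ η : ℝ → Ω} {s s' t t' : ℝ}

theorem forward_eq (hσ : IsSymplecticForm σ) (hH : ContMDiff (𝓡 (m + 2)) 𝓘(ℝ, ℝ) ∞ H)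
    (hγ : IsMIntegralCurveOn (I := 𝓡 (m + 2)) γ (hamiltonianVectorField σ H) (Icc s (s + t)))
    (hη : IsMIntegralCurveOn (I := 𝓡 (m + 2)) η (hamiltonianVectorField σ H) (Icc s' (s' + t)))
    (h : γ s = η s') {r : ℝ} (hr : r ∈ Icc 0 t) : γ (s + r) = η (s' + r) := by
  have h1 := IsMIntegralCurveOn.shift hη (s - s')
  have ht : 0 ≤ t := hr.1.trans hr.2
  have h2 := IsMIntegralCurveOn.eqOn_of_eq hσ hH (t₀ := s) hγ
    (h1.mono (Icc_subset_Icc (by linarith) (by linarith))) ⟨le_rfl, by linarith⟩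
    (by simpa using h) (x := s + r) ⟨by linarith [hr.1], by linarith [hr.2]⟩
  rw [h2]
  change η (s + r - (s - s')) = _
  congr 1
  ring

/-- If two trajectories meet before their first hits of `S`, then they end at the same point. -/
theorem IsFirstHitAlong.eq_of_meet (hσ : IsSymplecticForm σ)
    (hH : ContMDiff (𝓡 (m + 2)) 𝓘(ℝ, ℝ) ∞ H) (hγ : IsFirstHitAlong σ H S γ x t p)
    (hη : IsFirstHitAlong σ H S η y t' q) (hs : s ∈ Ico 0 t) (hs' : s' ∈ Ico 0 t')
    (h : γ s = η s') : p = q ∧ t - s = t' - s' := by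
  wlog hle : t - s ≤ t' - s' generalizing x y γ η s s' t t' p q
  · have := this hη hγ hs' hs h.symm (by linarith)
    exact ⟨this.1.symm, this.2.symm⟩
  obtain ⟨-, hγi, -, hγt, hpS, -⟩ := hγ
  obtain ⟨-, hηi, -, hηt, -, hηS⟩ := hη
  have h1 := forward_eq hσ hH (t := t - s) (hγi.mono (Icc_subset_Icc hs.1 (by linarith)))
    (hηi.mono (Icc_subset_Icc hs'.1 (by linarith))) h (r := t - s) ⟨by linarith [hs.2], le_rfl⟩
  rw [add_sub_cancel, hγt] at h1
  have h2 : s' + (t - s) = t' := by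
    by_contra hne
    exact hηS (s' + (t - s)) ⟨by linarith [hs'.1, hs.2], lt_of_le_of_ne (by linarith) hne⟩
      (h1 ▸ hpS)
  refine ⟨?_, by linarith⟩
  rw [h1, h2, hηt]

/-- Trajectories from different points of `S₀` do not meet before they reach `S₁`, and a trajectory
from `S₀` to `S₁` visits each of its points only once: this is where the injectivity of the Poincaré
map enters. -/
theorem IsFirstHitAlong.eq_of_meet_of_injOn (hσ : IsSymplecticForm σ)
    (hH : ContMDiff (𝓡 (m + 2)) 𝓘(ℝ, ℝ) ∞ H) {τ : Ω → ℝ} {R : Ω → Ω} {S₀ : Set Ω}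
    (hR : InjOn R S₀) (hx : x ∈ S₀) (hy : y ∈ S₀) (hγ : IsFirstHitAlong σ H S₁ γ x (τ x) (R x))
    (hη : IsFirstHitAlong σ H S₁ η y (τ y) (R y)) (hs : s ∈ Ico 0 (τ x)) (hs' : s' ∈ Ico 0 (τ y))
    (h : γ s = η s') : x = y ∧ s = s' := by
  have h1 := hγ.eq_of_meet hσ hH hη hs hs' h
  have h2 := hR hx hy h1.1
  subst h2
  exact ⟨rfl, by linarith [h1.2]⟩

end FirstHits

/-! ### The passage from one section to the other -/

section Passage

variable {m : ℕ} {Ω : Type*} [TopologicalSpace Ω] [ChartedSpace (Euc (m + 2)) Ω]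
  {σ : TwoForm (m + 2) Ω} {H : Ω → ℝ} {S₀ S₁ : Set Ω} {τ : Ω → ℝ} {R : Ω → Ω}

/-- The trajectory from the point `w` of the section `S₀` to the section `S₁` runs, for a time
interval of length `2δ`, along the line through `w` in the chart `c`, and ends at the point `w` of
`S₁`. The points of the sections are labelled by the charts `e₀` and `e₁`. -/
structure PassesThrough (σ : TwoForm (m + 2) Ω) (H : Ω → ℝ) (S₀ S₁ : Set Ω) (τ : Ω → ℝ) (R : Ω → Ω)
    (c e₀ e₁ : OpenPartialHomeomorph Ω (Euc (m + 2))) (δ : ℝ) (w : Euc (m + 2)) : Prop where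
  mem_target₀ : w ∈ e₀.target
  mem_target₁ : w ∈ e₁.target
  mem_section : e₀.symm w ∈ S₀
  map_eq : R (e₀.symm w) = e₁.symm w
  line_mem : ∀ t, |t| ≤ δ → w + t • tVec ∈ c.target
  line_not_mem₀ : ∀ t, |t| ≤ δ → c.symm (w + t • tVec) ∉ S₀
  line_not_mem₁ : ∀ t, |t| ≤ δ → c.symm (w + t • tVec) ∉ S₁
  exists_trajectory : ∃ (γ : ℝ → Ω) (s : ℝ),
    IsFirstHitAlong σ H S₁ γ (e₀.symm w) (τ (e₀.symm w)) (R (e₀.symm w)) ∧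
      δ < s ∧ s + δ < τ (e₀.symm w) ∧ ∀ t, |t| ≤ δ → γ (s + t) = c.symm (w + t • tVec)

variable [IsManifold (𝓡 (m + 2)) ∞ Ω] [T2Space Ω]

/-- Charts adapted to the flow between the two sections, near a given trajectory. -/
theorem exists_passage_charts (hσ : IsSymplecticForm σ) (hH : ContMDiff (𝓡 (m + 2)) 𝓘(ℝ, ℝ) ∞ H)
    (hS₀ : IsSection σ H S₀) (hS₁ : IsSection σ H S₁)
    (hR : ∀ x ∈ S₀, IsFirstHit σ H S₁ x (τ x) (R x)) (hinj : InjOn R S₀) {y₀ : Ω} (hy₀ : y₀ ∈ S₀)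
    (hτ : ContinuousWithinAt τ S₀ y₀) {x₀ : Ω} (hx₀ : IsBetween σ H S₁ y₀ x₀) :
    ∃ (ωZ : Euc m →L[ℝ] Euc m →L[ℝ] ℝ) (c₀ c c₁ e₀ e₁ : OpenPartialHomeomorph Ω (Euc (m + 2)))
      (δ : ℝ), (∀ v w, ωZ v w = - ωZ w v) ∧ IsFlowChart σ H (H x₀) ωZ c₀ ∧
      IsFlowChart σ H (H x₀) ωZ c ∧ IsFlowChart σ H (H x₀) ωZ c₁ ∧ IsSectionChart S₀ c₀ e₀ ∧
      IsSectionChart S₁ c₁ e₁ ∧ 0 ∈ c.target ∧ c.symm 0 = x₀ ∧ 0 ∈ e₀.target ∧ e₀.symm 0 = y₀ ∧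
      0 < δ ∧ ∀ᶠ w in 𝓝 (0 : Euc (m + 2)), tc w = 0 →
        PassesThrough σ H S₀ S₁ τ R c e₀ e₁ δ w := by
  obtain ⟨γ, L, y, hγ, s₀, hs₀, hγs₀⟩ := hx₀
  obtain ⟨γ', hγ'⟩ := hR y₀ hy₀
  obtain ⟨hyR, hLτ⟩ := hγ.eq_of_meet hσ hH hγ' (s := 0) (s' := 0) ⟨le_rfl, hγ.1⟩ ⟨le_rfl, hγ'.1⟩
    (hγ.2.2.1.trans hγ'.2.2.1.symm)
  rw [sub_zero, sub_zero] at hLτ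
  obtain ⟨hL, hγi, hγ0, hγL, hyS, hγS⟩ := hγ
  have hX0 := hS₀.hamiltonianVectorField_ne_zero hy₀
  obtain ⟨ωZ, c₀, hωZ, hc₀, hyc₀, hc₀0⟩ := exists_isFlowChart hσ hH hX0
  have h0c₀ : 0 ∈ c₀.target := by
    rw [← hc₀0]
    exact c₀.map_source hyc₀
  have hc₀s : c₀.symm 0 = y₀ := by rw [← hc₀0, c₀.left_inv hyc₀]
  have hγi₁ := hγi.mono (Icc_subset_Icc_right hs₀.2.le)
  have hHx₀ : H x₀ = H y₀ := by
    rw [← hγs₀, ← hγ0]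
    exact energy_eq_of_trajectory hσ hH hγi₁ ⟨hs₀.1.le, le_rfl⟩
  rw [← hHx₀] at hc₀
  obtain ⟨c, hc, h0c, hcs, δ₁, hδ₁, htube₁⟩ := exists_flowTube_of_trajectory hσ hH hs₀.1.le hγi₁
    (by rwa [hγ0]) (c := c₀) (ωZ := ωZ) (by rwa [hγ0, ← hHx₀]) h0c₀ (by rw [hc₀s, hγ0])
  rw [hγ0, ← hHx₀] at hc
  have hγi₂ : IsMIntegralCurveOn (I := 𝓡 (m + 2)) (fun t => γ (t - -s₀))
      (hamiltonianVectorField σ H) (Icc 0 (L - s₀)) := by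
    refine (IsMIntegralCurveOn.shift hγi (-s₀)).mono (Icc_subset_Icc ?_ ?_)
    · linarith [hs₀.1]
    · linarith
  have hX1 := hamiltonianVectorField_ne_zero_of_trajectory hσ hH hγi ⟨le_rfl, hL.le⟩
    ⟨hs₀.1.le, hs₀.2.le⟩ (by rwa [hγ0])
  obtain ⟨c₁, hc₁, h0c₁, hc₁s, δ₂, hδ₂, htube₂⟩ := exists_flowTube_of_trajectory hσ hH
    (sub_nonneg.2 hs₀.2.le) hγi₂ (by
      have h0 : (0 : ℝ) - -s₀ = s₀ := by ring
      rw [h0]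
      exact hX1) (c := c) (ωZ := ωZ)
    (by simpa [hγs₀] using hc) h0c (by simpa using hcs)
  have hc₁s' : c₁.symm 0 = y := by
    rw [hc₁s, ← hγL]
    congr 1
    ring
  have hc₁' : IsFlowChart σ H (H x₀) ωZ c₁ := by simpa [hγs₀] using hc₁
  obtain ⟨e₀, he₀, hy₀e₀, he₀0⟩ := exists_isSectionChart hσ hH hS₀ hc₀ h0c₀ (by rwa [hc₀s])
  obtain ⟨e₁, he₁, hye₁, he₁0⟩ := exists_isSectionChart hσ hH hS₁ hc₁' h0c₁ (by rwa [hc₁s'])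
  rw [hc₀s] at hy₀e₀ he₀0
  rw [hc₁s'] at hye₁ he₁0
  have h0e₀ : 0 ∈ e₀.target := by
    rw [← he₀0]
    exact e₀.map_source hy₀e₀
  have h0e₁ : 0 ∈ e₁.target := by
    rw [← he₁0]
    exact e₁.map_source hye₁
  have he₀s : e₀.symm 0 = y₀ := by rw [← he₀0, e₀.left_inv hy₀e₀]
  have hU₁ : (c₁.symm.trans e₁).source ∈ 𝓝 (0 : Euc (m + 2)) :=
    (c₁.symm.trans e₁).open_source.mem_nhds (by simpa [h0c₁, hc₁s'] using hye₁)
  obtain ⟨r, hr, hrU⟩ := Metric.mem_nhds_iff.1 hU₁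
  set δ := min (min δ₁ δ₂) (min (r / 2) (min (s₀ / 4) ((L - s₀) / 4))) with hδdef
  have hδ₁' : δ ≤ min δ₁ δ₂ := min_le_left _ _
  have hδr : δ ≤ r / 2 := (min_le_right _ _).trans (min_le_left _ _)
  have hδs : δ ≤ s₀ / 4 := (min_le_right _ _).trans ((min_le_right _ _).trans (min_le_left _ _))
  have hδL : δ ≤ (L - s₀) / 4 :=
    (min_le_right _ _).trans ((min_le_right _ _).trans (min_le_right _ _))
  have hs₀0 := hs₀.1
  have hLs₀ : 0 < L - s₀ := sub_pos.2 hs₀.2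
  have hδ : 0 < δ := by positivity
  refine ⟨ωZ, c₀, c, c₁, e₀, e₁, δ, hωZ, hc₀, hc, hc₁', he₀, he₁, h0c, hcs.trans hγs₀, h0e₀, he₀s,
    hδ, ?_⟩
  have hev₁ : ∀ᶠ w in 𝓝 (0 : Euc (m + 2)), |tc (c₀ (e₀.symm w)) - tc w| < δ / 2 := by
    have h1 : ContinuousAt (fun w => |tc (c₀ (e₀.symm w)) - tc w|) 0 := by
      have h2 : ContinuousAt (fun w => c₀ (e₀.symm w)) 0 := ContinuousAt.comp
        (by rw [he₀s]; exact c₀.continuousAt hyc₀) (e₀.continuousAt_symm h0e₀)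
      exact ((tc.continuous.continuousAt.comp h2).sub tc.continuous.continuousAt).abs
    exact h1.eventually_lt continuousAt_const (by simpa [he₀s, hc₀0] using hδ)
  have hev₂ : ∀ᶠ w in 𝓝 (0 : Euc (m + 2)), e₀.symm w ∈ S₀ → |τ (e₀.symm w) - L| < δ / 2 := by
    have h1 : ∀ᶠ x in 𝓝[S₀] y₀, |τ x - L| < δ / 2 := by
      have h2 := Metric.tendsto_nhds.1 hτ (δ / 2) (half_pos hδ)
      simpa only [Real.dist_eq, ← hLτ] using h2
    have h2 := eventually_nhdsWithin_iff.1 h1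
    have h3 := e₀.continuousAt_symm h0e₀
    rw [ContinuousAt, he₀s] at h3
    exact h3.eventually h2
  filter_upwards [htube₁, htube₂, e₀.open_target.mem_nhds h0e₀, e₁.open_target.mem_nhds h0e₁,
    hev₁, hev₂, Metric.ball_mem_nhds (0 : Euc (m + 2)) (half_pos hr)]
    with w hw₁ hw₂ hwe₀ hwe₁ hwt hwτ hwr htw
  have hv : e₀.symm w ∈ S₀ := by
    rw [he₀.mem_iff _ (e₀.map_target hwe₀), e₀.right_inv hwe₀, htw]
  have hτv := abs_lt.1 (hwτ hv)
  set v := e₀.symm w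
  set t₀ := tc (c₀ v) - tc w with ht₀
  have ht₀' := abs_lt.1 hwt
  obtain ⟨η, hη, hηe⟩ := (hw₁.mono (min_le_left δ₁ δ₂)).exists_trajectory (lt_min hδ₁ hδ₂)
    (hw₂.mono (min_le_right δ₁ δ₂)) hs₀.1.le (sub_nonneg.2 hs₀.2.le)
  obtain ⟨γv, hγv⟩ := hR v hv
  have hγη : ∀ t ∈ Icc 0 (τ v), γv t = η (t₀ + t) := by
    intro t ht
    have h1 := forward_eq hσ hH (γ := γv) (η := η) (s := 0) (s' := t₀) (t := τ v)
      (by simpa using hγv.2.1) (hη.mono (Icc_subset_Icc (by linarith) (by linarith)))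
      (by
        rw [(hηe t₀ (hwt.le.trans (by linarith))).1, ← (he₀.symm_eq hwe₀).2]
        exact hγv.2.2.1) ht
    rwa [zero_add] at h1
  have hline : ∀ t, |t| ≤ δ → γv (s₀ - t₀ + t) = c.symm (w + t • tVec) := by
    intro t ht
    have ht' := abs_le.1 ht
    rw [hγη _ ⟨by linarith, by linarith⟩, ← (hηe t (ht.trans hδ₁')).2.1]
    congr 1
    ring
  have hnot₁ : ∀ t, |t| ≤ δ → c.symm (w + t • tVec) ∉ S₁ := by
    intro t ht
    have ht' := abs_le.1 ht
    rw [← hline t ht]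
    exact hγv.2.2.2.2.2 _ ⟨by linarith, by linarith⟩
  have hnot₀ : ∀ t, |t| ≤ δ → c.symm (w + t • tVec) ∉ S₀ := by
    intro t ht hmem
    have ht' := abs_le.1 ht
    rw [← hline t ht] at hmem
    obtain ⟨γp, hγp⟩ := hR _ hmem
    have h1 := hγv.eq_of_meet_of_injOn hσ hH hinj hv hmem hγp (s := s₀ - t₀ + t) (s' := 0)
      ⟨by linarith, by linarith⟩ ⟨le_rfl, hγp.1⟩ hγp.2.2.1.symm
    linarith [h1.2]
  have hRv : R v = e₁.symm w := by
    set t' := t₀ + τ v - L with ht'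
    have ht'' : |t'| ≤ δ := abs_le.2 ⟨by linarith, by linarith⟩
    have h1 : R v = c₁.symm (w + t' • tVec) := by
      rw [← hγv.2.2.2.1, hγη _ ⟨hγv.1.le, le_rfl⟩, ← (hηe t' (ht''.trans hδ₁')).2.2]
      congr 1
      ring
    have h2 : w + t' • tVec ∈ (c₁.symm.trans e₁).source := by
      refine hrU ?_
      rw [mem_ball_zero_iff] at hwr ⊢
      refine (norm_add_le _ _).trans_lt ?_
      rw [norm_smul, norm_tVec, Real.norm_eq_abs]
      linarith
    rw [OpenPartialHomeomorph.trans_source] at h2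
    have h3 : R v ∈ e₁.source := by
      rw [h1]
      exact h2.2
    have h4 : c₁ (R v) = w + t' • tVec := by
      rw [h1]
      exact c₁.right_inv h2.1
    have h5 : e₁ (R v) = w := by
      refine euc_ext ?_ ?_ ?_
      · rw [he₁.zc_eq _ h3, h4]
        simp
      · rw [htw]
        exact (he₁.mem_iff _ h3).1 hγv.2.2.2.2.1
      · rw [he₁.ec_eq _ h3, h4]
        simp
    rw [← h5, e₁.left_inv h3]
  exact ⟨hwe₀, hwe₁, hv, hRv, fun t ht => (hw₂.1 t (ht.trans (hδ₁'.trans (min_le_right _ _)))).1,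
    hnot₀, hnot₁, γv, s₀ - t₀, hγv, by linarith, by linarith, hline⟩

end Passage

/-! ### Continuity of operators that preserve smooth families -/

section SpecialCurve

/-- The derivatives in `z` of a smooth function `F (l, z)` depend continuously on `(l, z)`. -/
theorem continuousOn_iteratedFDeriv_param {E : Type} [NormedAddCommGroup E] [NormedSpace ℝ E]
    {O : Set (ℝ × E)} (hO : IsOpen O) (k : ℕ) :
    ∀ {G : Type} [NormedAddCommGroup G] [NormedSpace ℝ G] {F : ℝ × E → G}, ContDiffOn ℝ ∞ F O →
      ContinuousOn (fun p : ℝ × E => iteratedFDeriv ℝ k (fun z => F (p.1, z)) p.2) O := by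
  induction k with
  | zero =>
    intro G _ _ F hF
    simp only [iteratedFDeriv_zero_eq_comp]
    exact (LinearIsometryEquiv.continuous _).comp_continuousOn hF.continuousOn
  | succ k ih =>
    intro G _ _ F hF
    let F' : ℝ × E → E →L[ℝ] G := fun p => (fderiv ℝ F p).comp (ContinuousLinearMap.inr ℝ ℝ E)
    have hF' : ContDiffOn ℝ ∞ F' O :=
      (hF.fderiv_of_isOpen hO (m := ∞) (by simp)).clm_comp contDiffOn_const
    have hd : ∀ p ∈ O, fderiv ℝ (fun z => F (p.1, z)) p.2 = F' p := by
      intro p hp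
      have h1 : HasFDerivAt F (fderiv ℝ F p) (p.1, p.2) :=
        ((hF.contDiffAt (hO.mem_nhds hp)).differentiableAt (by simp)).hasFDerivAt
      have h2 : HasFDerivAt (fun z : E => (p.1, z)) (ContinuousLinearMap.inr ℝ ℝ E) p.2 :=
        hasFDerivAt_prodMk_right p.1 p.2
      exact (h1.comp p.2 h2).fderiv
    refine ((continuousMultilinearCurryRightEquiv' ℝ k E G).symm.continuous.comp_continuousOn
      (ih hF')).congr fun p hp => ?_
    rw [iteratedFDeriv_succ_eq_comp_right]
    simp only [Function.comp_apply]
    congr 1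
    refine Filter.EventuallyEq.eq_of_nhds (Filter.EventuallyEq.iteratedFDeriv ℝ ?_ k)
    have : ∀ᶠ z in 𝓝 p.2, (p.1, z) ∈ O :=
      (Continuous.prodMk_right p.1).continuousAt.eventually (hO.mem_nhds hp)
    filter_upwards [this] with z hz using hd _ hz

/-- A sequence of functions which converges to zero fast enough, with all derivatives, consists of
values of a smooth one-parameter family. -/
theorem exists_special_curve (Z : Type) [NormedAddCommGroup Z] [NormedSpace ℝ Z]
    [CompleteSpace Z] :
    ∃ (ε l : ℕ → ℝ), (∀ n, 0 < ε n) ∧ Filter.Tendsto l Filter.atTop (𝓝 0) ∧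
      ∀ a : ℕ → Z → Z, (∀ n, ContDiff ℝ ∞ (a n)) →
        (∀ n, ∀ k ≤ n, ∀ x, ‖iteratedFDeriv ℝ k (a n) x‖ ≤ ε n) →
        ∃ A : ℝ × Z → Z, ContDiff ℝ ∞ A ∧ (∀ n x, A (l n, x) = a n x) ∧
          (∀ x, (∀ n, a n x = 0) → ∀ t, A (t, x) = 0) ∧ ∀ x, A (0, x) = 0 := by
  -- the `n`-th function is put at the parameter `2⁻ⁿ`, by means of a bump function there
  have hl : ∀ n : ℕ, (0 : ℝ) < (1 / 2) ^ n := fun n => by positivity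
  let ρ : ∀ n : ℕ, ContDiffBump ((1 / 2 : ℝ) ^ n) := fun n =>
    ⟨(1 / 2) ^ n / 8, (1 / 2) ^ n / 4, by positivity, by linarith [hl n]⟩
  have hρ1 : ∀ n, ρ n ((1 / 2) ^ n) = 1 := fun n =>
    (ρ n).one_of_mem_closedBall (Metric.mem_closedBall_self (ρ n).rIn_pos.le)
  have hρ0 : ∀ n, ρ n 0 = 0 := fun n => (ρ n).zero_of_le_dist (by
    rw [Real.dist_eq, zero_sub, abs_neg, abs_of_pos (hl n)]
    change (1 / 2 : ℝ) ^ n / 4 ≤ _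
    linarith [hl n])
  have hρne : ∀ n j, j ≠ n → ρ n ((1 / 2) ^ j) = 0 := by
    intro n j hne
    refine (ρ n).zero_of_le_dist ?_
    change (1 / 2 : ℝ) ^ n / 4 ≤ _
    rw [Real.dist_eq]
    have hhalf : ∀ i k : ℕ, i < k → (1 / 2 : ℝ) ^ k ≤ (1 / 2) ^ i / 2 := by
      intro i k hik
      calc (1 / 2 : ℝ) ^ k ≤ (1 / 2) ^ (i + 1) :=
            pow_le_pow_of_le_one (by norm_num) (by norm_num) hik
        _ = (1 / 2) ^ i / 2 := by ring
    rcases hne.lt_or_gt with hlt | hgt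
    · have := hhalf j n hlt
      exact le_trans (by linarith [hl n, hl j]) (le_abs_self _)
    · have := hhalf n j hgt
      exact le_trans (by linarith [hl n, hl j]) (neg_le_abs _)
  have hbd : ∀ n, ∃ C : ℝ, 0 < C ∧ ∀ i ≤ n, ∀ t, ‖iteratedFDeriv ℝ i (ρ n) t‖ ≤ C := by
    intro n
    have h1 : ∀ i, ∃ C : ℝ, ∀ t, ‖iteratedFDeriv ℝ i (ρ n) t‖ ≤ C := fun i =>
      ((ρ n).hasCompactSupport.iteratedFDeriv i).exists_bound_of_continuous
        ((ρ n).contDiff.continuous_iteratedFDeriv (m := i) (n := ∞)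
          (by exact_mod_cast le_top))
    choose C hC using h1
    refine ⟨1 + ∑ i ∈ Finset.range (n + 1), |C i|, by positivity, fun i hi t => ?_⟩
    have h2 := Finset.single_le_sum (f := fun i => |C i|) (fun i _ => abs_nonneg _)
      (Finset.mem_range.2 (Nat.lt_succ_of_le hi))
    linarith [hC i t, le_abs_self (C i)]
  choose C hC0 hC using hbd
  -- the factor `4⁻ⁿ` absorbs the factor `2ᵏ`, `k ≤ n`, of the Leibniz rule
  refine ⟨fun n => (1 / 4) ^ n / C n, fun n => (1 / 2) ^ n, fun n => div_pos (by positivity) (hC0 n),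
    tendsto_pow_atTop_nhds_zero_of_lt_one (by norm_num) (by norm_num), fun a ha haε => ?_⟩
  let f : ℕ → ℝ × Z → Z := fun n p => ρ n p.1 • a n p.2
  have hρs : ∀ n, ContDiff ℝ ∞ fun p : ℝ × Z => ρ n p.1 := fun n =>
    (ρ n).contDiff.comp contDiff_fst
  have has : ∀ n, ContDiff ℝ ∞ fun p : ℝ × Z => a n p.2 := fun n => (ha n).comp contDiff_snd
  have hf : ∀ n, ContDiff ℝ ∞ (f n) := fun n => (hρs n).smul (has n)
  have hfb : ∀ n, ∀ k ≤ n, ∀ p, ‖iteratedFDeriv ℝ k (f n) p‖ ≤ (1 / 2) ^ n := by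
    intro n k hk p
    refine (norm_iteratedFDeriv_smul_le (hρs n) (has n) p (n := k)
      (by exact_mod_cast le_top)).trans ?_
    have h1 : ∀ i ≤ k, ‖iteratedFDeriv ℝ i (fun p : ℝ × Z => ρ n p.1) p‖ ≤ C n := by
      intro i hi
      refine le_trans ?_ (hC n i (hi.trans hk) p.1)
      have := (ContinuousLinearMap.fst ℝ ℝ Z).iteratedFDeriv_comp_right (n := ∞)
        ((ρ n).contDiff) p (i := i) (by exact_mod_cast le_top)
      change ‖iteratedFDeriv ℝ i (ρ n ∘ ContinuousLinearMap.fst ℝ ℝ Z) p‖ ≤ _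
      rw [this]
      refine (ContinuousMultilinearMap.norm_compContinuousLinearMap_le _ _).trans
        (mul_le_of_le_one_right (norm_nonneg _) ?_)
      exact Finset.prod_le_one (fun _ _ => norm_nonneg _)
        fun _ _ => ContinuousLinearMap.norm_fst_le ℝ ℝ Z
    have h2 : ∀ i ≤ k, ‖iteratedFDeriv ℝ i (fun p : ℝ × Z => a n p.2) p‖ ≤ (1 / 4) ^ n / C n := by
      intro i hi
      refine le_trans ?_ (haε n i (hi.trans hk) p.2)
      have := (ContinuousLinearMap.snd ℝ ℝ Z).iteratedFDeriv_comp_right (n := ∞)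
        (ha n) p (i := i) (by exact_mod_cast le_top)
      change ‖iteratedFDeriv ℝ i (a n ∘ ContinuousLinearMap.snd ℝ ℝ Z) p‖ ≤ _
      rw [this]
      refine (ContinuousMultilinearMap.norm_compContinuousLinearMap_le _ _).trans
        (mul_le_of_le_one_right (norm_nonneg _) ?_)
      exact Finset.prod_le_one (fun _ _ => norm_nonneg _)
        fun _ _ => ContinuousLinearMap.norm_snd_le ℝ ℝ Z
    calc ∑ i ∈ Finset.range (k + 1), (k.choose i : ℝ) *
          ‖iteratedFDeriv ℝ i (fun p : ℝ × Z => ρ n p.1) p‖ *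
          ‖iteratedFDeriv ℝ (k - i) (fun p : ℝ × Z => a n p.2) p‖
        ≤ ∑ i ∈ Finset.range (k + 1), (k.choose i : ℝ) * C n * ((1 / 4) ^ n / C n) := by
          refine Finset.sum_le_sum fun i hi => ?_
          have hi' : i ≤ k := Nat.lt_succ_iff.1 (Finset.mem_range.1 hi)
          have := (hC0 n).le
          gcongr
          · exact h1 i hi'
          · exact h2 _ (Nat.sub_le _ _)
      _ = 2 ^ k * (1 / 4) ^ n := by
          rw [← Finset.sum_mul, ← Finset.sum_mul]
          have : (∑ i ∈ Finset.range (k + 1), (k.choose i : ℝ)) = 2 ^ k := by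
            exact_mod_cast Nat.sum_range_choose k
          rw [this]
          field_simp [(hC0 n).ne']
      _ ≤ 2 ^ n * (1 / 4) ^ n := by
          gcongr
          norm_num
      _ = (1 / 2) ^ n := by rw [← mul_pow]; norm_num
  refine ⟨fun p => ∑' n, f n p, ?_, fun n x => ?_, fun x hx t => ?_, fun x => ?_⟩
  · refine contDiff_tsum_of_eventually (v := fun _ n => (1 / 2) ^ n) hf
      (fun k _ => summable_geometric_of_lt_one (by norm_num) (by norm_num)) fun k _ => ?_
    rw [Nat.cofinite_eq_atTop]
    filter_upwards [Filter.eventually_ge_atTop k] with n hn p using hfb n k hn p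
  · change ∑' j, f j ((1 / 2) ^ n, x) = a n x
    rw [tsum_eq_single n]
    · simp only [f]
      rw [hρ1, one_smul]
    · intro j hj
      simp only [f]
      rw [hρne j n hj.symm, zero_smul]
  · simp [f, hx]
  · simp [f, hρ0]

/-- A functional which maps smooth one-parameter families to smooth families is continuous at zero
in the `C^∞` topologies. -/
theorem exists_forall_iteratedFDeriv_lt {Z W G E : Type} [NormedAddCommGroup Z] [NormedSpace ℝ Z]
    [CompleteSpace Z]
    [NormedAddCommGroup W] [NormedSpace ℝ W] [NormedAddCommGroup G] [NormedSpace ℝ G]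
    [NormedAddCommGroup E] [NormedSpace ℝ E] {T : (Z → Z) → W → G} {s : Set Z}
    (hT : ∀ A : ℝ × Z → Z, ContDiff ℝ ∞ A → (∀ x ∉ s, ∀ t, A (t, x) = 0) → (∀ x, A (0, x) = 0) →
      ∃ J : Set ℝ, IsOpen J ∧ (0 : ℝ) ∈ J ∧
        ContDiffOn ℝ ∞ (fun p : ℝ × W => T (fun x => A (p.1, x)) p.2) (J ×ˢ univ))
    (hT0 : ∀ w, T (fun _ => 0) w = 0) {g : E → W} {O : Set E} (hO : IsOpen O)
    (hg : ContDiffOn ℝ ∞ g O) {K : Set E} (hK : IsCompact K) (hKO : K ⊆ O) (r : ℕ) {ε : ℝ}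
    (hε : 0 < ε) :
    ∃ (n : ℕ) (η : ℝ), 0 < η ∧ ∀ a : Z → Z, ContDiff ℝ ∞ a → (∀ x ∉ s, a x = 0) →
      (∀ k ≤ n, ∀ x, ‖iteratedFDeriv ℝ k a x‖ ≤ η) →
      ∀ k ≤ r, ∀ z ∈ K, ‖iteratedFDeriv ℝ k (fun z => T a (g z)) z‖ < ε := by
  obtain ⟨η, l, hη, hl, hcurve⟩ := exists_special_curve Z
  -- a sequence of counterexamples that converges fast enough lies on a smooth curve through `0`
  by_contra! hcon
  choose a ha has haη hbad using fun n => hcon n (η n) (hη n)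
  obtain ⟨A, hA, hAa, hAs, hA0⟩ := hcurve a ha haη
  obtain ⟨J, hJ, h0J, hTA⟩ := hT A hA (fun x hx t => hAs x (fun n => has n x hx) t) hA0
  have hF : ContDiffOn ℝ ∞ (fun p : ℝ × E => T (fun x => A (p.1, x)) (g p.2)) (J ×ˢ O) :=
    hTA.comp (f := fun p : ℝ × E => (p.1, g p.2))
      (contDiffOn_fst.prodMk (hg.comp contDiffOn_snd fun p hp => hp.2)) fun p hp => ⟨hp.1, trivial⟩
  have hev : ∀ᶠ t in 𝓝 (0 : ℝ), ∀ k ∈ Iic r, ∀ z ∈ K,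
      ‖iteratedFDeriv ℝ k (fun z => T (fun x => A (t, x)) (g z)) z‖ < ε := by
    rw [Filter.eventually_all_finite (finite_Iic r)]
    intro k _
    refine hK.eventually_forall_of_forall_eventually fun z hz => ?_
    have h1 := (continuousOn_iteratedFDeriv_param (hJ.prod hO) k hF).continuousAt
      ((hJ.prod hO).mem_nhds (show ((0 : ℝ), z) ∈ J ×ˢ O from ⟨h0J, hKO hz⟩))
    refine h1.norm.eventually_lt continuousAt_const ?_
    have h2 : (fun z => T (fun x => A (0, x)) (g z)) = fun _ => 0 := by
      funext z
      simp only [hA0]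
      exact hT0 _
    simp only [h2]
    simpa using hε
  obtain ⟨n, hn⟩ := (hl.eventually hev).exists
  obtain ⟨k, hk, z, hz, hlt⟩ := hbad n
  have h3 : (fun x => A (l n, x)) = a n := funext (hAa n)
  have h4 := hn k hk z hz
  rw [h3] at h4
  exact absurd h4 (not_lt.2 hlt)

end SpecialCurve

/-! ### Perturbations of the identity -/

section PerturbedIdentity

variable {Z : Type} [NormedAddCommGroup Z] [NormedSpace ℝ Z]

/-- The inverse of the perturbation `x ↦ x + κ a(x)` of the identity. -/
noncomputable def perturbInv (a : Z → Z) (κ : ℝ) : Z → Z := Function.invFun fun x => x + κ • a x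

theorem injective_add_smul {a : Z → Z} (ha : Differentiable ℝ a)
    (hb : ∀ x, ‖fderiv ℝ a x‖ ≤ 1 / 4) {κ : ℝ} (hκ : |κ| < 2) :
    Function.Injective fun x => x + κ • a x := by
  intro x y hxy
  have h1 : ‖a x - a y‖ ≤ 1 / 4 * ‖x - y‖ :=
    convex_univ.norm_image_sub_le_of_norm_fderiv_le (fun z _ => ha z) (fun z _ => hb z)
      (mem_univ y) (mem_univ x)
  have h2 : x - y = -(κ • (a x - a y)) := by
    have h3 : x + κ • a x = y + κ • a y := hxy
    rw [smul_sub]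
    refine eq_neg_of_add_eq_zero_left ?_
    rw [← sub_eq_zero.2 h3]
    abel
  have h3 : ‖x - y‖ ≤ 2 * (1 / 4 * ‖x - y‖) := by
    calc ‖x - y‖ = |κ| * ‖a x - a y‖ := by
          conv_lhs => rw [h2]
          rw [norm_neg, norm_smul, Real.norm_eq_abs]
      _ ≤ 2 * (1 / 4 * ‖x - y‖) := by gcongr
  have h4 : ‖x - y‖ = 0 := le_antisymm (by linarith) (norm_nonneg _)
  exact sub_eq_zero.1 (norm_eq_zero.1 h4)

theorem surjective_add_smul [CompleteSpace Z] {a : Z → Z} (ha : Differentiable ℝ a)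
    (hb : ∀ x, ‖fderiv ℝ a x‖ ≤ 1 / 4) {κ : ℝ} (hκ : |κ| < 2) :
    Function.Surjective fun x => x + κ • a x := by
  intro y
  have hc : ContractingWith (1 / 2) fun x => y - κ • a x := by
    refine ⟨by rw [← NNReal.coe_lt_coe]; norm_num, LipschitzWith.of_dist_le_mul fun x z => ?_⟩
    have h1 : ‖a x - a z‖ ≤ 1 / 4 * ‖x - z‖ :=
      convex_univ.norm_image_sub_le_of_norm_fderiv_le (fun z _ => ha z) (fun z _ => hb z)
        (mem_univ z) (mem_univ x)
    rw [dist_eq_norm, dist_eq_norm, sub_sub_sub_cancel_left, ← smul_sub, norm_smul,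
      Real.norm_eq_abs, norm_sub_rev (a z)]
    calc |κ| * ‖a x - a z‖ ≤ 2 * (1 / 4 * ‖x - z‖) := by gcongr
      _ = _ := by push_cast; ring
  refine ⟨ContractingWith.fixedPoint _ hc, ?_⟩
  have := hc.fixedPoint_isFixedPt
  rw [Function.IsFixedPt] at this
  simp only
  nth_rewrite 1 [← this]
  abel

theorem perturbInv_eq_iff [CompleteSpace Z] {a : Z → Z} (ha : Differentiable ℝ a)
    (hb : ∀ x, ‖fderiv ℝ a x‖ ≤ 1 / 4) {κ : ℝ} (hκ : |κ| < 2) {x y : Z} :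
    perturbInv a κ y = x ↔ x + κ • a x = y := by
  have hi := injective_add_smul ha hb hκ
  have h1 : (fun x => x + κ • a x) (perturbInv a κ y) = y :=
    Function.invFun_eq (surjective_add_smul ha hb hκ y)
  constructor
  · rintro rfl
    exact h1
  · intro h
    exact hi (h1.trans h.symm)

theorem injective_id_add_smul {D : Z →L[ℝ] Z} (hD : ‖D‖ ≤ 1 / 4) {κ : ℝ} (hκ : |κ| < 2) {u : Z}
    (hu : u + κ • D u = 0) : u = 0 := by
  have h1 : ‖u‖ ≤ 2 * (1 / 4 * ‖u‖) := by
    calc ‖u‖ = |κ| * ‖D u‖ := by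
          conv_lhs => rw [eq_neg_of_add_eq_zero_left hu]
          rw [norm_neg, norm_smul, Real.norm_eq_abs]
      _ ≤ 2 * (1 / 4 * ‖u‖) := by
          gcongr
          exact D.le_of_opNorm_le hD u
  exact norm_eq_zero.1 (le_antisymm (by linarith) (norm_nonneg _))

variable [FiniteDimensional ℝ Z]

/-- The inverses of a smooth family of perturbations of the identity depend smoothly on all
variables. -/
theorem contDiffOn_perturbInv {A : ℝ × Z → Z} (hA : ContDiff ℝ ∞ A) {J : Set ℝ} (hJ : IsOpen J)
    (hb : ∀ t ∈ J, ∀ x, ‖fderiv ℝ (fun x => A (t, x)) x‖ ≤ 1 / 4) :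
    ContDiffOn ℝ ∞ (fun p : ℝ × ℝ × Z => perturbInv (fun x => A (p.1, x)) p.2.1 p.2.2)
      (J ×ˢ ({κ : ℝ | |κ| < 2} ×ˢ univ)) := by
  have hAt : ∀ t, Differentiable ℝ fun x => A (t, x) := fun t =>
    (hA.comp (contDiff_prodMk_right t)).differentiable (by simp)
  have hO : IsOpen (J ×ˢ ({κ : ℝ | |κ| < 2} ×ˢ (univ : Set Z))) :=
    hJ.prod ((isOpen_lt continuous_abs continuous_const).prod isOpen_univ)
  rintro ⟨t₀, κ₀, y₀⟩ ⟨ht₀, hκ₀, -⟩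
  refine ContDiffAt.contDiffWithinAt ?_
  simp only [mem_ofPred_eq] at hκ₀ ht₀
  set x₀ := perturbInv (fun x => A (t₀, x)) κ₀ y₀ with hx₀
  have hx₀' : x₀ + κ₀ • A (t₀, x₀) = y₀ := (perturbInv_eq_iff (hAt t₀) (hb t₀ ht₀) hκ₀).1 hx₀.symm
  let Φ : ℝ × ℝ × Z → ℝ × ℝ × Z := fun p => (p.1, p.2.1, p.2.2 + p.2.1 • A (p.1, p.2.2))
  have hΦ : ContDiff ℝ ∞ Φ := by
    have h1 : ContDiff ℝ ∞ fun p : ℝ × ℝ × Z => A (p.1, p.2.2) :=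
      hA.comp (contDiff_fst.prodMk contDiff_snd.snd)
    exact contDiff_fst.prodMk (contDiff_snd.fst.prodMk
      (contDiff_snd.snd.add (contDiff_snd.fst.smul h1)))
  have hdA : HasFDerivAt A (fderiv ℝ A (t₀, x₀)) (t₀, x₀) :=
    (hA.differentiable (by simp) _).hasFDerivAt
  have hdAx : fderiv ℝ (fun x => A (t₀, x)) x₀ =
      (fderiv ℝ A (t₀, x₀)).comp (ContinuousLinearMap.inr ℝ ℝ Z) :=
    (hdA.comp x₀ (hasFDerivAt_prodMk_right t₀ x₀)).fderiv
  have hΦd := (hΦ.differentiable (by simp) (t₀, κ₀, x₀)).hasFDerivAt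
  set L := fderiv ℝ Φ (t₀, κ₀, x₀)
  have hL : ∀ u : ℝ × ℝ × Z, L u = (u.1, u.2.1,
      u.2.2 + (κ₀ • fderiv ℝ A (t₀, x₀) (u.1, u.2.2) + u.2.1 • A (t₀, x₀))) := by
    intro u
    have h1 : HasFDerivAt (fun p : ℝ × ℝ × Z => p.1) (ContinuousLinearMap.fst ℝ ℝ (ℝ × Z))
      (t₀, κ₀, x₀) := hasFDerivAt_fst
    have h2 : HasFDerivAt (fun p : ℝ × ℝ × Z => p.2.1) _ (t₀, κ₀, x₀) :=
      (hasFDerivAt_fst (𝕜 := ℝ) (E := ℝ) (F := Z)).comp (t₀, κ₀, x₀) hasFDerivAt_snd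
    have h3 : HasFDerivAt (fun p : ℝ × ℝ × Z => p.2.2) _ (t₀, κ₀, x₀) :=
      (hasFDerivAt_snd (𝕜 := ℝ) (E := ℝ) (F := Z)).comp (t₀, κ₀, x₀) hasFDerivAt_snd
    have h4 : HasFDerivAt (fun p : ℝ × ℝ × Z => A (p.1, p.2.2)) _ (t₀, κ₀, x₀) :=
      hdA.comp (t₀, κ₀, x₀) (h1.prodMk h3)
    have h5 : HasFDerivAt Φ _ (t₀, κ₀, x₀) := h1.prodMk (h2.prodMk (h3.add (h2.smul h4)))
    rw [show L = _ from hΦd.unique h5]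
    rfl
  have hLinj : Function.Injective L := by
    rw [injective_iff_map_eq_zero]
    rintro ⟨τ, k, u⟩ hu
    rw [hL] at hu
    simp only [Prod.mk_eq_zero] at hu
    obtain ⟨rfl, rfl, hu⟩ := hu
    rw [zero_smul, add_zero] at hu
    have h1 := injective_id_add_smul (hb t₀ ht₀ x₀) hκ₀ (u := u) (by rw [hdAx]; exact hu)
    rw [h1]
    rfl
  let Le : (ℝ × ℝ × Z) ≃L[ℝ] (ℝ × ℝ × Z) :=
    (LinearEquiv.ofInjectiveEndo L.toLinearMap hLinj).toContinuousLinearEquiv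
  have hΦd' : HasFDerivAt Φ (Le : (ℝ × ℝ × Z) →L[ℝ] (ℝ × ℝ × Z)) (t₀, κ₀, x₀) :=
    hΦd.congr_fderiv (ContinuousLinearMap.ext fun u => rfl)
  obtain ⟨φ, hφ0, -, hφ, hφs⟩ := exists_openPartialHomeomorph_contDiffOn_symm isOpen_univ
    hΦ.contDiffOn (mem_univ _) hΦd'
  have hy : (t₀, κ₀, y₀) ∈ φ.target := by
    have := φ.map_source hφ0
    rwa [hφ, show Φ (t₀, κ₀, x₀) = (t₀, κ₀, y₀) by simp only [Φ, hx₀']] at this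
  have hsm : ContDiffAt ℝ ∞ (fun p => (φ.symm p).2.2) (t₀, κ₀, y₀) :=
    contDiff_snd.snd.contDiffAt.comp _ (hφs.contDiffAt (φ.open_target.mem_nhds hy))
  refine hsm.congr_of_eventuallyEq ?_
  filter_upwards [φ.open_target.mem_nhds hy, hO.mem_nhds ⟨ht₀, hκ₀, mem_univ y₀⟩]
    with ⟨t, κ, y⟩ hp hpO
  have h1 := φ.right_inv hp
  rw [hφ] at h1
  simp only [Φ, Prod.mk.injEq] at h1
  simp only
  rw [perturbInv_eq_iff (hAt t) (hb t hpO.1) hpO.2.1]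
  obtain ⟨h2, h3, h4⟩ := h1
  rw [h2, h3] at h4
  exact h4

end PerturbedIdentity

/-! ### Generating functions of symplectic maps -/

section GeneratingFunction

variable {Z : Type} [NormedAddCommGroup Z] [NormedSpace ℝ Z]

/-- The 1-form whose primitive is the generating function, of midpoint type, of the symplectic map
`x ↦ x + a(x)`; it is read at the point `x` instead of the midpoint `x + a(x) / 2`. -/
noncomputable def genForm (ωZ : Z →L[ℝ] Z →L[ℝ] ℝ) (a : Z → Z) (x : Z) : Z →L[ℝ] ℝ :=
  (ωZ (a x)).comp (ContinuousLinearMap.id ℝ Z + (1 / 2 : ℝ) • fderiv ℝ a x)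

/-- The generating function of `x ↦ x + a(x)`, up to a constant. -/
noncomputable def genFun (ωZ : Z →L[ℝ] Z →L[ℝ] ℝ) (a : Z → Z) (x : Z) : ℝ :=
  ∫ s in (0 : ℝ)..1, genForm ωZ a (s • x) x

theorem genForm_apply (ωZ : Z →L[ℝ] Z →L[ℝ] ℝ) (a : Z → Z) (x v : Z) :
    genForm ωZ a x v = ωZ (a x) (v + (1 / 2 : ℝ) • fderiv ℝ a x v) := rfl

theorem genFun_zero (ωZ : Z →L[ℝ] Z →L[ℝ] ℝ) (x : Z) : genFun ωZ (fun _ => 0) x = 0 := by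
  simp [genFun, genForm_apply]

theorem contDiff_genForm (ωZ : Z →L[ℝ] Z →L[ℝ] ℝ) {a : Z → Z} (ha : ContDiff ℝ ∞ a) :
    ContDiff ℝ ∞ (genForm ωZ a) :=
  (ωZ.contDiff.comp ha).clm_comp
    (contDiff_const.add ((ha.fderiv_right (m := ∞) (by simp)).const_smul (1 / 2 : ℝ)))

/-- The generating function depends smoothly on the map: it sends smooth families to smooth
families. -/
theorem contDiff_genFun_family (ωZ : Z →L[ℝ] Z →L[ℝ] ℝ) {A : ℝ × Z → Z} (hA : ContDiff ℝ ∞ A) :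
    ContDiff ℝ ∞ fun p : ℝ × Z => genFun ωZ (fun x => A (p.1, x)) p.2 := by
  let f : ℝ × (ℝ × Z) → ℝ := fun q => ωZ (A (q.2.1, q.1 • q.2.2))
    (q.2.2 + (1 / 2 : ℝ) • fderiv ℝ A (q.2.1, q.1 • q.2.2) (0, q.2.2))
  have hx : ContDiff ℝ ∞ fun q : ℝ × (ℝ × Z) => q.2.2 := contDiff_snd.snd
  have hg : ContDiff ℝ ∞ fun q : ℝ × (ℝ × Z) => (q.2.1, q.1 • q.2.2) :=
    contDiff_snd.fst.prodMk (contDiff_fst.smul hx)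
  have hf : ContDiff ℝ ∞ f := by
    refine (ωZ.contDiff.comp (hA.comp hg)).clm_apply (hx.add (contDiff_const.smul ?_))
    exact ((hA.fderiv_right (m := ∞) (by simp)).comp hg).clm_apply (contDiff_const.prodMk hx)
  have h1 := (contDiff_integral_param hf).1
  convert h1 using 2 with p
  refine intervalIntegral.integral_congr fun s _ => ?_
  have h2 : fderiv ℝ (fun x => A (p.1, x)) (s • p.2) =
      (fderiv ℝ A (p.1, s • p.2)).comp (ContinuousLinearMap.inr ℝ ℝ Z) :=
    ((hA.differentiable (by simp) _).hasFDerivAt.comp _ (hasFDerivAt_prodMk_right _ _)).fderiv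
  simp only [genForm_apply, h2]
  rfl

/-- The symplecticity of `x ↦ x + a(x)` makes the form `genForm ωZ a` closed. -/
theorem hasFDerivAt_genFun {ωZ : Z →L[ℝ] Z →L[ℝ] ℝ} (hω : ∀ v w, ωZ v w = - ωZ w v) {a : Z → Z}
    (ha : ContDiff ℝ ∞ a)
    (hsymp : ∀ x u v, ωZ (u + fderiv ℝ a x u) (v + fderiv ℝ a x v) = ωZ u v) (x : Z) :
    HasFDerivAt (genFun ωZ a) (genForm ωZ a x) x := by
  have hα := contDiff_genForm ωZ ha
  have had : ∀ x, HasFDerivAt a (fderiv ℝ a x) x := fun x =>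
    (ha.differentiable (by simp) x).hasFDerivAt
  have had2 : ∀ x, HasFDerivAt (fderiv ℝ a) (fderiv ℝ (fderiv ℝ a) x) x := fun x =>
    ((ha.fderiv_right (m := ∞) (by simp)).differentiable (by simp) x).hasFDerivAt
  have key : ∀ x u v, fderiv ℝ (genForm ωZ a) x u v =
      ωZ (fderiv ℝ a x u) (v + (1 / 2 : ℝ) • fderiv ℝ a x v) +
        (1 / 2) * ωZ (a x) (fderiv ℝ (fderiv ℝ a) x u v) := by
    intro x u v
    have h1 : HasFDerivAt (fun x => genForm ωZ a x v) _ x :=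
      (hα.differentiable (by simp) x).hasFDerivAt.clm_apply (hasFDerivAt_const v x)
    have h2 : HasFDerivAt (fun x => ωZ (a x) (v + (1 / 2 : ℝ) • fderiv ℝ a x v)) _ x :=
      (ωZ.hasFDerivAt.comp x (had x)).clm_apply
        ((((had2 x).clm_apply (hasFDerivAt_const v x)).const_smul (1 / 2 : ℝ)).const_add v)
    have h3 := congrArg (fun L => L u) (h1.unique h2)
    simp at h3
    rw [h3]
    simp
    ring
  -- the exterior derivative of `genForm ωZ a` is the defect of symplecticity of `x ↦ x + a(x)`,
  -- because the second derivatives of `a` cancel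
  obtain ⟨G, hG⟩ := convex_univ.exists_forall_hasFDerivAt_of_fderiv_symmetric isOpen_univ
    (hα.differentiable (by simp)).differentiableOn (fun x _ u v => by
      have hs : fderiv ℝ (fderiv ℝ a) x u v = fderiv ℝ (fderiv ℝ a) x v u :=
        (ha.contDiffAt.isSymmSndFDerivAt (by
          rw [minSmoothness_of_isRCLikeNormedField]
          exact WithTop.coe_le_coe.2 (le_top : (2 : ℕ∞) ≤ ⊤))).eq u v
      rw [key, key, hs]
      have h1 := hsymp x u v
      have h2 := hω (fderiv ℝ a x v) u
      have h3 := hω (fderiv ℝ a x v) (fderiv ℝ a x u)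
      simp only [map_add, add_apply, map_smul, smul_eq_mul] at h1 ⊢
      rw [h2, h3]
      linarith)
  have hGS : ∀ x, genFun ωZ a x = G x - G 0 := by
    intro x
    have h1 : ∀ s ∈ uIcc (0 : ℝ) 1, HasDerivAt (fun s => G (s • x)) (genForm ωZ a (s • x) x) s := by
      intro s _
      have h2 : HasDerivAt (fun s : ℝ => s • x) x s := by
        simpa using (hasDerivAt_id s).smul_const x
      exact (hG (s • x) trivial).comp_hasDerivAt s h2
    have h3 := intervalIntegral.integral_eq_sub_of_hasDerivAt h1 (by
      refine Continuous.intervalIntegrable ?_ _ _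
      exact (hα.continuous.comp (by fun_prop)).clm_apply continuous_const)
    simpa [genFun] using h3
  have h4 : genFun ωZ a = fun x => G x - G 0 := funext hGS
  rw [h4]
  exact (hG x trivial).sub_const _

theorem isPreconnected_compl_closedBall_zero (hrank : 1 < Module.rank ℝ Z) {r : ℝ} (hr : 0 < r) :
    IsPreconnected {x : Z | r < ‖x‖} := by
  have h1 := (isConnected_compl_singleton_of_one_lt_rank hrank (0 : Z)).isPreconnected
  have hc : ContinuousOn (fun v : Z => (1 + r / ‖v‖) • v) {0}ᶜ := by
    refine ContinuousOn.smul (continuousOn_const.add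
      (continuousOn_const.div continuous_norm.continuousOn ?_)) continuousOn_id
    intro v hv
    exact norm_ne_zero_iff.2 hv
  convert h1.image _ hc using 1
  ext x
  constructor
  · intro hx
    have hx' : r < ‖x‖ := hx
    have hx0 : 0 < ‖x‖ := hr.trans hx'
    have h2 : 0 < 1 - r / ‖x‖ := by
      rw [sub_pos, div_lt_one hx0]
      exact hx'
    refine ⟨(1 - r / ‖x‖) • x, ?_, ?_⟩
    · exact smul_ne_zero h2.ne' (norm_pos_iff.1 hx0)
    · simp only
      rw [norm_smul, Real.norm_of_nonneg h2.le, smul_smul]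
      have h3 : ‖x‖ - r ≠ 0 := (sub_pos.2 hx').ne'
      have h4 : (1 + r / ((1 - r / ‖x‖) * ‖x‖)) * (1 - r / ‖x‖) = 1 := by
        have h5 : (1 - r / ‖x‖) * ‖x‖ = ‖x‖ - r := by field_simp
        rw [h5]
        field_simp
        ring
      rw [h4, one_smul]
  · rintro ⟨v, hv, rfl⟩
    have hv0 : 0 < ‖v‖ := norm_pos_iff.2 hv
    change r < ‖(1 + r / ‖v‖) • v‖
    rw [norm_smul, Real.norm_of_nonneg (by positivity)]
    have : (1 + r / ‖v‖) * ‖v‖ = ‖v‖ + r := by field_simp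
    linarith

/-- Outside the support of `a` the generating function is constant, because the complement of a ball
is connected in dimension at least two. -/
theorem genFun_eq_of_norm_lt {ωZ : Z →L[ℝ] Z →L[ℝ] ℝ} (hω : ∀ v w, ωZ v w = - ωZ w v) {a : Z → Z}
    (ha : ContDiff ℝ ∞ a)
    (hsymp : ∀ x u v, ωZ (u + fderiv ℝ a x u) (v + fderiv ℝ a x v) = ωZ u v)
    (hrank : 1 < Module.rank ℝ Z) {r : ℝ} (hr : 0 < r) (har : ∀ x, r < ‖x‖ → a x = 0) {x p : Z}
    (hx : r < ‖x‖) (hp : r < ‖p‖) : genFun ωZ a x = genFun ωZ a p := by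
  have hd := hasFDerivAt_genFun hω ha hsymp
  refine IsOpen.is_const_of_fderiv_eq_zero (𝕜 := ℝ) (s := {x : Z | r < ‖x‖})
    (isOpen_lt continuous_const continuous_norm) (isPreconnected_compl_closedBall_zero hrank hr)
    (fun z _ => (hd z).differentiableAt.differentiableWithinAt) (fun z hz => ?_) hx hp
  rw [(hd z).fderiv]
  ext v
  rw [genForm_apply, har z hz]
  simp

end GeneratingFunction

/-! ### The model perturbation -/

section ModelEnergy

variable {m : ℕ} {ωZ : Euc m →L[ℝ] Euc m →L[ℝ] ℝ} {β χ : ℝ → ℝ} {p₀ : Euc m}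

/-- The perturbation of the Hamiltonian `e` on `ℝᵐ⁺²` whose flow realizes the symplectic map
`x ↦ x + a(x)`. The function `β` runs from `0` to `1` and parametrizes the isotopy from the identity
to this map, `χ` is a cut-off function, and `p₀` is a point outside the support of `a`. -/
noncomputable def modelEnergy (ωZ : Euc m →L[ℝ] Euc m →L[ℝ] ℝ) (β χ : ℝ → ℝ) (p₀ : Euc m)
    (a : Euc m → Euc m) (w : Euc (m + 2)) : ℝ :=
  χ (ec w) * (deriv β (tc w) *
    (genFun ωZ a (perturbInv a ((1 + β (tc w)) / 2) (zc w)) - genFun ωZ a p₀))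

theorem modelEnergy_zero (w : Euc (m + 2)) : modelEnergy ωZ β χ p₀ (fun _ => 0) w = 0 := by
  simp [modelEnergy, genFun_zero]

theorem contDiffOn_modelEnergy_family (hβ : ContDiff ℝ ∞ β) (hβI : ∀ t, β t ∈ Icc (0 : ℝ) 1)
    (hχ : ContDiff ℝ ∞ χ) {A : ℝ × Euc m → Euc m} (hA : ContDiff ℝ ∞ A) {J : Set ℝ}
    (hJ : IsOpen J) (hb : ∀ t ∈ J, ∀ x, ‖fderiv ℝ (fun x => A (t, x)) x‖ ≤ 1 / 4) :
    ContDiffOn ℝ ∞ (fun p : ℝ × Euc (m + 2) =>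
      modelEnergy ωZ β χ p₀ (fun x => A (p.1, x)) p.2) (J ×ˢ univ) := by
  have ht : ContDiff ℝ ∞ fun p : ℝ × Euc (m + 2) => tc p.2 := tc.contDiff.comp contDiff_snd
  have he : ContDiff ℝ ∞ fun p : ℝ × Euc (m + 2) => ec p.2 := ec.contDiff.comp contDiff_snd
  have hz : ContDiff ℝ ∞ fun p : ℝ × Euc (m + 2) => zc p.2 := zc.contDiff.comp contDiff_snd
  have hκ : ContDiff ℝ ∞ fun p : ℝ × Euc (m + 2) => (1 + β (tc p.2)) / 2 :=
    (contDiff_const.add (hβ.comp ht)).div_const 2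
  have hβ' : ContDiff ℝ ∞ (deriv β) := (contDiff_infty_iff_deriv.1 hβ).2
  have hX : ContDiffOn ℝ ∞ (fun p : ℝ × Euc (m + 2) =>
      perturbInv (fun x => A (p.1, x)) ((1 + β (tc p.2)) / 2) (zc p.2)) (J ×ˢ univ) := by
    refine (contDiffOn_perturbInv hA hJ hb).comp
      (f := fun p : ℝ × Euc (m + 2) => (p.1, (1 + β (tc p.2)) / 2, zc p.2))
      (contDiff_fst.prodMk (hκ.prodMk hz)).contDiffOn ?_
    rintro p ⟨hp, -⟩
    have h1 := hβI (tc p.2)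
    refine ⟨hp, ?_, trivial⟩
    change |(1 + β (tc p.2)) / 2| < 2
    rw [abs_lt]
    constructor <;> linarith [h1.1, h1.2]
  have hG := contDiff_genFun_family ωZ hA
  have hG1 : ContDiffOn ℝ ∞ (fun p : ℝ × Euc (m + 2) => genFun ωZ (fun x => A (p.1, x))
      (perturbInv (fun x => A (p.1, x)) ((1 + β (tc p.2)) / 2) (zc p.2))) (J ×ˢ univ) :=
    hG.comp_contDiffOn (contDiffOn_fst.prodMk hX)
  have hG2 : ContDiff ℝ ∞ fun p : ℝ × Euc (m + 2) => genFun ωZ (fun x => A (p.1, x)) p₀ :=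
    hG.comp (contDiff_fst.prodMk contDiff_const)
  exact (hχ.comp he).contDiffOn.mul ((hβ'.comp ht).contDiffOn.mul (hG1.sub hG2.contDiffOn))

theorem contDiff_modelEnergy (hβ : ContDiff ℝ ∞ β) (hβI : ∀ t, β t ∈ Icc (0 : ℝ) 1)
    (hχ : ContDiff ℝ ∞ χ) {a : Euc m → Euc m} (ha : ContDiff ℝ ∞ a)
    (hb : ∀ x, ‖fderiv ℝ a x‖ ≤ 1 / 4) : ContDiff ℝ ∞ (modelEnergy ωZ β χ p₀ a) := by
  have h1 := contDiffOn_modelEnergy_family (ωZ := ωZ) (p₀ := p₀) hβ hβI hχ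
    (A := fun p : ℝ × Euc m => a p.2) (ha.comp contDiff_snd) isOpen_univ (fun _ _ => hb)
  rw [univ_prod_univ, contDiffOn_univ] at h1
  exact h1.comp (contDiff_prodMk_right (0 : ℝ))

theorem exists_isOpen_norm_fderiv_le {A : ℝ × Euc m → Euc m} (hA : ContDiff ℝ ∞ A)
    {s : Set (Euc m)} (hs : IsCompact s) (hAs : ∀ x ∉ s, ∀ t, A (t, x) = 0)
    (hA0 : ∀ x, A (0, x) = 0) : ∃ J : Set ℝ, IsOpen J ∧ (0 : ℝ) ∈ J ∧
      ∀ t ∈ J, ∀ x, ‖fderiv ℝ (fun x => A (t, x)) x‖ ≤ 1 / 4 := by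
  have hd : ∀ p : ℝ × Euc m, fderiv ℝ (fun x => A (p.1, x)) p.2 =
      (fderiv ℝ A p).comp (ContinuousLinearMap.inr ℝ ℝ (Euc m)) := fun p =>
    ((hA.differentiable (by simp) _).hasFDerivAt.comp _ (hasFDerivAt_prodMk_right p.1 p.2)).fderiv
  have hc : Continuous fun p : ℝ × Euc m => fderiv ℝ (fun x => A (p.1, x)) p.2 := by
    simp only [hd]
    exact ((hA.continuous_fderiv (by simp))).clm_comp continuous_const
  have hev : ∀ᶠ t in 𝓝 (0 : ℝ), ∀ x ∈ s, ‖fderiv ℝ (fun x => A (t, x)) x‖ ≤ 1 / 4 := by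
    refine hs.eventually_forall_of_forall_eventually fun x _ => ?_
    have h1 := (hc.norm.continuousAt (x := ((0 : ℝ), x))).eventually_lt
      (continuousAt_const (y := (1 / 4 : ℝ))) (by simp [hA0])
    filter_upwards [h1] with p hp using hp.le
  obtain ⟨J, hJs, hJ, h0J⟩ := mem_nhds_iff.1 hev
  refine ⟨J, hJ, h0J, fun t ht x => ?_⟩
  by_cases hx : x ∈ s
  · exact hJs ht x hx
  · have : (fun x => A (t, x)) =ᶠ[𝓝 x] fun _ => 0 := by
      filter_upwards [hs.isClosed.isOpen_compl.mem_nhds hx] with y hy using hAs y hy t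
    rw [this.fderiv_eq]
    simp

/-- The model energy is small, with all its derivatives, when `a` is. -/
theorem exists_forall_modelEnergy_lt (ωZ : Euc m →L[ℝ] Euc m →L[ℝ] ℝ) (p₀ : Euc m)
    (hβ : ContDiff ℝ ∞ β) (hβI : ∀ t, β t ∈ Icc (0 : ℝ) 1) (hχ : ContDiff ℝ ∞ χ)
    {s : Set (Euc m)} (hs : IsCompact s) {E : Type} [NormedAddCommGroup E] [NormedSpace ℝ E]
    {g : E → Euc (m + 2)} {O : Set E} (hO : IsOpen O) (hg : ContDiffOn ℝ ∞ g O) {K : Set E}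
    (hK : IsCompact K) (hKO : K ⊆ O) (r : ℕ) {ε : ℝ} (hε : 0 < ε) :
    ∃ (n : ℕ) (η : ℝ), 0 < η ∧ ∀ a : Euc m → Euc m, ContDiff ℝ ∞ a → (∀ x ∉ s, a x = 0) →
      (∀ k ≤ n, ∀ x, ‖iteratedFDeriv ℝ k a x‖ ≤ η) →
      ∀ k ≤ r, ∀ z ∈ K,
        ‖iteratedFDeriv ℝ k (fun z => modelEnergy ωZ β χ p₀ a (g z)) z‖ < ε := by
  refine exists_forall_iteratedFDeriv_lt (T := modelEnergy ωZ β χ p₀) (fun A hA hAs hA0 => ?_)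
    modelEnergy_zero hO hg hK hKO r hε
  obtain ⟨J, hJ, h0J, hb⟩ := exists_isOpen_norm_fderiv_le hA hs hAs hA0
  exact ⟨J, hJ, h0J, contDiffOn_modelEnergy_family hβ hβI hχ hA hJ hb⟩

end ModelEnergy

section ModelCurve

variable {m : ℕ}

/-- The map `x ↦ x + a(x)` is a small symplectic perturbation of the identity, supported in the
closed ball of radius `r`. -/
structure IsSymplecticPerturbation (ωZ : Euc m →L[ℝ] Euc m →L[ℝ] ℝ) (r : ℝ) (a : Euc m → Euc m) :
    Prop where
  contDiff : ContDiff ℝ ∞ a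
  norm_fderiv_le : ∀ x, ‖fderiv ℝ a x‖ ≤ 1 / 4
  symplectic : ∀ x u v, ωZ (u + fderiv ℝ a x u) (v + fderiv ℝ a x v) = ωZ u v
  eq_zero : ∀ x, r < ‖x‖ → a x = 0

/-- `β` is smooth and goes from `0` to `1` in the interval `[-δ, δ]`. -/
structure IsRamp (δ : ℝ) (β : ℝ → ℝ) : Prop where
  contDiff : ContDiff ℝ ∞ β
  mem_Icc : ∀ t, β t ∈ Icc (0 : ℝ) 1
  eq_zero : ∀ t ≤ -δ, β t = 0
  eq_one : ∀ t, δ ≤ t → β t = 1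

theorem IsRamp.deriv_eq_zero {δ : ℝ} {β : ℝ → ℝ} (hβ : IsRamp δ β) {t : ℝ} (ht : δ < |t|) :
    deriv β t = 0 := by
  rcases lt_abs.1 ht with h | h
  · have : β =ᶠ[𝓝 t] fun _ => 1 := by
      filter_upwards [lt_mem_nhds h] with s hs using hβ.eq_one s hs.le
    simp [this.deriv_eq]
  · have : β =ᶠ[𝓝 t] fun _ => 0 := by
      filter_upwards [gt_mem_nhds (lt_neg_of_lt_neg h)] with s hs using hβ.eq_zero s hs.le
    simp [this.deriv_eq]

theorem exists_isRamp {δ : ℝ} (hδ : 0 < δ) : ∃ β : ℝ → ℝ, IsRamp δ β := by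
  refine ⟨fun t => Real.smoothTransition ((t + δ) / (2 * δ)), ?_, fun t =>
    ⟨Real.smoothTransition.nonneg _, Real.smoothTransition.le_one _⟩, fun t ht => ?_, fun t ht => ?_⟩
  · exact Real.smoothTransition.contDiff.comp ((contDiff_id.add contDiff_const).div_const _)
  · exact Real.smoothTransition.zero_of_nonpos
      (div_nonpos_of_nonpos_of_nonneg (by linarith) (by linarith))
  · exact Real.smoothTransition.one_of_one_le ((one_le_div (by linarith)).2 (by linarith))

theorem exists_cutoff {ε : ℝ} (hε : 0 < ε) : ∃ χ : ℝ → ℝ, ContDiff ℝ ∞ χ ∧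
    (∀ e, |e| ≤ ε / 2 → χ e = 1) ∧ ∀ e, ε ≤ |e| → χ e = 0 := by
  let f : ContDiffBump (0 : ℝ) := ⟨ε / 2, ε, by linarith, by linarith⟩
  refine ⟨f, f.contDiff, fun e he => f.one_of_mem_closedBall (by simpa using he), fun e he =>
    f.zero_of_le_dist (by simpa using he)⟩

/-- The point `x` with `x + (1 - β t) / 2 • a x = q`. As
`β t` goes from `0` to `1`, the point `x + (1 + β t) / 2 • a x` moves from `q` to `q + a q`. -/
noncomputable def modelBase (β : ℝ → ℝ) (a : Euc m → Euc m) (q : Euc m) (t : ℝ) : Euc m :=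
  perturbInv a ((1 - β t) / 2) q

/-- The integral curve of the model Hamiltonian `e + modelEnergy` that starts at `q`. Its energy
coordinate makes up for the value of `modelEnergy`, so that the total energy is zero. -/
noncomputable def modelCurve (ωZ : Euc m →L[ℝ] Euc m →L[ℝ] ℝ) (β : ℝ → ℝ) (p₀ : Euc m)
    (a : Euc m → Euc m) (q : Euc m) (t : ℝ) : Euc (m + 2) :=
  zIncl (modelBase β a q t + ((1 + β t) / 2) • a (modelBase β a q t)) + t • tVec -
    (deriv β t * (genFun ωZ a (modelBase β a q t) - genFun ωZ a p₀)) • eVec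

variable {ωZ : Euc m →L[ℝ] Euc m →L[ℝ] ℝ} {β χ : ℝ → ℝ} {p₀ q : Euc m} {a : Euc m → Euc m}
  {r δ ε t : ℝ}

@[simp] theorem zc_modelCurve : zc (modelCurve ωZ β p₀ a q t) =
    modelBase β a q t + ((1 + β t) / 2) • a (modelBase β a q t) := by simp [modelCurve]

@[simp] theorem tc_modelCurve : tc (modelCurve ωZ β p₀ a q t) = t := by simp [modelCurve]

@[simp] theorem ec_modelCurve : ec (modelCurve ωZ β p₀ a q t) =
    -(deriv β t * (genFun ωZ a (modelBase β a q t) - genFun ωZ a p₀)) := by simp [modelCurve]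

theorem IsRamp.abs_add_lt (hβ : IsRamp δ β) (t : ℝ) : |(1 + β t) / 2| < 2 := by
  have := hβ.mem_Icc t
  rw [abs_lt]
  constructor <;> linarith [this.1, this.2]

theorem IsRamp.abs_sub_lt (hβ : IsRamp δ β) (t : ℝ) : |(1 - β t) / 2| < 2 := by
  have := hβ.mem_Icc t
  rw [abs_lt]
  constructor <;> linarith [this.1, this.2]

namespace IsSymplecticPerturbation

theorem differentiable (ha : IsSymplecticPerturbation ωZ r a) : Differentiable ℝ a :=
  ha.contDiff.differentiable (by simp)

theorem perturbInv_eq_self (ha : IsSymplecticPerturbation ωZ r a) {κ : ℝ} (hκ : |κ| < 2) {y : Euc m}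
    (hy : r < ‖y‖) : perturbInv a κ y = y :=
  (perturbInv_eq_iff ha.differentiable ha.norm_fderiv_le hκ).2 (by simp [ha.eq_zero y hy])

theorem modelBase_add (ha : IsSymplecticPerturbation ωZ r a) (hβ : IsRamp δ β) (q : Euc m) (t : ℝ) :
    modelBase β a q t + ((1 - β t) / 2) • a (modelBase β a q t) = q :=
  (perturbInv_eq_iff ha.differentiable ha.norm_fderiv_le (hβ.abs_sub_lt t)).1 rfl

theorem contDiff_modelBase (ha : IsSymplecticPerturbation ωZ r a) (hβ : IsRamp δ β) (q : Euc m) :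
    ContDiff ℝ ∞ (modelBase β a q) := by
  have h1 := contDiffOn_perturbInv (A := fun p : ℝ × Euc m => a p.2) (J := univ)
    (ha.contDiff.comp contDiff_snd) isOpen_univ (fun _ _ => ha.norm_fderiv_le)
  rw [← contDiffOn_univ]
  refine h1.comp (f := fun t => ((0 : ℝ), (1 - β t) / 2, q)) (contDiff_const.prodMk
    (((contDiff_const.sub hβ.contDiff).div_const 2).prodMk contDiff_const)).contDiffOn ?_
  exact fun t _ => ⟨trivial, hβ.abs_sub_lt t, trivial⟩

/-- The model curves that start in the support of `a` stay over it. -/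
theorem norm_zc_modelCurve_le (ha : IsSymplecticPerturbation ωZ r a) (hβ : IsRamp δ β)
    (hq : ‖q‖ ≤ r) : ‖zc (modelCurve ωZ β p₀ a q t)‖ ≤ r := by
  by_contra! h
  have h1 := ha.perturbInv_eq_self (hβ.abs_add_lt t) h
  rw [perturbInv_eq_iff ha.differentiable ha.norm_fderiv_le (hβ.abs_add_lt t)] at h1
  have h2 := injective_add_smul ha.differentiable ha.norm_fderiv_le (hβ.abs_add_lt t)
    (h1.trans zc_modelCurve)
  rw [h2] at h
  have h3 := ha.modelBase_add hβ q t
  rw [ha.eq_zero _ h, smul_zero, add_zero] at h3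
  rw [h3] at h
  exact absurd hq (not_le.2 h)

theorem modelCurve_of_lt (ha : IsSymplecticPerturbation ωZ r a) (hβ : IsRamp δ β) 
    (ht : t < -δ) : modelCurve ωZ β p₀ a q t = zIncl q + t • tVec := by
  have h1 := ha.modelBase_add hβ q t
  have h2 : deriv β t = 0 := hβ.deriv_eq_zero (lt_abs.2 (Or.inr (by linarith)))
  rw [hβ.eq_zero t ht.le, sub_zero] at h1
  rw [modelCurve, h2, hβ.eq_zero t ht.le, add_zero, h1]
  simp

theorem modelCurve_of_gt (ha : IsSymplecticPerturbation ωZ r a) (hβ : IsRamp δ β)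
    (ht : δ < t) : modelCurve ωZ β p₀ a q t = zIncl (q + a q) + t • tVec := by
  have h1 := ha.modelBase_add hβ q t
  have h2 : deriv β t = 0 := hβ.deriv_eq_zero (lt_abs.2 (Or.inl ht))
  rw [hβ.eq_one t ht.le, sub_self, zero_div, zero_smul, add_zero] at h1
  rw [modelCurve, h2, hβ.eq_one t ht.le, h1]
  norm_num

theorem modelEnergy_modelCurve (ha : IsSymplecticPerturbation ωZ r a) (hβ : IsRamp δ β) :
    modelEnergy ωZ β χ p₀ a (modelCurve ωZ β p₀ a q t) = χ (ec (modelCurve ωZ β p₀ a q t)) *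
      (deriv β t * (genFun ωZ a (modelBase β a q t) - genFun ωZ a p₀)) := by
  have h1 : perturbInv a ((1 + β t) / 2) (zc (modelCurve ωZ β p₀ a q t)) = modelBase β a q t :=
    (perturbInv_eq_iff ha.differentiable ha.norm_fderiv_le (hβ.abs_add_lt t)).2 zc_modelCurve.symm
  rw [modelEnergy, tc_modelCurve, h1]

/-- The model curves stay in the region where the cut-off function is `1`. -/
theorem abs_ec_modelCurve_lt (ha : IsSymplecticPerturbation ωZ r a) (hβ : IsRamp δ β) (hε : 0 < ε)
    (hχ : ∀ e, |e| ≤ ε / 2 → χ e = 1) (hM : ∀ w, |modelEnergy ωZ β χ p₀ a w| < ε / 2) :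
    |ec (modelCurve ωZ β p₀ a q t)| < ε / 2 := by
  have h1 := hM (modelCurve ωZ β p₀ a q t - ec (modelCurve ωZ β p₀ a q t) • eVec)
  have h2 : perturbInv a ((1 + β t) / 2) (zc (modelCurve ωZ β p₀ a q t)) = modelBase β a q t :=
    (perturbInv_eq_iff ha.differentiable ha.norm_fderiv_le (hβ.abs_add_lt t)).2 zc_modelCurve.symm
  have h3 : χ 0 = 1 := hχ 0 (by simpa using (half_pos hε).le)
  rw [modelEnergy] at h1
  simp only [map_sub, map_smul, zc_eVec, smul_zero, sub_zero, tc_eVec, ec_eVec, smul_eq_mul,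
    mul_one, sub_self, mul_zero, h2, h3, tc_modelCurve, one_mul] at h1
  rwa [ec_modelCurve, abs_neg]

/-- The support of the model energy is contained in a box. -/
theorem modelEnergy_eq_zero (ha : IsSymplecticPerturbation ωZ r a)
    (hω : ∀ v w, ωZ v w = - ωZ w v) (hm : 2 ≤ m) (hr : 0 < r) (hβ : IsRamp δ β)
    (hχ0 : ∀ e, ε ≤ |e| → χ e = 0) (hp₀ : r < ‖p₀‖) {w : Euc (m + 2)}
    (hw : r < ‖zc w‖ ∨ δ < |tc w| ∨ ε ≤ |ec w|) : modelEnergy ωZ β χ p₀ a w = 0 := by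
  rcases hw with h | h | h
  · have hrank : 1 < Module.rank ℝ (Euc m) := by
      rw [← Module.finrank_eq_rank, finrank_euclideanSpace_fin]
      exact_mod_cast hm
    rw [modelEnergy, ha.perturbInv_eq_self (hβ.abs_add_lt _) h, genFun_eq_of_norm_lt hω ha.contDiff
      ha.symplectic hrank hr ha.eq_zero h hp₀]
    simp
  · simp [modelEnergy, hβ.deriv_eq_zero h]
  · simp [modelEnergy, hχ0 _ h]

/-- The algebraic identity behind the model curve: it compares the differential of the generating
function with the velocity `y'` of the isotopy. -/
theorem form_identity {D : Euc m →L[ℝ] Euc m}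
    (hD : ∀ u v, ωZ (u + D u) (v + D v) = ωZ u v) {b : ℝ} {A p u : Euc m}
    (hp : p + ((1 - b) / 2) • D p = A) :
    2 * ωZ A (u + (1 / 2 : ℝ) • D u) = ωZ (2 • p + D p) (u + ((1 + b) / 2) • D u) := by
  have h1 := hD p u
  subst hp
  simp only [map_add, add_apply, map_smul, smul_apply, smul_eq_mul, two_smul] at h1 ⊢
  linear_combination (-b) * h1

/-- The model curves satisfy Hamilton's equation for `e + modelEnergy`, in the form
`ω(ξ', ·) = d(e + modelEnergy)`. -/
theorem hasDerivAt_modelCurve (ha : IsSymplecticPerturbation ωZ r a)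
    (hω : ∀ v w, ωZ v w = - ωZ w v) (hβ : IsRamp δ β) (hε : 0 < ε) (hχs : ContDiff ℝ ∞ χ)
    (hχ : ∀ e, |e| ≤ ε / 2 → χ e = 1) (hM : ∀ w, |modelEnergy ωZ β χ p₀ a w| < ε / 2)
    (q : Euc m) (t : ℝ) : ∃ ξ' : Euc (m + 2), HasDerivAt (modelCurve ωZ β p₀ a q) ξ' t ∧
      ∀ b, stdForm ωZ ξ' b =
        ec b + fderiv ℝ (modelEnergy ωZ β χ p₀ a) (modelCurve ωZ β p₀ a q t) b := by
  set M := modelEnergy ωZ β χ p₀ a with hMdef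
  set ξ := modelCurve ωZ β p₀ a q with hξ
  set x := modelBase β a q with hx
  have hMs : ContDiff ℝ ∞ M :=
    contDiff_modelEnergy hβ.contDiff hβ.mem_Icc hχs ha.contDiff ha.norm_fderiv_le
  have hMd : HasFDerivAt M (fderiv ℝ M (ξ t)) (ξ t) :=
    (hMs.differentiable (by simp) _).hasFDerivAt
  have hβd : HasDerivAt β (deriv β t) t :=
    (hβ.contDiff.differentiable (by simp) t).hasDerivAt
  have hβd2 : HasDerivAt (deriv β) (deriv (deriv β) t) t :=
    (((contDiff_infty_iff_deriv.1 hβ.contDiff).2).differentiable (by simp) t).hasDerivAt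
  have hxd : HasDerivAt x (deriv x t) t :=
    ((ha.contDiff_modelBase hβ q).differentiable (by simp) t).hasDerivAt
  set p := deriv x t with hp
  have hSd := hasFDerivAt_genFun hω ha.contDiff ha.symplectic
  have had : ∀ z, HasFDerivAt a (fderiv ℝ a z) z := fun z =>
    (ha.differentiable z).hasFDerivAt
  set D := fderiv ℝ a (x t) with hD
  have haxd : HasDerivAt (fun s => a (x s)) (D p) t := (had (x t)).comp_hasDerivAt t hxd
  have hpe : p + ((1 - β t) / 2) • D p = (deriv β t / 2) • a (x t) := by
    have h1 := hxd.add (((hβd.const_sub 1).div_const 2).smul haxd)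
    have h2 : (x + fun s => ((1 - β s) / 2) • a (x s)) = fun _ => q :=
      funext fun s => ha.modelBase_add hβ q s
    have h3 := (h2 ▸ h1).unique (hasDerivAt_const t q)
    have h4 : p + ((1 - β t) / 2) • D p - (deriv β t / 2) • a (x t) = 0 := by
      rw [← h3]
      module
    exact sub_eq_zero.1 h4
  set k : ℝ → ℝ := fun s => deriv β s * (genFun ωZ a (x s) - genFun ωZ a p₀) with hk
  obtain ⟨k', hkd⟩ : ∃ k', HasDerivAt k k' t :=
    ⟨_, hβd2.mul (((hSd (x t)).comp_hasDerivAt t hxd).sub_const _)⟩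
  set y' := 2 • p + D p with hy'
  have hξd : HasDerivAt ξ (zIncl y' + tVec - k' • eVec) t := by
    have h1 : HasDerivAt (fun s => x s + ((1 + β s) / 2) • a (x s)) y' t := by
      refine (hxd.add (((hβd.const_add 1).div_const 2).smul haxd)).congr_deriv (Eq.symm ?_)
      have h2 : y' = p + ((1 + β t) / 2) • D p + (p + ((1 - β t) / 2) • D p) := by
        rw [hy']
        module
      rw [h2, hpe]
      module
    have h2 := ((zIncl.hasFDerivAt.comp_hasDerivAt t h1).add
      ((hasDerivAt_id t).smul_const tVec)).sub (hkd.smul_const eVec)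
    rw [one_smul] at h2
    exact h2
  have hec : ∀ s, ec (ξ s) = - k s := fun s => ec_modelCurve
  have hlt : |ec (ξ t)| < ε / 2 := ha.abs_ec_modelCurve_lt hβ hε hχ hM
  -- near the curve the cut-off function is `1`, hence the derivative along `eVec` vanishes
  have hMe : fderiv ℝ M (ξ t) eVec = 0 := by
    let f : ℝ → Euc (m + 2) := fun s => ξ t + s • eVec
    have h1 : HasDerivAt f eVec 0 := by
      simpa [f] using ((hasDerivAt_id (0 : ℝ)).smul_const eVec).const_add (ξ t)
    have h2 : HasDerivAt (fun s => M (f s)) (fderiv ℝ M (ξ t) eVec) 0 :=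
      (show HasFDerivAt M (fderiv ℝ M (ξ t)) (f 0) by simpa [f] using hMd).comp_hasDerivAt 0 h1
    have h3 : (fun s => M (f s)) =ᶠ[𝓝 0] fun _ => k t := by
      have h4 : ContinuousAt (fun s : ℝ => |ec (ξ t) + s|) 0 := by fun_prop
      filter_upwards [h4.eventually_lt (continuousAt_const (y := ε / 2)) (by simpa using hlt)]
        with s hs
      have h5 := ha.modelEnergy_modelCurve (χ := fun _ => 1) (p₀ := p₀) (q := q) (t := t) hβ
      rw [one_mul, modelEnergy, one_mul] at h5
      rw [hMdef, modelEnergy]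
      simp only [f, map_add, map_smul, zc_eVec, smul_zero, add_zero, tc_eVec, ec_eVec, smul_eq_mul,
        mul_one, mul_zero]
      rw [hχ _ hs.le, one_mul, h5]
    exact h2.unique ((hasDerivAt_const (0 : ℝ) (k t)).congr_of_eventuallyEq h3)
  have hMξ : fderiv ℝ M (ξ t) (zIncl y' + tVec - k' • eVec) = k' := by
    have h2 := hMd.comp_hasDerivAt t hξd
    have h3 : (M ∘ ξ) =ᶠ[𝓝 t] k := by
      have h4 : ContinuousAt (fun s : ℝ => |ec (ξ s)|) t :=
        (ec.continuous.continuousAt.comp hξd.continuousAt).abs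
      filter_upwards [h4.eventually_lt (continuousAt_const (y := ε / 2)) hlt] with s hs
      rw [Function.comp_apply, hMdef, hξ, ha.modelEnergy_modelCurve hβ, hχ _ hs.le, one_mul]
    exact h2.unique (hkd.congr_of_eventuallyEq h3)
  have hMz : ∀ v, fderiv ℝ M (ξ t) (zIncl v) = ωZ y' v := by
    intro v
    have hinj : Function.Injective (ContinuousLinearMap.id ℝ (Euc m) + ((1 + β t) / 2) • D :
        Euc m →L[ℝ] Euc m) := by
      rw [injective_iff_map_eq_zero]
      intro u hu
      exact injective_id_add_smul (ha.norm_fderiv_le (x t)) (hβ.abs_add_lt t) hu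
    obtain ⟨u, hu⟩ := (LinearMap.injective_iff_surjective
      (f := (ContinuousLinearMap.id ℝ (Euc m) + ((1 + β t) / 2) • D : Euc m →L[ℝ] Euc m).toLinearMap)).1
      hinj v
    have hu' : u + ((1 + β t) / 2) • D u = v := hu
    -- differentiate the energy along the images of a line through the base point
    let g : ℝ → Euc m := fun s => x t + s • u
    have hg : HasDerivAt g u 0 := by
      simpa [g] using ((hasDerivAt_id (0 : ℝ)).smul_const u).const_add (x t)
    have hg0 : g 0 = x t := by simp [g]
    have hag : HasDerivAt (fun s => a (g s)) (D u) 0 :=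
      (show HasFDerivAt a D (g 0) by rw [hg0]; exact had (x t)).comp_hasDerivAt 0 hg
    let f : ℝ → Euc (m + 2) := fun s =>
      zIncl (g s + ((1 + β t) / 2) • a (g s)) + (t • tVec - k t • eVec)
    have hf : HasDerivAt f (zIncl v) 0 := by
      have h1 := (hg.add (hag.const_smul ((1 + β t) / 2)))
      rw [hu'] at h1
      exact (zIncl.hasFDerivAt.comp_hasDerivAt 0 h1).add_const _
    have hf0 : f 0 = ξ t := by
      simp only [f, hg0]
      rw [hξ, modelCurve, add_sub_assoc]
    have h2 : HasDerivAt (fun s => M (f s)) (fderiv ℝ M (ξ t) (zIncl v)) 0 :=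
      (show HasFDerivAt M (fderiv ℝ M (ξ t)) (f 0) by rw [hf0]; exact hMd).comp_hasDerivAt 0 hf
    have h3 : (fun s => M (f s)) = fun s => deriv β t * (genFun ωZ a (g s) - genFun ωZ a p₀) := by
      funext s
      have h4 : perturbInv a ((1 + β t) / 2) (g s + ((1 + β t) / 2) • a (g s)) = g s :=
        (perturbInv_eq_iff ha.differentiable ha.norm_fderiv_le (hβ.abs_add_lt t)).2 rfl
      have h5 : χ (-k t) = 1 := hχ _ (by rw [← hec]; exact hlt.le)
      rw [hMdef, modelEnergy]
      simp [f, h4, h5]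
    have h6 : HasDerivAt (fun s => deriv β t * (genFun ωZ a (g s) - genFun ωZ a p₀))
        (deriv β t * genForm ωZ a (x t) u) 0 :=
      (((show HasFDerivAt (genFun ωZ a) (genForm ωZ a (x t)) (g 0) by
        rw [hg0]; exact hSd (x t)).comp_hasDerivAt 0 hg).sub_const _).const_mul _
    have h7 := (h3 ▸ h2).unique h6
    rw [h7, genForm_apply, ← hu', hy', ← form_identity (ha.symplectic (x t)) hpe]
    simp only [map_smul, smul_apply, smul_eq_mul]
    ring
  refine ⟨_, hξd, fun b => ?_⟩
  have hyy : ωZ y' y' = 0 := by linarith [hω y' y']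
  have hMt : fderiv ℝ M (ξ t) tVec = k' := by
    rw [map_sub, map_add, map_smul, hMe, hMz, hyy] at hMξ
    simpa using hMξ
  conv_rhs => rw [← euc_decomp b]
  simp only [map_add, map_smul, hMe, hMz, hMt, stdForm]
  simp
  ring

end IsSymplecticPerturbation
end ModelCurve

/-! ### Perturbed Hamiltonians -/

section PerturbedEnergy

variable {m : ℕ}

/-- The box in the chart domain that contains the support of the perturbation. -/
def coordBox (m : ℕ) (r δ ε : ℝ) : Set (Euc (m + 2)) :=
  {w | ‖zc w‖ ≤ r ∧ |tc w| ≤ δ ∧ |ec w| ≤ ε}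

theorem isCompact_coordBox (r δ ε : ℝ) : IsCompact (coordBox m r δ ε) := by
  have h1 : IsCompact (Metric.closedBall (0 : Euc m) r ×ˢ (Icc (-δ) δ ×ˢ Icc (-ε) ε)) :=
    (isCompact_closedBall _ _).prod (isCompact_Icc.prod isCompact_Icc)
  have h2 : Continuous fun p : Euc m × ℝ × ℝ =>
      (zIncl p.1 + p.2.1 • tVec + p.2.2 • eVec : Euc (m + 2)) := by fun_prop
  convert h1.image h2 using 1
  ext w
  constructor
  · rintro ⟨hz, ht, he⟩
    exact ⟨(zc w, tc w, ec w), ⟨by simpa using hz, abs_le.1 ht, abs_le.1 he⟩, euc_decomp w⟩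
  · rintro ⟨⟨z, t, e⟩, ⟨hz, ht, he⟩, rfl⟩
    exact ⟨by simpa using hz, by simpa using abs_le.2 ht, by simpa using abs_le.2 he⟩

theorem sub_tc_smul_add (w : Euc (m + 2)) : w - tc w • tVec + tc w • tVec = w :=
  sub_add_cancel _ _

variable {Ω : Type*} [TopologicalSpace Ω] {H : Ω → ℝ} {M : Euc (m + 2) → ℝ}
  {c : OpenPartialHomeomorph Ω (Euc (m + 2))} {B : Set (Euc (m + 2))}

/-- The sum of `H` and of the function that is `M` in the chart `c` and `0` outside the domain of
this chart. -/
noncomputable def perturbedEnergy (H : Ω → ℝ) (c : OpenPartialHomeomorph Ω (Euc (m + 2)))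
    (M : Euc (m + 2) → ℝ) (x : Ω) : ℝ :=
  H x + c.source.indicator (fun x => M (c x)) x

theorem perturbedEnergy_of_mem {x : Ω} (hx : x ∈ c.source) :
    perturbedEnergy H c M x = H x + M (c x) := by
  rw [perturbedEnergy, indicator_of_mem hx]

theorem perturbedEnergy_of_notMem (hM : ∀ w ∉ B, M w = 0) {x : Ω} (hx : x ∉ c.symm '' B) :
    perturbedEnergy H c M x = H x := by
  rw [perturbedEnergy]
  by_cases h : x ∈ c.source
  · rw [indicator_of_mem h, hM, add_zero]
    exact fun hB => hx ⟨c x, hB, c.left_inv h⟩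
  · rw [indicator_of_notMem h, add_zero]

theorem perturbedEnergy_eventuallyEq [T2Space Ω] (hB : IsCompact B) (hBc : B ⊆ c.target)
    (hM : ∀ w ∉ B, M w = 0) {x : Ω} (hx : x ∉ c.symm '' B) : perturbedEnergy H c M =ᶠ[𝓝 x] H := by
  have h1 : IsCompact (c.symm '' B) := hB.image_of_continuousOn (c.continuousOn_symm.mono hBc)
  filter_upwards [h1.isClosed.isOpen_compl.mem_nhds hx] with y hy
  exact perturbedEnergy_of_notMem hM hy

theorem slice_perturbedEnergy (hM : ∀ w ∉ B, M w = 0) {S : Set Ω} (hBS : ∀ w ∈ B, c.symm w ∉ S)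
    (h : ℝ) : slice (perturbedEnergy H c M) S h = slice H S h := by
  ext x
  refine and_congr_right fun hx => ?_
  rw [perturbedEnergy_of_notMem hM]
  rintro ⟨w, hw, rfl⟩
  exact hBS w hw hx

variable [ChartedSpace (Euc (m + 2)) Ω] {σ : TwoForm (m + 2) Ω}

theorem contMDiff_perturbedEnergy [T2Space Ω] [IsManifold (𝓡 (m + 2)) ∞ Ω]
    (hH : ContMDiff (𝓡 (m + 2)) 𝓘(ℝ, ℝ) ∞ H)
    (hc : c ∈ IsManifold.maximalAtlas (𝓡 (m + 2)) ∞ Ω) (hMs : ContDiff ℝ ∞ M) (hB : IsCompact B)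
    (hBc : B ⊆ c.target) (hM : ∀ w ∉ B, M w = 0) :
    ContMDiff (𝓡 (m + 2)) 𝓘(ℝ, ℝ) ∞ (perturbedEnergy H c M) := by
  intro x
  by_cases hx : x ∈ c.symm '' B
  · obtain ⟨w, hw, rfl⟩ := hx
    have hxs := c.map_target (hBc hw)
    have h1 : ContMDiffAt (𝓡 (m + 2)) 𝓘(ℝ, ℝ) ∞ (fun x => M (c x)) (c.symm w) :=
      hMs.contMDiff.contMDiffAt.comp _ (contMDiffAt_of_mem_maximalAtlas hc hxs)
    refine ((hH _).add h1).congr_of_eventuallyEq ?_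
    filter_upwards [c.open_source.mem_nhds hxs] with y hy using perturbedEnergy_of_mem hy
  · exact (hH x).congr_of_eventuallyEq (perturbedEnergy_eventuallyEq hB hBc hM hx)

theorem hamiltonianVectorField_congr {H' : Ω → ℝ} {x : Ω} (h : H' =ᶠ[𝓝 x] H) :
    hamiltonianVectorField σ H' x = hamiltonianVectorField σ H x := by
  have h1 : ∀ v : TangentSpace (𝓡 (m + 2)) x, dAt H' x v = dAt H x v := by
    intro v
    simp only [dAt, h.mfderiv_eq]
    rfl
  simp only [hamiltonianVectorField, h1]

/-- Trajectories that avoid the support of the perturbation remain trajectories. -/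
theorem IsMIntegralCurveOn.perturbedEnergy [T2Space Ω] (hB : IsCompact B) (hBc : B ⊆ c.target)
    (hM : ∀ w ∉ B, M w = 0) {γ : ℝ → Ω} {s : Set ℝ}
    (hγ : IsMIntegralCurveOn (I := 𝓡 (m + 2)) γ (hamiltonianVectorField σ H) s)
    (hs : ∀ t ∈ s, γ t ∉ c.symm '' B) :
    IsMIntegralCurveOn (I := 𝓡 (m + 2)) γ
      (hamiltonianVectorField σ (PoincareSection.perturbedEnergy H c M)) s := by
  intro t ht
  rw [hamiltonianVectorField_congr (perturbedEnergy_eventuallyEq hB hBc hM (hs t ht))]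
  exact hγ t ht

theorem IsSection.perturbedEnergy [T2Space Ω] (hB : IsCompact B) (hBc : B ⊆ c.target)
    (hM : ∀ w ∉ B, M w = 0) {S : Set Ω} (hS : IsSection σ H S)
    (hBS : ∀ w ∈ B, c.symm w ∉ S) : IsSection σ (PoincareSection.perturbedEnergy H c M) S := by
  refine ⟨hS.1, fun x hx => ?_⟩
  rw [hamiltonianVectorField_congr (perturbedEnergy_eventuallyEq hB hBc hM ?_)]
  · exact hS.2 x hx
  · rintro ⟨w, hw, rfl⟩
    exact hBS w hw hx

variable {h : ℝ} {ωZ : Euc m →L[ℝ] Euc m →L[ℝ] ℝ}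

/-- Integral curves of the perturbed Hamiltonian, read in a flow chart. -/
theorem IsFlowChart.isMIntegralCurveOn_perturbedEnergy (hσ : IsSymplecticForm σ)
    (hc : IsFlowChart σ H h ωZ c) (hMs : ContDiff ℝ ∞ M)
    (hH' : ContMDiff (𝓡 (m + 2)) 𝓘(ℝ, ℝ) ∞ (perturbedEnergy H c M)) {ξ : ℝ → Euc (m + 2)}
    {s : Set ℝ} (hξ : ∀ t ∈ s, ∃ ξ', HasDerivAt ξ ξ' t ∧
      ∀ b, stdForm ωZ ξ' b = ec b + fderiv ℝ M (ξ t) b) (hξs : ∀ t ∈ s, ξ t ∈ c.target) :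
    IsMIntegralCurveOn (I := 𝓡 (m + 2)) (fun t => c.symm (ξ t))
      (hamiltonianVectorField σ (perturbedEnergy H c M)) s := by
  intro t ht
  obtain ⟨ξ', h1, h2⟩ := hξ t ht
  have hw := hξs t ht
  have h3 := hasMFDerivWithinAt_symm_comp hc.mem h1.hasDerivWithinAt (s := s) hw
  have h4 : HasFDerivAt (fun y => perturbedEnergy H c M (c.symm y)) (ec + fderiv ℝ M (ξ t))
      (ξ t) := by
    refine ((hc.fderiv_energy hw).add
      ((hMs.differentiable (by simp) _).hasFDerivAt)).congr_of_eventuallyEq ?_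
    filter_upwards [c.open_target.mem_nhds hw] with y hy
    rw [perturbedEnergy_of_mem (c.map_target hy), c.right_inv hy]
    rfl
  have h5 := (mfderiv_symm_eq_hamiltonianVectorField_iff hσ hc.mem hw
    (hH'.mdifferentiable (by simp) _) ξ').2 fun b => by
      rw [hc.form _ hw, h2, h4.fderiv]
      rfl
  rw [h5] at h3
  exact h3

end PerturbedEnergy

/-! ### Realization of a perturbed Poincaré map -/

section Realization

variable {m : ℕ} {Ω : Type*} [TopologicalSpace Ω] [ChartedSpace (Euc (m + 2)) Ω]
  {σ : TwoForm (m + 2) Ω} {H : Ω → ℝ} {S₀ S₁ : Set Ω} {τ : Ω → ℝ} {R : Ω → Ω} {h : ℝ}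
  {ωZ : Euc m →L[ℝ] Euc m →L[ℝ] ℝ} {c₀ c c₁ e₀ e₁ : OpenPartialHomeomorph Ω (Euc (m + 2))}
  {r r' δ ε : ℝ}

/-- A flow chart `c` between the two sections, and section charts labelling the trajectories that
run through it. The points labelled by the box of size `r'` in the `z`-coordinates and `ε` in the
energy coordinate pass through `c` in straight lines during the times in `[-2δ, 2δ]`. -/
structure IsPassage (σ : TwoForm (m + 2) Ω) (H : Ω → ℝ) (S₀ S₁ : Set Ω) (τ : Ω → ℝ) (R : Ω → Ω)
    (h : ℝ) (ωZ : Euc m →L[ℝ] Euc m →L[ℝ] ℝ) (c₀ c c₁ e₀ e₁ : OpenPartialHomeomorph Ω (Euc (m + 2)))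
    (r r' δ ε : ℝ) : Prop where
  antisymm : ∀ v w, ωZ v w = - ωZ w v
  flow₀ : IsFlowChart σ H h ωZ c₀
  flow : IsFlowChart σ H h ωZ c
  flow₁ : IsFlowChart σ H h ωZ c₁
  section₀ : IsSectionChart S₀ c₀ e₀
  section₁ : IsSectionChart S₁ c₁ e₁
  r_pos : 0 < r
  r_lt : r < r'
  δ_pos : 0 < δ
  ε_pos : 0 < ε
  passes : ∀ w, ‖zc w‖ < r' → |ec w| ≤ ε → tc w = 0 →
    PassesThrough σ H S₀ S₁ τ R c e₀ e₁ (2 * δ) w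

namespace IsPassage

variable (hP : IsPassage σ H S₀ S₁ τ R h ωZ c₀ c c₁ e₀ e₁ r r' δ ε)
include hP

theorem passes_of_mem {w : Euc (m + 2)} (hw : w ∈ coordBox m r (2 * δ) ε) :
    PassesThrough σ H S₀ S₁ τ R c e₀ e₁ (2 * δ) (w - tc w • tVec) :=
  hP.passes _ (by simpa using hw.1.trans_lt hP.r_lt) (by simpa using hw.2.2) (by simp)

theorem mem_target {w : Euc (m + 2)} (hw : w ∈ coordBox m r (2 * δ) ε) : w ∈ c.target := by
  simpa using (hP.passes_of_mem hw).line_mem _ hw.2.1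

theorem notMem₀ {w : Euc (m + 2)} (hw : w ∈ coordBox m r (2 * δ) ε) : c.symm w ∉ S₀ := by
  simpa using (hP.passes_of_mem hw).line_not_mem₀ _ hw.2.1

theorem notMem₁ {w : Euc (m + 2)} (hw : w ∈ coordBox m r (2 * δ) ε) : c.symm w ∉ S₁ := by
  simpa using (hP.passes_of_mem hw).line_not_mem₁ _ hw.2.1

theorem coordBox_subset : coordBox m r δ ε ⊆ coordBox m r (2 * δ) ε := fun _ hw =>
  ⟨hw.1, hw.2.1.trans (by linarith [hP.δ_pos]), hw.2.2⟩

theorem passes_zIncl {q : Euc m} (hq : ‖q‖ < r') :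
    PassesThrough σ H S₀ S₁ τ R c e₀ e₁ (2 * δ) (zIncl q) :=
  hP.passes _ (by simpa using hq) (by simpa using hP.ε_pos.le) (by simp)

theorem symm_zIncl_mem_slice {q : Euc m} (hq : ‖q‖ < r') :
    e₀.symm (zIncl q) ∈ slice H S₀ h := by
  have h1 := hP.passes_zIncl hq
  refine ⟨h1.mem_section, ?_⟩
  have h2 := e₀.map_target h1.mem_target₀
  rw [hP.flow₀.ec_eq (hP.section₀.source_subset h2), ← hP.section₀.ec_eq _ h2,
    e₀.right_inv h1.mem_target₀]
  simp

variable [IsManifold (𝓡 (m + 2)) ∞ Ω] [T2Space Ω]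

/-- A trajectory on the energy level `h` meets the box only on the line through its own label. -/
theorem label_of_trajectory (hσ : IsSymplecticForm σ) (hH : ContMDiff (𝓡 (m + 2)) 𝓘(ℝ, ℝ) ∞ H)
    (hinj : InjOn R S₀) {x : Ω} (hx : x ∈ slice H S₀ h) {γ : ℝ → Ω}
    (hγ : IsFirstHitAlong σ H S₁ γ x (τ x) (R x)) {t : ℝ} (ht : t ∈ Icc 0 (τ x))
    {w : Euc (m + 2)} (hw : w ∈ coordBox m r (2 * δ) ε) (h : γ t = c.symm w) :
    x = e₀.symm (zIncl (zc w)) := by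
  have hec : ec w = 0 := by
    have h1 := energy_eq_of_trajectory hσ hH hγ.2.1 ht
    rw [hγ.2.2.1, hx.2, h, hP.flow.energy _ (hP.mem_target hw)] at h1
    linarith
  have h0 : w - tc w • tVec = zIncl (zc w) := euc_ext (by simp) (by simp) (by simp [hec])
  have hlt : t < τ x := by
    refine lt_of_le_of_ne ht.2 fun he => hP.notMem₁ hw ?_
    rw [← h, he, hγ.2.2.2.1]
    exact hγ.2.2.2.2.1
  have h1 := hP.passes_of_mem hw
  obtain ⟨η, s, hη, hs, hs', hline⟩ := h1.exists_trajectory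
  have ht' := abs_le.1 hw.2.1
  have h2 := hline (tc w) hw.2.1
  rw [sub_tc_smul_add, ← h] at h2
  rw [← h0]
  exact (hγ.eq_of_meet_of_injOn hσ hH hinj hx.1 h1.mem_section hη ⟨ht.1, hlt⟩
    ⟨by linarith, by linarith⟩ h2.symm).1

/-- A trajectory through the box meets the box only at times near the passage time. -/
theorem time_of_trajectory (hσ : IsSymplecticForm σ) (hH : ContMDiff (𝓡 (m + 2)) 𝓘(ℝ, ℝ) ∞ H)
    (hinj : InjOn R S₀) {q : Euc m} (hq : ‖q‖ < r') {γ : ℝ → Ω} {s : ℝ}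
    (hγ : IsFirstHitAlong σ H S₁ γ (e₀.symm (zIncl q)) (τ (e₀.symm (zIncl q)))
      (R (e₀.symm (zIncl q)))) (hs : 2 * δ < s) (hs' : s + 2 * δ < τ (e₀.symm (zIncl q)))
    (hline : ∀ t, |t| ≤ 2 * δ → γ (s + t) = c.symm (zIncl q + t • tVec)) {t : ℝ}
    (ht : t ∈ Icc 0 (τ (e₀.symm (zIncl q)))) {w : Euc (m + 2)} (hw : w ∈ coordBox m r δ ε)
    (h : γ t = c.symm w) : |t - s| ≤ δ := by
  have hw2 := hP.coordBox_subset hw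
  have hx := hP.symm_zIncl_mem_slice hq
  have hp := hP.passes_zIncl hq
  have h1 := hP.label_of_trajectory hσ hH hinj hx hγ ht hw2 h
  have h3 : zIncl q = zIncl (zc w) := e₀.symm.injOn hp.mem_target₀
    (hP.passes_zIncl (hw.1.trans_lt hP.r_lt)).mem_target₀ h1
  have hec : ec w = 0 := by
    have h1 := energy_eq_of_trajectory hσ hH hγ.2.1 ht
    rw [hγ.2.2.1, hx.2, h, hP.flow.energy _ (hP.mem_target hw2)] at h1
    linarith
  have h0 : w = zIncl q + tc w • tVec := by
    rw [h3]
    exact euc_ext (by simp) (by simp) (by simp [hec])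
  have h2 := hline (tc w) hw2.2.1
  rw [← h0, ← h] at h2
  have ht' := abs_le.1 hw2.2.1
  have hlt : t < τ (e₀.symm (zIncl q)) := by
    refine lt_of_le_of_ne ht.2 fun he => hP.notMem₁ hw2 ?_
    rw [← h, he, hγ.2.2.2.1]
    exact hγ.2.2.2.2.1
  have h4 := (hγ.eq_of_meet_of_injOn hσ hH hinj hx.1 hx.1 hγ ⟨ht.1, hlt⟩
    ⟨by linarith, by linarith⟩ h2.symm).2
  rw [h4, add_sub_cancel_left]
  exact hw.2.1

/-- The perturbed Hamiltonian realizes the perturbed Poincaré map: its trajectories follow those of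
`H` up to the box, cross the box along a model curve, and follow another trajectory of `H`
afterwards. -/
theorem isPoincareMapOn (hσ : IsSymplecticForm σ) (hH : ContMDiff (𝓡 (m + 2)) 𝓘(ℝ, ℝ) ∞ H)
    (hinj : InjOn R S₀) (hR : ∀ x ∈ S₀, IsFirstHit σ H S₁ x (τ x) (R x)) {a : Euc m → Euc m}
    (ha : IsSymplecticPerturbation ωZ r a) {β χ : ℝ → ℝ} {p₀ : Euc m} (hβ : IsRamp δ β)
    (hχs : ContDiff ℝ ∞ χ) (hχ : ∀ e, |e| ≤ ε / 2 → χ e = 1)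
    (hM0 : ∀ w ∉ coordBox m r δ ε, modelEnergy ωZ β χ p₀ a w = 0)
    (hM : ∀ w, |modelEnergy ωZ β χ p₀ a w| < ε / 2) {R' : Ω → Ω}
    (hR'a : ∀ q, ‖q‖ ≤ r → R' (e₀.symm (zIncl q)) = e₁.symm (zIncl (q + a q)))
    (hR' : ∀ x ∈ slice H S₀ h,
      x ∉ (fun q => e₀.symm (zIncl q)) '' Metric.closedBall (0 : Euc m) r → R' x = R x) :
    IsPoincareMapOn σ (perturbedEnergy H c (modelEnergy ωZ β χ p₀ a)) (slice H S₀ h) S₁ R' := by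
  have hB : IsCompact (coordBox m r δ ε) := isCompact_coordBox r δ ε
  have hBc : coordBox m r δ ε ⊆ c.target := fun w hw => hP.mem_target (hP.coordBox_subset hw)
  have hMs : ContDiff ℝ ∞ (modelEnergy ωZ β χ p₀ a) :=
    contDiff_modelEnergy hβ.contDiff hβ.mem_Icc hχs ha.contDiff ha.norm_fderiv_le
  set M := modelEnergy ωZ β χ p₀ a with hMdef
  have hH' := contMDiff_perturbedEnergy hH hP.flow.mem hMs hB hBc hM0
  have hδ := hP.δ_pos
  intro x hx
  by_cases hxV : x ∈ (fun q => e₀.symm (zIncl q)) '' Metric.closedBall (0 : Euc m) r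
  · obtain ⟨q, hq, rfl⟩ := hxV
    rw [mem_closedBall_zero_iff] at hq
    simp only
    have hq' := hq.trans_lt hP.r_lt
    set ξ := modelCurve ωZ β p₀ a q with hξ
    have hξz : ∀ t, ‖zc (ξ t)‖ ≤ r := fun t => ha.norm_zc_modelCurve_le hβ hq
    have hξe : ∀ t, |ec (ξ t)| < ε / 2 := fun t => ha.abs_ec_modelCurve_lt hβ hP.ε_pos hχ hM
    have hξB : ∀ t, |t| ≤ 2 * δ → ξ t ∈ coordBox m r (2 * δ) ε := fun t ht =>
      ⟨hξz t, by rwa [tc_modelCurve], by linarith [hξe t, hP.ε_pos]⟩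
    have hq₁ : ‖q + a q‖ ≤ r := by
      have h1 := hξz (2 * δ)
      rw [hξ, ha.modelCurve_of_gt hβ (by linarith)] at h1
      simpa using h1
    have hq₁' := hq₁.trans_lt hP.r_lt
    have hp := hP.passes_zIncl hq'
    have hp₁ := hP.passes_zIncl hq₁'
    obtain ⟨γ, s, hγ, hs, hs', hline⟩ := hp.exists_trajectory
    obtain ⟨γ₁, s₁, hγ₁, hs₁, hs₁', hline₁⟩ := hp₁.exists_trajectory
    set v := e₀.symm (zIncl q) with hv
    set v₁ := e₀.symm (zIncl (q + a q)) with hv₁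
    -- the new trajectory is glued from three pieces; the first one precedes the box
    have hA : IsMIntegralCurveOn (I := 𝓡 (m + 2)) γ
        (hamiltonianVectorField σ (perturbedEnergy H c M)) (Icc 0 (s - 3 / 2 * δ)) := by
      refine IsMIntegralCurveOn.perturbedEnergy hB hBc hM0
        (hγ.2.1.mono (Icc_subset_Icc_right (by linarith))) ?_
      rintro t ht ⟨w, hw, hwt⟩
      have h1 := abs_le.1 (hP.time_of_trajectory hσ hH hinj hq' hγ hs hs' hline
        ⟨ht.1, by linarith [ht.2]⟩ hw hwt.symm)
      linarith [ht.2, h1.1]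
    -- the second piece crosses the box along the model curve
    have hB2 : IsMIntegralCurveOn (I := 𝓡 (m + 2)) (fun t => c.symm (ξ t))
        (hamiltonianVectorField σ (perturbedEnergy H c M)) (Icc (-(2 * δ)) (2 * δ)) :=
      hP.flow.isMIntegralCurveOn_perturbedEnergy hσ hMs hH'
        (fun t _ => ha.hasDerivAt_modelCurve hP.antisymm hβ hP.ε_pos hχs hχ hM q t)
        (fun t ht => hP.mem_target (hξB t (abs_le.2 ht)))
    have hB3 := IsMIntegralCurveOn.shift hB2 s
    -- the third piece is the end of the trajectory labelled by `q + a q`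
    have hC : IsMIntegralCurveOn (I := 𝓡 (m + 2)) γ₁
        (hamiltonianVectorField σ (perturbedEnergy H c M)) (Icc (s₁ + 3 / 2 * δ) (τ v₁)) := by
      refine IsMIntegralCurveOn.perturbedEnergy hB hBc hM0
        (hγ₁.2.1.mono (Icc_subset_Icc_left (by linarith))) ?_
      rintro t ht ⟨w, hw, hwt⟩
      have h1 := abs_le.1 (hP.time_of_trajectory hσ hH hinj hq₁' hγ₁ hs₁ hs₁' hline₁
        ⟨by linarith [ht.1], ht.2⟩ hw hwt.symm)
      linarith [ht.1, h1.2]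
    have hC2 := IsMIntegralCurveOn.shift hC (s - s₁)
    obtain ⟨η, hη, hη₁, hη₂⟩ := IsMIntegralCurveOn.exists_glue (b' := -(2 * δ) + s)
      (b := s - 3 / 2 * δ) (by linarith) hA hB3 (by
        intro t ht
        have h1 := hline (t - s) (abs_le.2 ⟨by linarith [ht.1], by linarith [ht.2]⟩)
        simp only
        rw [hξ, ha.modelCurve_of_lt hβ (by linarith [ht.2]), ← h1, add_sub_cancel])
    obtain ⟨ζ, hζ, hζη, hζ₃⟩ := IsMIntegralCurveOn.exists_glue
      (b' := s₁ + 3 / 2 * δ + (s - s₁)) (b := 2 * δ + s) (by linarith) hη hC2 (by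
        intro t ht
        have h1 := hline₁ (t - s) (abs_le.2 ⟨by linarith [ht.1], by linarith [ht.2]⟩)
        rw [hη₂ ⟨by linarith [ht.1], ht.2⟩]
        simp only
        rw [hξ, ha.modelCurve_of_gt hβ (by linarith [ht.1]), ← h1]
        congr 1
        ring)
    have hT : τ v₁ + (s - s₁) ∈ Icc (s₁ + 3 / 2 * δ + (s - s₁)) (τ v₁ + (s - s₁)) :=
      ⟨by linarith, le_rfl⟩
    refine ⟨τ v₁ + (s - s₁), ζ, by linarith, hζ, ?_, ?_, ?_, ?_⟩
    · rw [hζη ⟨le_rfl, by linarith⟩, hη₁ ⟨le_rfl, by linarith⟩]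
      exact hγ.2.2.1
    · rw [hζ₃ hT, hR'a q hq]
      simp only [add_sub_cancel_right]
      rw [hγ₁.2.2.2.1]
      exact hp₁.map_eq
    · rw [hR'a q hq, ← hp₁.map_eq]
      exact hγ₁.2.2.2.2.1
    · intro t ht
      rcases le_or_gt t (s - 3 / 2 * δ) with h1 | h1
      · rw [hζη ⟨ht.1.le, by linarith⟩, hη₁ ⟨ht.1.le, h1⟩]
        exact hγ.2.2.2.2.2 t ⟨ht.1, by linarith⟩
      rcases le_or_gt t (2 * δ + s) with h2 | h2
      · rw [hζη ⟨ht.1.le, h2⟩, hη₂ ⟨by linarith, h2⟩]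
        exact hP.notMem₁ (hξB _ (abs_le.2 ⟨by linarith, by linarith⟩))
      · rw [hζ₃ ⟨by linarith, ht.2.le⟩]
        exact hγ₁.2.2.2.2.2 _ ⟨by linarith, by linarith [ht.2]⟩
  · rw [hR' x hx hxV]
    obtain ⟨γ, hγ⟩ := hR x hx.1
    refine ⟨τ x, γ, hγ.1, IsMIntegralCurveOn.perturbedEnergy hB hBc hM0 hγ.2.1 ?_, hγ.2.2⟩
    rintro t ht ⟨w, hw, hwt⟩
    have h1 := hP.label_of_trajectory hσ hH hinj hx hγ ht (hP.coordBox_subset hw) hwt.symm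
    exact hxV ⟨zc w, by simpa using hw.1, h1.symm⟩

end IsPassage
end Realization

/-! ### Whitney neighborhoods -/

section Closeness

variable {m : ℕ} {Ω : Type*} [TopologicalSpace Ω] [ChartedSpace (Euc (m + 2)) Ω] [T2Space Ω]
  {H : Ω → ℝ} {c : OpenPartialHomeomorph Ω (Euc (m + 2))}

/-- Small perturbations of the identity lead to perturbed Hamiltonians in a given Whitney
neighborhood: only finitely many of the compact sets that define the neighborhood meet the
support of the perturbation. -/
theorem exists_forall_perturbedEnergy_lt (H : Ω → ℝ) (ωZ : Euc m →L[ℝ] Euc m →L[ℝ] ℝ) (p₀ : Euc m)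
    {β χ : ℝ → ℝ} (hβ : ContDiff ℝ ∞ β) (hβI : ∀ t, β t ∈ Icc (0 : ℝ) 1) (hχ : ContDiff ℝ ∞ χ)
    {s : Set (Euc m)} (hs : IsCompact s) (hc : c ∈ IsManifold.maximalAtlas (𝓡 (m + 2)) ∞ Ω)
    {B : Set (Euc (m + 2))} (hB : IsCompact B) (hBc : B ⊆ c.target) {N : ℕ}
    {e : ℕ → OpenPartialHomeomorph Ω (Euc (m + 2))} {K : ℕ → Set Ω} {ε : ℕ → ℝ}
    (hK : LocallyFinite K) (hKe : ∀ i, e i ∈ IsManifold.maximalAtlas (𝓡 (m + 2)) ∞ Ω ∧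
      IsCompact (K i) ∧ K i ⊆ (e i).source ∧ 0 < ε i) {ε₀ : ℝ} (hε₀ : 0 < ε₀) :
    ∃ (n : ℕ) (η : ℝ), 0 < η ∧ ∀ a : Euc m → Euc m, ContDiff ℝ ∞ a → (∀ x ∉ s, a x = 0) →
      (∀ k ≤ n, ∀ x, ‖iteratedFDeriv ℝ k a x‖ ≤ η) →
      (∀ x, ‖fderiv ℝ a x‖ ≤ 1 / 4) ∧
      ((∀ w ∉ B, modelEnergy ωZ β χ p₀ a w = 0) →
        (∀ w, |modelEnergy ωZ β χ p₀ a w| < ε₀) ∧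
        ∀ i, ∀ k ≤ N, ∀ x ∈ K i,
          ‖iteratedFDeriv ℝ k (fun z => perturbedEnergy H c (modelEnergy ωZ β χ p₀ a)
            ((e i).symm z) - H ((e i).symm z)) (e i x)‖ < ε i) := by
  set B' := c.symm '' B with hB'
  have hB'c : IsCompact B' := hB.image_of_continuousOn (c.continuousOn_symm.mono hBc)
  have hB's : B' ⊆ c.source := by
    rintro _ ⟨w, hw, rfl⟩
    exact c.map_target (hBc hw)
  have hfin : {i | (K i ∩ B').Nonempty}.Finite := hK.finite_nonempty_inter_compact hB'c
  have hi : ∀ i, ∃ (n : ℕ) (η : ℝ), 0 < η ∧ ∀ a : Euc m → Euc m, ContDiff ℝ ∞ a →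
      (∀ x ∉ s, a x = 0) → (∀ k ≤ n, ∀ x, ‖iteratedFDeriv ℝ k a x‖ ≤ η) →
      ∀ k ≤ N, ∀ z ∈ e i '' (K i ∩ B'), ‖iteratedFDeriv ℝ k
        (fun z => modelEnergy ωZ β χ p₀ a (c ((e i).symm z))) z‖ < ε i := by
    intro i
    obtain ⟨h1, h2, h3, h4⟩ := hKe i
    refine exists_forall_modelEnergy_lt ωZ p₀ hβ hβI hχ hs ((e i).symm.trans c).open_source
      (contDiffOn_chart_symm_comp hc h1)
      ((h2.inter_right hB'c.isClosed).image_of_continuousOn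
        ((e i).continuousOn.mono (inter_subset_left.trans h3))) ?_ N h4
    rintro _ ⟨x, ⟨hx, hxB⟩, rfl⟩
    simpa [(e i).left_inv (h3 hx)] using ⟨(e i).map_source (h3 hx), hB's hxB⟩
  choose n η hη hn using hi
  obtain ⟨n₀, η₀, hη₀, hn₀⟩ := exists_forall_modelEnergy_lt ωZ p₀ hβ hβI hχ hs (g := id)
    isOpen_univ contDiffOn_id hB (subset_univ B) 0 hε₀
  set F := hfin.toFinset
  obtain ⟨η₁, hη₁, hη₁F⟩ : ∃ η₁, 0 < η₁ ∧ ∀ i ∈ F, η₁ ≤ η i := by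
    have h1 : ∀ᶠ t in 𝓝[>] (0 : ℝ), ∀ i ∈ F, t ≤ η i := (Filter.eventually_all_finset F).2
      fun i _ => mem_nhdsWithin_of_mem_nhds (Iic_mem_nhds (hη i))
    obtain ⟨t, ht, ht0⟩ := (h1.and self_mem_nhdsWithin).exists
    exact ⟨t, ht0, ht⟩
  refine ⟨max (max 1 n₀) (F.sup n), min (min (1 / 4) η₀) η₁, by positivity,
    fun a ha has hab => ⟨fun x => ?_, fun hM0 => ⟨fun w => ?_, fun i k hk x hx => ?_⟩⟩⟩
  · rw [← norm_iteratedFDeriv_one]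
    exact (hab 1 ((le_max_left _ _).trans (le_max_left _ _)) x).trans
      ((min_le_left _ _).trans (min_le_left _ _))
  · by_cases hw : w ∈ B
    · have h1 := hn₀ a ha has (fun k hk x =>
        (hab k (hk.trans ((le_max_right _ _).trans (le_max_left _ _))) x).trans
          ((min_le_left _ _).trans (min_le_right _ _))) 0 le_rfl w hw
      simpa using h1
    · rw [hM0 w hw, abs_zero]
      exact hε₀
  · obtain ⟨h1, h2, h3, h4⟩ := hKe i
    have hxs := h3 hx
    by_cases hxB : x ∈ B'
    · have hiF : i ∈ F := hfin.mem_toFinset.2 ⟨x, hx, hxB⟩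
      have h5 := hn i a ha has (fun k hk x =>
        (hab k (hk.trans ((Finset.le_sup hiF).trans (le_max_right _ _))) x).trans
          ((min_le_right _ _).trans (hη₁F i hiF))) k hk (e i x) ⟨x, ⟨hx, hxB⟩, rfl⟩
      have h6 : (fun z => perturbedEnergy H c (modelEnergy ωZ β χ p₀ a) ((e i).symm z) -
          H ((e i).symm z)) =ᶠ[𝓝 (e i x)] fun z => modelEnergy ωZ β χ p₀ a (c ((e i).symm z)) := by
        have h7 : ((e i).symm.trans c).source ∈ 𝓝 (e i x) :=
          ((e i).symm.trans c).open_source.mem_nhds (by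
            simpa [(e i).left_inv hxs] using ⟨(e i).map_source hxs, hB's hxB⟩)
        filter_upwards [h7] with z hz
        rw [OpenPartialHomeomorph.trans_source] at hz
        rw [perturbedEnergy_of_mem hz.2, add_sub_cancel_left]
      rwa [(h6.iteratedFDeriv ℝ k).eq_of_nhds]
    · have h6 : (fun z => perturbedEnergy H c (modelEnergy ωZ β χ p₀ a) ((e i).symm z) -
          H ((e i).symm z)) =ᶠ[𝓝 (e i x)] fun _ => 0 := by
        have h7 := (e i).continuousAt_symm ((e i).map_source hxs)
        rw [ContinuousAt, (e i).left_inv hxs] at h7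
        filter_upwards [h7.eventually (perturbedEnergy_eventuallyEq (H := H) hB hBc hM0 hxB)]
          with z hz
        rw [hz, sub_self]
      rw [(h6.iteratedFDeriv ℝ k).eq_of_nhds]
      simpa using h4

end Closeness

/-! ### Perturbed Poincaré maps as displacements -/

section Displacement

variable {m : ℕ} {Ω : Type*} [TopologicalSpace Ω] {H : Ω → ℝ} {S₀ S₁ : Set Ω} {τ : Ω → ℝ} {R R' : Ω → Ω} {h : ℝ}
  {ωZ : Euc m →L[ℝ] Euc m →L[ℝ] ℝ} {c₀ c c₁ e₀ e₁ : OpenPartialHomeomorph Ω (Euc (m + 2))}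
  {r r' δ ε : ℝ}

/-- The displacement `R' ∘ R⁻¹ - id` on the slice of `S₁`, in the labels of the points of the
slice, cut off outside the closed ball of radius `r`. -/
noncomputable def displacement (e₀ e₁ : OpenPartialHomeomorph Ω (Euc (m + 2))) (r : ℝ) (R' : Ω → Ω) :
    Euc m → Euc m :=
  (Metric.closedBall 0 r).indicator fun u => zc (e₁ (R' (e₀.symm (zIncl u)))) - u

theorem displacement_eq_zero {u : Euc m} (hu : r < ‖u‖) : displacement e₀ e₁ r R' u = 0 :=
  indicator_of_notMem (by simpa using hu) _

theorem displacement_eventuallyEq_zero {x : Euc m} (hx : r < ‖x‖) :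
    displacement e₀ e₁ r R' =ᶠ[𝓝 x] fun _ => 0 := by
  filter_upwards [(isOpen_lt continuous_const continuous_norm).mem_nhds hx] with u hu
  exact displacement_eq_zero hu

/-- The part of the slice of `S₀` on which the Poincaré map is modified. -/
def labelBall (e₀ : OpenPartialHomeomorph Ω (Euc (m + 2))) (r : ℝ) : Set Ω :=
  (fun q => e₀.symm (zIncl q)) '' Metric.closedBall (0 : Euc m) r

variable [ChartedSpace (Euc (m + 2)) Ω] {σ : TwoForm (m + 2) Ω}

/-- `R'` is a symplectic map of the slices which differs from `R` only on the ball of labels of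
radius `r`, and which maps this ball into the domain of the section chart `e₁`. -/
structure IsLocalModification (σ : TwoForm (m + 2) Ω) (H : Ω → ℝ) (S₀ S₁ : Set Ω) (R : Ω → Ω)
    (h : ℝ) (e₀ e₁ : OpenPartialHomeomorph Ω (Euc (m + 2))) (r : ℝ) (R' : Ω → Ω) : Prop where
  smooth : IsSmoothMap (d := m + 2) (slice H S₀ h) (slice H S₁ h) R'
  symplectic : IsSymplecticOn σ m (slice H S₀ h) R'
  eq_of_notMem : ∀ x ∈ slice H S₀ h, x ∉ labelBall e₀ r → R' x = R x
  mapsTo : MapsTo R' (labelBall e₀ r) e₁.source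

theorem IsPassage.isTangent_slice (hP : IsPassage σ H S₀ S₁ τ R h ωZ c₀ c c₁ e₀ e₁ r r' δ ε) {x : Euc m}
    (hx : ‖x‖ < r') (u : Euc m) : IsTangent m (slice H S₀ h) (e₀.symm (zIncl x))
      (mfderiv (𝓡 (m + 2)) (𝓡 (m + 2)) e₀.symm (zIncl x) (zIncl u)) := by
  have ht := (hP.passes_zIncl hx).mem_target₀
  refine ⟨e₀, hP.section₀.isSliceChart hP.flow₀, hP.symm_zIncl_mem_slice hx, e₀.map_target ht,
    fun i hi => ?_⟩
  have h1 := congrArg (fun L => L (zIncl u))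
    ((mdifferentiable_of_mem_maximalAtlas hP.section₀.mem).comp_symm_deriv ht)
  have h2 : (show Euc (m + 2) from mfderiv (𝓡 (m + 2)) (𝓡 (m + 2)) e₀ (e₀.symm (zIncl x))
      (mfderiv (𝓡 (m + 2)) (𝓡 (m + 2)) e₀.symm (zIncl x) (zIncl u))) = zIncl u := h1
  rw [h2]
  exact (forall_coord_eq_zero_iff (zIncl u)).2 (by simp) i hi

namespace IsLocalModification

theorem mem_source (hP : IsPassage σ H S₀ S₁ τ R h ωZ c₀ c c₁ e₀ e₁ r r' δ ε)
    (hR' : IsLocalModification σ H S₀ S₁ R h e₀ e₁ r R') {u : Euc m} (hu : ‖u‖ < r') :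
    R' (e₀.symm (zIncl u)) ∈ e₁.source := by
  by_cases h1 : e₀.symm (zIncl u) ∈ labelBall e₀ r
  · exact hR'.mapsTo h1
  · have h2 := hP.passes_zIncl hu
    rw [hR'.eq_of_notMem _ (hP.symm_zIncl_mem_slice hu) h1, h2.map_eq]
    exact e₁.map_target h2.mem_target₁

/-- In the labels, `R'` is the map `u ↦ u + displacement u` on the ball of radius `r'`. -/
theorem chart_apply (hP : IsPassage σ H S₀ S₁ τ R h ωZ c₀ c c₁ e₀ e₁ r r' δ ε)
    (hR' : IsLocalModification σ H S₀ S₁ R h e₀ e₁ r R') {u : Euc m} (hu : ‖u‖ < r') :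
    e₁ (R' (e₀.symm (zIncl u))) = zIncl (u + displacement e₀ e₁ r R' u) := by
  have hp := hP.passes_zIncl hu
  by_cases hur : ‖u‖ ≤ r
  · have h1 : R' (e₀.symm (zIncl u)) ∈ slice H S₁ h := hR'.smooth.2 (hP.symm_zIncl_mem_slice hu)
    have h2 := (hP.section₁.isSliceChart hP.flow₁).2 _ (hR'.mem_source hP hu)
    have h3 := (forall_coord_eq_zero_iff _).1 (h2.1 h1)
    rw [displacement, indicator_of_mem (by simpa using hur)]
    exact euc_ext (by simp) (by simpa using h3.1) (by simpa using h3.2)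
  · rw [not_le] at hur
    rw [displacement_eq_zero hur, add_zero, hR'.eq_of_notMem _ (hP.symm_zIncl_mem_slice hu), hp.map_eq,
      e₁.right_inv hp.mem_target₁]
    rintro ⟨q, hq, hqu⟩
    rw [mem_closedBall_zero_iff] at hq
    have h4 := congrArg zc (e₀.symm.injOn (hP.passes_zIncl (hq.trans_lt hP.r_lt)).mem_target₀
      hp.mem_target₀ hqu)
    rw [zc_zIncl, zc_zIncl] at h4
    rw [h4] at hq
    exact absurd hq (not_le.2 hur)

theorem apply_symm (hP : IsPassage σ H S₀ S₁ τ R h ωZ c₀ c c₁ e₀ e₁ r r' δ ε)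
    (hR' : IsLocalModification σ H S₀ S₁ R h e₀ e₁ r R') {u : Euc m} (hu : ‖u‖ < r') :
    zIncl (u + displacement e₀ e₁ r R' u) ∈ e₁.target ∧
      R' (e₀.symm (zIncl u)) = e₁.symm (zIncl (u + displacement e₀ e₁ r R' u)) := by
  have h1 := hR'.mem_source hP hu
  rw [← hR'.chart_apply hP hu]
  exact ⟨e₁.map_source h1, (e₁.left_inv h1).symm⟩

theorem contDiff_displacement (hP : IsPassage σ H S₀ S₁ τ R h ωZ c₀ c c₁ e₀ e₁ r r' δ ε)
    (hR' : IsLocalModification σ H S₀ S₁ R h e₀ e₁ r R') :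
    ContDiff ℝ ∞ (displacement e₀ e₁ r R') := by
  have h1 : ContMDiffOn (𝓡 m) (𝓡 (m + 2)) ∞ (fun u : Euc m => e₀.symm (zIncl u))
      (Metric.ball 0 r') :=
    (contMDiffOn_symm_of_mem_maximalAtlas hP.section₀.mem).comp
      zIncl.contDiff.contMDiff.contMDiffOn
      fun u hu => (hP.passes_zIncl (mem_ball_zero_iff.1 hu)).mem_target₀
  have h2 : ContMDiffOn (𝓡 m) (𝓡 (m + 2)) ∞ (fun u : Euc m => R' (e₀.symm (zIncl u)))
      (Metric.ball 0 r') :=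
    hR'.smooth.1.comp h1 fun u hu => hP.symm_zIncl_mem_slice (mem_ball_zero_iff.1 hu)
  have h3 : ContMDiffOn (𝓡 m) (𝓡 (m + 2)) ∞ (fun u : Euc m => e₁ (R' (e₀.symm (zIncl u))))
      (Metric.ball 0 r') :=
    (contMDiffOn_of_mem_maximalAtlas hP.section₁.mem).comp h2
      fun u hu => hR'.mem_source hP (mem_ball_zero_iff.1 hu)
  rw [contMDiffOn_iff_contDiffOn] at h3
  refine contDiff_iff_contDiffAt.2 fun x => ?_
  rcases lt_or_ge r ‖x‖ with hx | hx
  · exact contDiffAt_const.congr_of_eventuallyEq (displacement_eventuallyEq_zero hx)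
  · have hx' : x ∈ Metric.ball (0 : Euc m) r' := mem_ball_zero_iff.2 (hx.trans_lt hP.r_lt)
    have h4 := ((zc : Euc (m + 2) →L[ℝ] Euc m).contDiff.comp_contDiffOn h3).sub contDiffOn_id
    refine (h4.contDiffAt (Metric.isOpen_ball.mem_nhds hx')).congr_of_eventuallyEq ?_
    filter_upwards [Metric.isOpen_ball.mem_nhds hx'] with u hu
    simp [hR'.chart_apply hP (mem_ball_zero_iff.1 hu)]

theorem norm_iteratedFDeriv_displacement_le
    (hP : IsPassage σ H S₀ S₁ τ R h ωZ c₀ c c₁ e₀ e₁ r r' δ ε)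
    (hR' : IsLocalModification σ H S₀ S₁ R h e₀ e₁ r R') {k : ℕ} {η : ℝ} (hη : 0 ≤ η)
    (hclose : ∀ w : Euc m, zIncl w ∈ e₀.target → e₀.symm (zIncl w) ∈ labelBall e₀ r →
      ‖iteratedFDeriv ℝ k (fun u : Euc m => e₁ (R' (e₀.symm (zIncl u))) -
        e₁ (R (e₀.symm (zIncl u)))) w‖ < η) (x : Euc m) :
    ‖iteratedFDeriv ℝ k (displacement e₀ e₁ r R') x‖ ≤
      ‖(zc : Euc (m + 2) →L[ℝ] Euc m)‖ * η := by
  rcases lt_or_ge r ‖x‖ with hx | hx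
  · rw [((displacement_eventuallyEq_zero hx).iteratedFDeriv ℝ k).eq_of_nhds]
    simp only [iteratedFDeriv_fun_zero, Pi.zero_apply, norm_zero]
    positivity
  · have hx' := hx.trans_lt hP.r_lt
    have h1 := hclose x (hP.passes_zIncl hx').mem_target₀ ⟨x, by simpa using hx, rfl⟩
    have h2 : (fun u : Euc m => e₁ (R' (e₀.symm (zIncl u))) - e₁ (R (e₀.symm (zIncl u))))
        =ᶠ[𝓝 x] fun u => zIncl (displacement e₀ e₁ r R' u) := by
      filter_upwards [Metric.isOpen_ball.mem_nhds (mem_ball_zero_iff.2 hx')] with u hu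
      have hp := hP.passes_zIncl (mem_ball_zero_iff.1 hu)
      rw [hR'.chart_apply hP (mem_ball_zero_iff.1 hu), hp.map_eq, e₁.right_inv hp.mem_target₁,
        map_add, add_sub_cancel_left]
    rw [(h2.iteratedFDeriv ℝ k).eq_of_nhds] at h1
    have h3 := (zc : Euc (m + 2) →L[ℝ] Euc m).norm_iteratedFDeriv_comp_left
      (f := fun u => zIncl (displacement e₀ e₁ r R' u)) (x := x) (N := ∞) (n := k)
      (zIncl.contDiff.comp (hR'.contDiff_displacement hP)).contDiffAt
      (by exact_mod_cast (le_top : ((k : ℕ∞)) ≤ ⊤))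
    have h4 : (⇑(zc : Euc (m + 2) →L[ℝ] Euc m) ∘ fun u => zIncl (displacement e₀ e₁ r R' u)) =
        displacement e₀ e₁ r R' := funext fun u => zc_zIncl _
    rw [h4] at h3
    exact h3.trans (by gcongr)

/-- The differential of `R'` along the slice, in the labels. -/
theorem mfderivWithin_apply (hP : IsPassage σ H S₀ S₁ τ R h ωZ c₀ c c₁ e₀ e₁ r r' δ ε)
    (hR' : IsLocalModification σ H S₀ S₁ R h e₀ e₁ r R') {x : Euc m} (hx : ‖x‖ < r') (u : Euc m) :
    (show Euc (m + 2) from mfderivWithin (𝓡 (m + 2)) (𝓡 (m + 2)) R' (slice H S₀ h)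
      (e₀.symm (zIncl x)) (mfderiv (𝓡 (m + 2)) (𝓡 (m + 2)) e₀.symm (zIncl x) (zIncl u))) =
      mfderiv (𝓡 (m + 2)) (𝓡 (m + 2)) e₁.symm (zIncl (x + displacement e₀ e₁ r R' x))
        (zIncl (u + fderiv ℝ (displacement e₀ e₁ r R') x u)) := by
  set a := displacement e₀ e₁ r R' with ha
  have hball : Metric.ball (0 : Euc m) r' ∈ 𝓝 x :=
    Metric.isOpen_ball.mem_nhds (mem_ball_zero_iff.2 hx)
  have h0 : HasMFDerivAt (𝓡 m) (𝓡 (m + 2)) (zIncl : Euc m → Euc (m + 2)) x zIncl :=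
    zIncl.hasFDerivAt.hasMFDerivAt
  have h1 := ((mdifferentiable_of_mem_maximalAtlas hP.section₀.mem).mdifferentiableAt_symm
    (hP.passes_zIncl hx).mem_target₀).hasMFDerivAt.comp x h0
  have h2 := ((hR'.smooth.1 _ (hP.symm_zIncl_mem_slice hx)).mdifferentiableWithinAt
    (by simp)).hasMFDerivWithinAt
  have hsub : Metric.ball (0 : Euc m) r' ⊆ (e₀.symm ∘ zIncl) ⁻¹' slice H S₀ h :=
    fun u hu => hP.symm_zIncl_mem_slice (mem_ball_zero_iff.1 hu)
  have h3 := (h2.comp x h1.hasMFDerivWithinAt hsub).hasMFDerivAt hball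
  have h4 : HasMFDerivAt (𝓡 m) (𝓡 (m + 2)) (fun u : Euc m => (zIncl (u + a u) : Euc (m + 2))) x
      (zIncl.comp (ContinuousLinearMap.id ℝ (Euc m) + fderiv ℝ a x)) :=
    (zIncl.hasFDerivAt.comp x ((hasFDerivAt_id x).add
      ((hR'.contDiff_displacement hP).differentiable (by simp) x).hasFDerivAt)).hasMFDerivAt
  have h5 := ((mdifferentiable_of_mem_maximalAtlas hP.section₁.mem).mdifferentiableAt_symm
    (hR'.apply_symm hP hx).1).hasMFDerivAt.comp x h4
  have h6 := h5.congr_of_eventuallyEq (f₁ := R' ∘ (e₀.symm ∘ zIncl)) (by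
    filter_upwards [hball] with u hu using (hR'.apply_symm hP (mem_ball_zero_iff.1 hu)).2)
  exact congrArg (fun L : Euc m →L[ℝ] Euc (m + 2) => L u) (hasMFDerivAt_unique h3 h6)

/-- Since section charts carry the symplectic form of the slices to `ωZ`, the map
`u ↦ u + displacement u` preserves `ωZ`. -/
theorem symplectic_displacement (hP : IsPassage σ H S₀ S₁ τ R h ωZ c₀ c c₁ e₀ e₁ r r' δ ε)
    (hR' : IsLocalModification σ H S₀ S₁ R h e₀ e₁ r R') (x u v : Euc m) :
    ωZ (u + fderiv ℝ (displacement e₀ e₁ r R') x u) (v + fderiv ℝ (displacement e₀ e₁ r R') x v) =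
      ωZ u v := by
  rcases lt_or_ge r ‖x‖ with hx | hx
  · rw [(displacement_eventuallyEq_zero hx).fderiv_eq]
    simp
  · have hx' := hx.trans_lt hP.r_lt
    obtain ⟨ht, heq⟩ := hR'.apply_symm hP hx'
    have h1 := hR'.symplectic _ (hP.symm_zIncl_mem_slice hx') _ _ (hP.isTangent_slice hx' u)
      (hP.isTangent_slice hx' v)
    have h2 := formInChart_apply_eq (σ := σ) (e := e₀) (zIncl x) (zIncl u) (zIncl v)
    have h3 := formInChart_apply_eq (σ := σ) (e := e₁)
      (zIncl (x + displacement e₀ e₁ r R' x))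
      (zIncl (u + fderiv ℝ (displacement e₀ e₁ r R') x u))
      (zIncl (v + fderiv ℝ (displacement e₀ e₁ r R') x v))
    rw [hP.section₀.formInChart_eq hP.flow₀ (hP.passes_zIncl hx').mem_target₀ (by simp) (by simp),
      zc_zIncl, zc_zIncl] at h2
    rw [hP.section₁.formInChart_eq hP.flow₁ ht (by simp) (by simp), zc_zIncl, zc_zIncl] at h3
    have key : ∀ p, p = e₁.symm (zIncl (x + displacement e₀ e₁ r R' x)) → ∀ V W : Euc (m + 2),
        σ p ![V, W] = σ (e₁.symm (zIncl (x + displacement e₀ e₁ r R' x))) ![V, W] := by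
      rintro _ rfl V W
      rfl
    rw [h2, h3]
    refine Eq.trans ?_ h1
    refine Eq.trans ?_ (key _ heq _ _).symm
    have hu := hR'.mfderivWithin_apply hP hx' u
    have hv := hR'.mfderivWithin_apply hP hx' v
    exact congrArg₂ (fun V W : Euc (m + 2) =>
      σ (e₁.symm (zIncl (x + displacement e₀ e₁ r R' x))) ![V, W]) hu.symm hv.symm

end IsLocalModification
end Displacement

/-! ### Choice of the neighborhoods -/

section Passages

variable {m : ℕ}

theorem exists_box_subset {O : Set (Euc (m + 2))} (hO : O ∈ 𝓝 (0 : Euc (m + 2))) :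
    ∃ ρ > 0, ∀ w : Euc (m + 2), ‖zc w‖ < ρ → |tc w| < ρ → |ec w| < ρ → w ∈ O := by
  obtain ⟨r, hr, hrO⟩ := Metric.mem_nhds_iff.1 hO
  set C := ‖(zIncl : Euc m →L[ℝ] Euc (m + 2))‖ + ‖(tVec : Euc (m + 2))‖ + ‖(eVec : Euc (m + 2))‖
    with hC
  have hC0 : 0 ≤ C := by positivity
  refine ⟨r / (C + 1), by positivity, fun w hz ht he => hrO ?_⟩
  set ρ := r / (C + 1) with hρ
  have hρr : ρ * (C + 1) = r := div_mul_cancel₀ _ (by positivity)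
  rw [mem_ball_zero_iff]
  have hρ0 : 0 < ρ := by positivity
  calc ‖w‖ = ‖zIncl (zc w) + tc w • tVec + ec w • eVec‖ := by rw [euc_decomp]
    _ ≤ ‖zIncl (zc w)‖ + ‖tc w • (tVec : Euc (m + 2))‖ + ‖ec w • (eVec : Euc (m + 2))‖ :=
        norm_add₃_le
    _ ≤ ‖(zIncl : Euc m →L[ℝ] Euc (m + 2))‖ * ρ + ρ * ‖(tVec : Euc (m + 2))‖ +
          ρ * ‖(eVec : Euc (m + 2))‖ := by
        rw [norm_smul, norm_smul, Real.norm_eq_abs, Real.norm_eq_abs]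
        have := zIncl.le_opNorm_of_le hz.le
        gcongr
    _ = ρ * C := by rw [hC]; ring
    _ < ρ * (C + 1) := by gcongr; linarith
    _ = r := hρr

variable {Ω : Type*} [TopologicalSpace Ω] [ChartedSpace (Euc (m + 2)) Ω]
  {σ : TwoForm (m + 2) Ω} {H : Ω → ℝ} {S₀ S₁ : Set Ω} {τ : Ω → ℝ} {R : Ω → Ω} {h : ℝ}
  {ωZ : Euc m →L[ℝ] Euc m →L[ℝ] ℝ} {c₀ c c₁ e₀ e₁ : OpenPartialHomeomorph Ω (Euc (m + 2))}
  {r r' δ δ' ε : ℝ}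

theorem PassesThrough.mono {w : Euc (m + 2)} (hw : PassesThrough σ H S₀ S₁ τ R c e₀ e₁ δ w)
    (hδ : δ' ≤ δ) : PassesThrough σ H S₀ S₁ τ R c e₀ e₁ δ' w := by
  obtain ⟨γ, s, hγ, hs, hs', hl⟩ := hw.exists_trajectory
  exact ⟨hw.mem_target₀, hw.mem_target₁, hw.mem_section, hw.map_eq,
    fun t ht => hw.line_mem t (ht.trans hδ), fun t ht => hw.line_not_mem₀ t (ht.trans hδ),
    fun t ht => hw.line_not_mem₁ t (ht.trans hδ), γ, s, hγ, by linarith, by linarith,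
    fun t ht => hl t (ht.trans hδ)⟩

namespace IsPassage

variable (hP : IsPassage σ H S₀ S₁ τ R h ωZ c₀ c c₁ e₀ e₁ r r' δ ε)
include hP

theorem labelBall_subset : labelBall e₀ r ⊆ slice H S₀ h ∩ e₀.source := by
  rintro _ ⟨q, hq, rfl⟩
  have hq' := (mem_closedBall_zero_iff.1 hq).trans_lt hP.r_lt
  exact ⟨hP.symm_zIncl_mem_slice hq', e₀.map_target (hP.passes_zIncl hq').mem_target₀⟩

theorem isCompact_labelBall : IsCompact (labelBall e₀ r) := by
  refine (isCompact_closedBall (0 : Euc m) r).image_of_continuousOn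
    (e₀.continuousOn_symm.comp zIncl.continuous.continuousOn fun q hq => ?_)
  exact (hP.passes_zIncl ((mem_closedBall_zero_iff.1 hq).trans_lt hP.r_lt)).mem_target₀

theorem mapsTo_labelBall : MapsTo R (labelBall e₀ r) e₁.source := by
  rintro _ ⟨q, hq, rfl⟩
  have hp := hP.passes_zIncl ((mem_closedBall_zero_iff.1 hq).trans_lt hP.r_lt)
  simp only
  rw [hp.map_eq]
  exact e₁.map_target hp.mem_target₁

theorem labelBall_mem_nhdsWithin (h0 : 0 ∈ e₀.target) :
    labelBall e₀ r ∈ 𝓝[slice H S₀ h] (e₀.symm 0) := by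
  have hs := e₀.map_target h0
  have h1 : ∀ᶠ x in 𝓝 (e₀.symm 0), ‖zc (e₀ x)‖ < r := by
    have h2 : ContinuousAt (fun x => ‖zc (e₀ x)‖) (e₀.symm 0) :=
      (zc.continuous.continuousAt.comp (e₀.continuousAt hs)).norm
    exact h2.eventually_lt continuousAt_const (by simpa [e₀.right_inv h0] using hP.r_pos)
  filter_upwards [mem_nhdsWithin_of_mem_nhds (h1.and (e₀.open_source.mem_nhds hs)),
    self_mem_nhdsWithin] with x hx hxS
  have h3 := (forall_coord_eq_zero_iff _).1
    (((hP.section₀.isSliceChart hP.flow₀).2 x hx.2).1 hxS)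
  refine ⟨zc (e₀ x), by simpa using hx.1.le, ?_⟩
  have h4 : zIncl (zc (e₀ x)) = e₀ x := euc_ext (by simp) (by simp [h3.1]) (by simp [h3.2])
  simp only
  rw [h4, e₀.left_inv hx.2]

end IsPassage

variable [IsManifold (𝓡 (m + 2)) ∞ Ω] [T2Space Ω]

/-- A passage whose box lies in a given neighborhood of the point `x₀`. -/
theorem exists_isPassage (hσ : IsSymplecticForm σ) (hH : ContMDiff (𝓡 (m + 2)) 𝓘(ℝ, ℝ) ∞ H)
    (hS₀ : IsSection σ H S₀) (hS₁ : IsSection σ H S₁)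
    (hR : ∀ x ∈ S₀, IsFirstHit σ H S₁ x (τ x) (R x)) (hinj : InjOn R S₀) {y₀ : Ω} (hy₀ : y₀ ∈ S₀)
    (hτ : ContinuousWithinAt τ S₀ y₀) {x₀ : Ω} (hx₀ : IsBetween σ H S₁ y₀ x₀) {U : Set Ω}
    (hU : U ∈ 𝓝 x₀) : ∃ (ωZ : Euc m →L[ℝ] Euc m →L[ℝ] ℝ)
      (c₀ c c₁ e₀ e₁ : OpenPartialHomeomorph Ω (Euc (m + 2))) (r r' δ ε : ℝ),
      IsPassage σ H S₀ S₁ τ R (H x₀) ωZ c₀ c c₁ e₀ e₁ r r' δ ε ∧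
      0 ∈ e₀.target ∧ e₀.symm 0 = y₀ ∧ c.symm '' coordBox m r δ ε ⊆ U := by
  obtain ⟨ωZ, c₀, c, c₁, e₀, e₁, δ₁, hωZ, hc₀, hc, hc₁, he₀, he₁, h0c, hcs, h0e₀, he₀s, hδ₁, hev⟩ :=
    exists_passage_charts hσ hH hS₀ hS₁ hR hinj hy₀ hτ hx₀
  have hcU : ∀ᶠ w in 𝓝 (0 : Euc (m + 2)), c.symm w ∈ U := by
    have h1 := c.continuousAt_symm h0c
    rw [ContinuousAt, hcs] at h1
    exact h1.eventually hU
  obtain ⟨ρ, hρ, hbox⟩ := exists_box_subset (hev.and hcU)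
  refine ⟨ωZ, c₀, c, c₁, e₀, e₁, ρ / 2, ρ, min (ρ / 2) (δ₁ / 2), ρ / 2, ⟨hωZ, hc₀, hc, hc₁, he₀, he₁,
    half_pos hρ, half_lt_self hρ, by positivity, half_pos hρ, fun w hz he ht => ?_⟩, h0e₀, he₀s, ?_⟩
  · refine ((hbox w hz (by rwa [ht, abs_zero]) (by linarith)).1 ht).mono ?_
    linarith [min_le_right (ρ / 2) (δ₁ / 2)]
  · rintro _ ⟨w, ⟨hz, ht, he⟩, rfl⟩
    exact (hbox w (by linarith) (by linarith [min_le_left (ρ / 2) (δ₁ / 2)]) (by linarith)).2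

end Passages

/-! ### The realization theorem -/

/-- The realization theorem, for a manifold of dimension `m + 2`. Only the injectivity of the Poincaré
map `R` is needed. -/
theorem exists_realization {d m : ℕ} (hd : d = m + 2) (hm : 2 ≤ m)
    {Ω : Type*} [TopologicalSpace Ω] [T2Space Ω]
    [ChartedSpace (Euc d) Ω] [IsManifold (𝓡 d) ∞ Ω]
    (σ : TwoForm d Ω) (hσ : IsSymplecticForm σ) (H : C^∞⟮𝓡 d, Ω; 𝓘(ℝ, ℝ), ℝ⟯)
    (S₀ S₁ : Set Ω) (hS₀ : IsSection σ H S₀) (hS₁ : IsSection σ H S₁)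
    (R : Ω → Ω) (τ : Ω → ℝ) (hR : ∀ x ∈ S₀, IsFirstHit σ H S₁ x (τ x) (R x))
    (hinj : InjOn R S₀) (y₀ : Ω) (hy₀ : y₀ ∈ S₀) (hτ : ContinuousWithinAt τ S₀ y₀)
    (x₀ : Ω) (hx₀ : IsBetween σ H S₁ y₀ x₀) (U : Set Ω) (hU : U ∈ 𝓝 x₀) :
    ∃ V ⊆ slice H S₀ (H x₀), V ∈ 𝓝[slice H S₀ (H x₀)] y₀ ∧
      ∀ 𝓗 : Set (C^∞⟮𝓡 d, Ω; 𝓘(ℝ, ℝ), ℝ⟯), IsWhitneyNhd H 𝓗 →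
        ∃ 𝓢 : Set (Ω → Ω),
          IsWeakNhd (d := d) m (slice H S₀ (H x₀)) (slice H S₁ (H x₀)) R 𝓢 ∧
          ∀ R' ∈ 𝓢, IsSmoothMap (d := d) (slice H S₀ (H x₀)) (slice H S₁ (H x₀)) R' →
            IsSymplecticOn σ m (slice H S₀ (H x₀)) R' →
            (∀ x ∈ slice H S₀ (H x₀), x ∉ V → R' x = R x) →
            ∃ H' ∈ 𝓗, (∀ x, x ∉ U → H' x = H x) ∧
              IsSection σ H' S₀ ∧ IsSection σ H' S₁ ∧
              slice H' S₀ (H x₀) = slice H S₀ (H x₀) ∧ slice H' S₁ (H x₀) = slice H S₁ (H x₀) ∧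
              IsPoincareMapOn σ H' (slice H S₀ (H x₀)) S₁ R' := by
  subst hd
  have hH : ContMDiff (𝓡 (m + 2)) 𝓘(ℝ, ℝ) ∞ H := H.contMDiff
  obtain ⟨ωZ, c₀, c, c₁, e₀, e₁, r, r', δ, ε, hP, h0, rfl, hBU⟩ :=
    exists_isPassage hσ hH hS₀ hS₁ hR hinj hy₀ hτ hx₀ hU
  refine ⟨labelBall e₀ r, fun x hx => (hP.labelBall_subset hx).1, hP.labelBall_mem_nhdsWithin h0,
    ?_⟩
  rintro 𝓗 ⟨N, e, K, εs, hK, hKe, h𝓗⟩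
  obtain ⟨β, hβ⟩ := exists_isRamp hP.δ_pos
  obtain ⟨χ, hχs, hχ1, hχ0⟩ := exists_cutoff hP.ε_pos
  have : Nontrivial (Euc m) := Module.nontrivial_of_finrank_pos (R := ℝ) (by
    rw [finrank_euclideanSpace_fin]
    omega)
  obtain ⟨p₀, hp₀⟩ := NormedSpace.exists_lt_norm ℝ (Euc m) r
  have hBc : coordBox m r δ ε ⊆ c.target := fun w hw => hP.mem_target (hP.coordBox_subset hw)
  obtain ⟨n, η, hη, hn⟩ := exists_forall_perturbedEnergy_lt (N := N) H ωZ p₀ hβ.contDiff hβ.mem_Icc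
    hχs (isCompact_closedBall (0 : Euc m) r) hP.flow.mem (isCompact_coordBox r δ ε) hBc hK hKe
    (half_pos hP.ε_pos)
  set C := ‖(zc : Euc (m + 2) →L[ℝ] Euc m)‖ with hC
  have hC0 : 0 ≤ C := norm_nonneg _
  set η' := η / (C + 1) with hη'
  have hη'0 : 0 < η' := by positivity
  have hCη : C * η' ≤ η := by
    calc C * η' ≤ (C + 1) * η' := by gcongr; linarith
      _ = η := mul_div_cancel₀ _ (by positivity)
  refine ⟨{g | MapsTo g (labelBall e₀ r) e₁.source ∧ ∀ k ≤ n, ∀ w : Euc m,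
      zIncl w ∈ e₀.target → e₀.symm (zIncl w) ∈ labelBall e₀ r →
        ‖iteratedFDeriv ℝ k (fun u : Euc m => e₁ (g (e₀.symm (zIncl u))) -
          e₁ (R (e₀.symm (zIncl u)))) w‖ < η'}, ?_, ?_⟩
  · exact ⟨n, 1, fun _ => e₀, fun _ => e₁, fun _ => labelBall e₀ r, η', hη'0, fun _ =>
      ⟨hP.section₀.isSliceChart hP.flow₀, hP.section₁.isSliceChart hP.flow₁, hP.isCompact_labelBall,
        hP.labelBall_subset, hP.mapsTo_labelBall⟩, fun g _ hg => hg 0⟩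
  rintro R' ⟨hmap, hclose⟩ hsm hsymp heq
  have hL : IsLocalModification σ H S₀ S₁ R (H x₀) e₀ e₁ r R' := ⟨hsm, hsymp, heq, hmap⟩
  set a := displacement e₀ e₁ r R' with ha
  have has := hL.contDiff_displacement hP
  obtain ⟨ha4, hM⟩ := hn a has (fun x hx => displacement_eq_zero (by simpa using hx))
    fun k hk x => (hL.norm_iteratedFDeriv_displacement_le hP hη'0.le (hclose k hk) x).trans hCη
  have hA : IsSymplecticPerturbation ωZ r a :=
    ⟨has, ha4, hL.symplectic_displacement hP, fun x hx => displacement_eq_zero hx⟩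
  have hM0 : ∀ w ∉ coordBox m r δ ε, modelEnergy ωZ β χ p₀ a w = 0 := by
    intro w hw
    refine hA.modelEnergy_eq_zero hP.antisymm hm hP.r_pos hβ hχ0 hp₀ ?_
    by_contra! h1
    exact hw ⟨h1.1, h1.2.1, h1.2.2.le⟩
  obtain ⟨hM1, hM2⟩ := hM hM0
  have hMs : ContDiff ℝ ∞ (modelEnergy ωZ β χ p₀ a) :=
    contDiff_modelEnergy hβ.contDiff hβ.mem_Icc hχs has ha4
  have hB := isCompact_coordBox (m := m) r δ ε
  have hBS₀ : ∀ w ∈ coordBox m r δ ε, c.symm w ∉ S₀ := fun w hw =>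
    hP.notMem₀ (hP.coordBox_subset hw)
  have hBS₁ : ∀ w ∈ coordBox m r δ ε, c.symm w ∉ S₁ := fun w hw =>
    hP.notMem₁ (hP.coordBox_subset hw)
  refine ⟨⟨perturbedEnergy H c (modelEnergy ωZ β χ p₀ a),
    contMDiff_perturbedEnergy hH hP.flow.mem hMs hB hBc hM0⟩, h𝓗 _ hM2, fun x hx =>
      perturbedEnergy_of_notMem hM0 fun h1 => hx (hBU h1),
    hS₀.perturbedEnergy hB hBc hM0 hBS₀, hS₁.perturbedEnergy hB hBc hM0 hBS₁,
    slice_perturbedEnergy hM0 hBS₀ _, slice_perturbedEnergy hM0 hBS₁ _, ?_⟩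
  refine hP.isPoincareMapOn hσ hH hinj hR hA hβ hχs hχ1 hM0 hM1 (fun q hq => ?_) heq
  exact (hL.apply_symm hP (hq.trans_lt hP.r_lt)).2

end PoincareSection

open PoincareSection in
theorem mainTheorem5 {n : ℕ} (hn : 2 ≤ n)
    {Ω : Type*} [TopologicalSpace Ω] [T2Space Ω] [SecondCountableTopology Ω]
    [ChartedSpace (Euc (2 * n)) Ω] [IsManifold (𝓡 (2 * n)) ∞ Ω]
    (σ : TwoForm (2 * n) Ω) (hσ : IsSymplecticForm σ)
    (H : C^∞⟮𝓡 (2 * n), Ω; 𝓘(ℝ, ℝ), ℝ⟯)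
    -- two sections between which the Poincare map `R`, with hitting time `τ`, is a diffeomorphism
    (S₀ S₁ : Set Ω) (hS₀ : IsSection σ H S₀) (hS₁ : IsSection σ H S₁)
    (R : Ω → Ω) (τ : Ω → ℝ) (hR : ∀ x ∈ S₀, IsFirstHit σ H S₁ x (τ x) (R x))
    (hRdiffeo : IsDiffeoBetween (d := 2 * n) S₀ S₁ R)
    (y₀ : Ω) (hy₀ : y₀ ∈ S₀) (hτ : ContinuousWithinAt τ S₀ y₀)
    (x₀ : Ω) (hx₀ : IsBetween σ H S₁ y₀ x₀)
    (h : ℝ) (hh : h = H x₀) :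
    ∀ U ∈ 𝓝 x₀, ∃ V ⊆ slice H S₀ h, V ∈ 𝓝[slice H S₀ h] y₀ ∧
      ∀ 𝓗 : Set (C^∞⟮𝓡 (2 * n), Ω; 𝓘(ℝ, ℝ), ℝ⟯), IsWhitneyNhd H 𝓗 →
        ∃ 𝓢 : Set (Ω → Ω),
          IsWeakNhd (d := 2 * n) (2 * n - 2) (slice H S₀ h) (slice H S₁ h) R 𝓢 ∧
          ∀ R' ∈ 𝓢, IsSmoothMap (d := 2 * n) (slice H S₀ h) (slice H S₁ h) R' →
            IsSymplecticOn σ (2 * n - 2) (slice H S₀ h) R' →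
            (∀ x ∈ slice H S₀ h, x ∉ V → R' x = R x) →
            ∃ H' ∈ 𝓗, (∀ x, H x = h → x ∉ U → H' x = H x) ∧
              -- `S₀`, `S₁` are sections for `H'` with the same slices, and `R'` is the Poincare
              -- map of `H'` on the slice
              IsSection σ H' S₀ ∧ IsSection σ H' S₁ ∧
              slice H' S₀ h = slice H S₀ h ∧ slice H' S₁ h = slice H S₁ h ∧
              IsPoincareMapOn σ H' (slice H S₀ h) S₁ R' := by
  intro U hU
  subst hh
  obtain ⟨g, -, hg⟩ := hRdiffeo.2
  obtain ⟨V, hV, hVy, H₁⟩ := exists_realization (m := 2 * n - 2) (by omega) (by omega) σ hσ H S₀ S₁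
    hS₀ hS₁ R τ hR hg.1.injOn y₀ hy₀ hτ x₀ hx₀ U hU
  refine ⟨V, hV, hVy, fun 𝓗 h𝓗 => ?_⟩
  obtain ⟨𝓢, h𝓢, H₂⟩ := H₁ 𝓗 h𝓗
  refine ⟨𝓢, h𝓢, fun R' hR' hsm hsymp heq => ?_⟩
  obtain ⟨H', hH', hU', H₃⟩ := H₂ R' hR' hsm hsymp heq
  exact ⟨H', hH', fun x _ hx => hU' x hx, H₃⟩
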